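/- Let $F$ be a non-archimedean local field of residue characteristic $p\neq 2$, $F^s$ a separable closure, $\Gamma=\mathrm{Gal}(F^s/F)$ and $\Sigma=\Gamma\times\{\pm1\}$. Let $R,R'$ be finite sets with an action of $\Sigma$, continuous for $\Gamma$, on which $-1\in\Sigma$ has no fixed point. For $\alpha\in R$ let $\Gamma_\alpha$ and $\Gamma_{\pm\alpha}$ be the stabilizers in $\Gamma$ of $\alpha$ and of $\{\alpha,-\alpha\}$, and $F_\alpha\supseteq F_{\pm\alpha}$ their fixed fields in $F^s$. Call $\alpha$ symmetric if $-\alpha\in\Gamma\alpha$, i.e. $[F_\alpha:F_{\pm\alpha}]=2$, and asymmetric otherwise; a symmetric $\alpha$ is ramified or unramified according to whether $F_\alpha/F_{\pm\alpha}$ is. For symmetric $\alpha$ let $\tau_\alpha$ be the non-trivial element of $\Gamma_{\pm\alpha}/\Gamma_\alpha$ and $\kappa_\alpha:F_{\pm\alpha}^\times\to\{\pm1\}$ the quadratic character with kernel $N_{F_\alpha/F_{\pm\alpha}}(F_\alpha^\times)$. The same notation is used for $R'$. A set of $\chi$-data (resp. $\zeta$-data) for $R$ consists of characters $\chi_\alpha:F_\alpha^\times\to\mathbb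 C^\times$, $\alpha\in R$, with $\chi_{\sigma\alpha}=\chi_\alpha\circ\sigma^{-1}$ for $\sigma\in\Gamma$, $\chi_{-\alpha}=\chi_\alpha^{-1}$, and, for symmetric $\alpha$, $\chi_\alpha|_{F_{\pm\alpha}^\times}=\kappa_\alpha$ (resp. $=1$). $\chi$-data are minimally ramified if $\chi_\alpha$ is trivial for asymmetric $\alpha$, unramified for symmetric unramified $\alpha$, and tamely ramified for symmetric ramified $\alpha$. Let $S$ be a torus over $F$, let $R\to X^*(S)$, $\alpha\mapsto\bar\alpha$, be a $\Sigma$-equivariant map, where $-1\in\Sigma$ acts on $X^*(S)$ by negation, and let $R\to R'$, $\alpha\mapsto\alpha'$, be a surjective $\Sigma$-equivariant map. Let $T$ be the torus over $F$ whose character module is the $\mathbb Z$-span of $\{\bar\alpha:\alpha\in R\}$ in $X^*(S)$, and let $S(F)_c$ be the preimage of the maximal bounded subgroup $T(F)_b\subseteq T(F)$ under the natural map $S(F)\to T(F)$. For $\zeta$-data $\zeta$ for $R$, the character $\zeta_S:S(F)\to\mathbb C^\times$ is the product over the $\Sigma$-orbits in $R$, with representatives $\alpha$, of the factors $\zeta_\alpha(\bar\alpha(\gamma))$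 if $\alpha$ is asymmetric, and $\zeta_\alpha(\delta)$ with $\delta\in F_\alpha^\times$, $\delta/\tau_\alpha(\delta)=\bar\alpha(\gamma)$, if $\alpha$ is symmetric. Let $\chi'$ be minimally ramified $\chi$-data for $R'$. Put $(\inf\chi')_\alpha=\chi'_{\alpha'}\circ N_{F_\alpha/F_{\alpha'}}$. Let $(\min\inf\chi')_\alpha$ be $1$ if $\alpha$ is asymmetric, the unique unramified extension of $\kappa_\alpha$ to $F_\alpha^\times$ if $\alpha$ is symmetric unramified, and $(\inf\chi')_\alpha$ if $\alpha$ is symmetric ramified. Then $\zeta_\alpha=(\min\inf\chi')_\alpha\cdot(\inf\chi')_\alpha^{-1}$ is a set of $\zeta$-data for $R$. For every $\gamma\in S(F)_c$ and $\alpha\in R$ one has $\bar\alpha(\gamma)\in O_{F_\alpha}^\times$, and if $\alpha$ is symmetric unramified then the image of $\bar\alpha(\gamma)$ in the residue field $k_\alpha$ of $F_\alpha$ lies in the group $k_\alpha^1$ of elements of norm $1$ to the residue field of $F_{\pm\alpha}$. The restriction of the character $\zeta_S$ to $S(F)_c$ is \[ \gamma\longmapsto\prod_{\substack{\alpha\in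 R_{\mathrm{asym}}/\Sigma\\ \alpha'\in R'_{\mathrm{sym,ram}}}}\mathrm{sgn}_{k_\alpha^\times}(\bar\alpha(\gamma))^{e(\alpha/\alpha')}\cdot\prod_{\substack{\alpha\in R_{\mathrm{sym,unram}}/\Gamma\\ \alpha'\in R'_{\mathrm{sym,ram}}}}\mathrm{sgn}_{k_\alpha^1}(\bar\alpha(\gamma))^{e(\alpha/\alpha')}, \] where $\mathrm{sgn}$ is the unique non-trivial $\{\pm1\}$-valued character of the cyclic groups $k_\alpha^\times$ and $k_\alpha^1$ of even order, applied to the image of $\bar\alpha(\gamma)$, and $e(\alpha/\alpha')$ is the ramification index of $F_\alpha/F_{\alpha'}$. In particular this restriction is independent of $\chi'$. -/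

import Mathlib

open scoped TensorProduct

noncomputable section

namespace TorusSigns

/-! ### Rings of integers in algebraic extensions of a local field -/

section Integers

open scoped Valued in
/-- In an algebraic extension `L` of a non-archimedean local field `F`, the integral closure of the
ring of integers of `F` is a valuation ring. -/
theorem isIntegral_or_isIntegral_inv (F : Type*) [Field F] [ValuativeRel F] [TopologicalSpace F]
    [IsNonarchimedeanLocalField F] (L : Type*) [Field L] [Algebra F L] [Algebra.IsAlgebraic F L]
    (x : L) : IsIntegral (ValuativeRel.valuation F).integer x ∨
      IsIntegral (ValuativeRel.valuation F).integer x⁻¹ := by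
  let := IsTopologicalAddGroup.rightUniformSpace F
  have := isUniformAddGroup_of_addCommGroup (G := F)
  let : (Valued.v (R := F)).RankOne :=
    { hom' := ValuativeRel.IsRankLeOne.nonempty.some.emb (R := F) |>.comp
        MonoidWithZeroHom.ValueGroup₀.embedding
      strictMono' := ValuativeRel.IsRankLeOne.nonempty.some.strictMono.comp
        MonoidWithZeroHom.ValueGroup₀.embedding_strictMono }
  have : CompleteSpace F := inferInstance
  have key : ∀ y : L, spectralNorm F L y ≤ 1 →
      IsIntegral (ValuativeRel.valuation F).integer y := by
    intro y hy
    have hm : (minpoly F y).Monic := minpoly.monic (Algebra.IsIntegral.isIntegral y)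
    rw [spectralNorm, spectralValue_le_one_iff hm] at hy
    have hl : minpoly F y ∈
        Polynomial.lifts (algebraMap (ValuativeRel.valuation F).integer F) := by
      rw [Polynomial.lifts_iff_coeff_lifts]
      intro n
      exact ⟨⟨(minpoly F y).coeff n, (Valued.toNormedField.norm_le_one_iff).1 (hy n)⟩, rfl⟩
    obtain ⟨q, hq, -, hqm⟩ := Polynomial.lifts_and_natDegree_eq_and_monic hl hm
    refine ⟨q, hqm, ?_⟩
    have := minpoly.aeval F y
    rw [← hq, Polynomial.aeval_map_algebraMap] at this
    exact this
  by_cases h0 : x = 0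
  · exact Or.inl (h0 ▸ isIntegral_zero)
  have hmul : spectralNorm F L x * spectralNorm F L x⁻¹ = 1 := by
    have := spectralAlgNorm_mul (K := F) x x⁻¹
    rw [mul_inv_cancel₀ h0] at this
    simp only [spectralAlgNorm_def, spectralNorm_one] at this
    exact this.symm
  rcases le_or_gt (spectralNorm F L x) 1 with h | h
  · exact Or.inl (key x h)
  · refine Or.inr (key _ ?_)
    by_contra h2
    push Not at h2
    nlinarith

variable {F Fs : Type*} [Field F] [ValuativeRel F] [TopologicalSpace F]
  [IsNonarchimedeanLocalField F] [Field Fs] [Algebra F Fs] [IsSepClosure F Fs]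

theorem isAlgebraic_of_isSepClosure (F Fs : Type*) [Field F] [Field Fs] [Algebra F Fs]
    [IsSepClosure F Fs] (L : IntermediateField F Fs) : Algebra.IsAlgebraic F L := by
  have : Algebra.IsSeparable F Fs := IsSepClosure.separable
  infer_instance

/-- The ring of integers `O_L` of an algebraic extension `L` of `F` inside `Fs`: the integral
closure in `L` of the ring of integers of `F`. -/
def integers (L : IntermediateField F Fs) : ValuationSubring L :=
  { (integralClosure (ValuativeRel.valuation F).integer L).toSubring with
    mem_or_inv_mem' := fun x => by
      have := isAlgebraic_of_isSepClosure F Fs L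
      exact isIntegral_or_isIntegral_inv F L x }

theorem mem_integers {L : IntermediateField F Fs} {x : L} :
    x ∈ integers L ↔ IsIntegral (ValuativeRel.valuation F).integer x := Iff.rfl

theorem inclusion_mem_integers {K L : IntermediateField F Fs} (h : K ≤ L) {x : K} :
    IntermediateField.inclusion h x ∈ integers L ↔ x ∈ integers K := by
  rw [mem_integers, mem_integers]
  exact isIntegral_algHom_iff
    ((IntermediateField.inclusion h).restrictScalars (ValuativeRel.valuation F).integer)
    (IntermediateField.inclusion_injective h)

/-- The inclusion `O_K → O_L` for `K ⊆ L`. -/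
def integersMap {K L : IntermediateField F Fs} (h : K ≤ L) : integers K →+* integers L :=
  ((IntermediateField.inclusion h).toRingHom.comp (integers K).subtype).codRestrict
    (integers L) fun x => (inclusion_mem_integers h).2 x.2

instance integersMap_isLocalHom {K L : IntermediateField F Fs} (h : K ≤ L) :
    IsLocalHom (integersMap h) where
  map_nonunit a ha := by
    obtain ⟨b, hb⟩ := ha.exists_right_inv
    have hb' : IntermediateField.inclusion h (a : K) * (b : L) = 1 := congrArg Subtype.val hb
    have hb'' : (b : L) = IntermediateField.inclusion h ((a : K)⁻¹) := by
      rw [map_inv₀]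
      exact eq_inv_of_mul_eq_one_right hb'
    have ha0 : (a : K) ≠ 0 := by
      intro h0
      rw [h0, map_zero, zero_mul] at hb'
      exact zero_ne_one hb'
    have hmem : (a : K)⁻¹ ∈ integers K := (inclusion_mem_integers h).1 (hb'' ▸ b.2)
    exact IsUnit.of_mul_eq_one ⟨(a : K)⁻¹, hmem⟩ (Subtype.ext (mul_inv_cancel₀ ha0))

/-- The residue field `k_L` of `L`. -/
abbrev ResidueField (L : IntermediateField F Fs) : Type _ := IsLocalRing.ResidueField (integers L)

/-- The ramification index `e(L/K)`, for `K ⊆ L`. -/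
def ramIndex {K L : IntermediateField F Fs} (h : K ≤ L) : ℕ :=
  letI : Algebra (integers K) (integers L) := (integersMap h).toAlgebra
  Ideal.ramificationIdx' (IsLocalRing.maximalIdeal (integers K))
    (IsLocalRing.maximalIdeal (integers L))

/-- The inclusion `Kˣ → Lˣ` for `K ⊆ L`. -/
def unitsIncl {K L : IntermediateField F Fs} (h : K ≤ L) : Kˣ →* Lˣ :=
  Units.map (IntermediateField.inclusion h).toRingHom.toMonoidHom

/-- The norm `N_{L/K} : Lˣ → Kˣ` for `K ⊆ L`. -/
def unitsNorm {K L : IntermediateField F Fs} (h : K ≤ L) : Lˣ →* Kˣ :=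
  letI : Algebra K L := (IntermediateField.inclusion h).toRingHom.toAlgebra
  Units.map (Algebra.norm K)

/-- The subgroup `k_L^1` of elements of `k_Lˣ` whose norm to `k_Kˣ` is `1`. -/
def residueNormOne {K L : IntermediateField F Fs} (h : K ≤ L) : Subgroup (ResidueField L)ˣ :=
  letI : Algebra (ResidueField K) (ResidueField L) :=
    (IsLocalRing.ResidueField.map (integersMap h)).toAlgebra
  (Units.map (Algebra.norm (ResidueField K) (S := ResidueField L))).ker

/-- A homomorphism `Lˣ → ℂˣ` is continuous, for the valuation topology of `L`. -/
def IsContinuousChar {L : IntermediateField F Fs} (χ : Lˣ →* ℂˣ) : Prop :=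
  letI := Valued.mk' (integers L).valuation
  Continuous χ

/-- `χ` is unramified: trivial on `O_Lˣ`. -/
def IsUnramifiedChar {L : IntermediateField F Fs} (χ : Lˣ →* ℂˣ) : Prop :=
  (integers L).unitGroup ≤ χ.ker

/-- `χ` is tamely ramified: trivial on `1 + 𝔪_L`. -/
def IsTameChar {L : IntermediateField F Fs} (χ : Lˣ →* ℂˣ) : Prop :=
  (integers L).principalUnitGroup ≤ χ.ker

end Integers

/-! ### Sign characters -/

section Sign

open scoped Classical in
/-- The sign character of a (cyclic group of even order) `G`: it is `1` on squares and `-1` on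
non-squares. -/
def sgn {G : Type*} [Group G] (x : G) : ℤˣ := if IsSquare x then 1 else -1

variable {F Fs : Type*} [Field F] [ValuativeRel F] [TopologicalSpace F]
  [IsNonarchimedeanLocalField F] [Field Fs] [Algebra F Fs] [IsSepClosure F Fs]

open scoped Classical in
/-- `sgn_{k_Lˣ}` of the image in `k_Lˣ` of an element of `O_Lˣ`. (The value outside `O_Lˣ` is
irrelevant.) -/
def sgnResidue {L : IntermediateField F Fs} (x : Lˣ) : ℤˣ :=
  if hx : x ∈ (integers L).unitGroup then
    sgn ((integers L).unitGroupToResidueFieldUnits ⟨x, hx⟩)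
  else 1

/-- `x` lies in `O_Lˣ` and its image in `k_Lˣ` lies in `k_L^1` (relative to `k_K`). -/
def HasResidueNormOne {K L : IntermediateField F Fs} (h : K ≤ L) (x : Lˣ) : Prop :=
  ∃ hx : x ∈ (integers L).unitGroup,
    (integers L).unitGroupToResidueFieldUnits ⟨x, hx⟩ ∈ residueNormOne h

open scoped Classical in
/-- `sgn_{k_L^1}` of the image in `k_L^1` of an element of `O_Lˣ` whose image in `k_Lˣ` lies
in `k_L^1`. (The value on other elements is irrelevant.) -/
def sgnResidueNormOne {K L : IntermediateField F Fs} (h : K ≤ L) (x : Lˣ) : ℤˣ :=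
  if hx : HasResidueNormOne h x then
    sgn (⟨(integers L).unitGroupToResidueFieldUnits ⟨x, hx.1⟩, hx.2⟩ : residueNormOne h)
  else 1

end Sign

/-! ### `Σ`-sets -/

section SigmaSets

/-- `Σ = Γ × {±1}`, where `Γ` is the Galois group of `Fs / F`. -/
abbrev Sig (F Fs : Type*) [Field F] [Field Fs] [Algebra F Fs] : Type _ := (Fs ≃ₐ[F] Fs) × ℤˣ

variable (F Fs : Type*) [Field F] [Field Fs] [Algebra F Fs]
variable {R : Type*} [MulAction (Sig F Fs) R]

/-- The action of `-1 ∈ {±1} ⊆ Σ`. -/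
def neg (α : R) : R := ((1, -1) : Sig F Fs) • α

variable {F Fs} in
/-- The action of `σ ∈ Γ ⊆ Σ`. -/
def gal (σ : Fs ≃ₐ[F] Fs) (α : R) : R := ((σ, 1) : Sig F Fs) • α

variable (R) in
/-- `-1 ∈ Σ` does not fix any element. -/
def IsAdmissible : Prop := ∀ α : R, neg F Fs α ≠ α

/-- `Γ_α`, the stabilizer of `α` in `Γ`. -/
def stab (α : R) : Subgroup (Fs ≃ₐ[F] Fs) :=
  (MulAction.stabilizer (Sig F Fs) α).comap (MonoidHom.inl _ _)

open scoped Pointwise in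
/-- `Γ_{±α}`, the stabilizer of the set `{α, -α}` in `Γ`. -/
def stabPM (α : R) : Subgroup (Fs ≃ₐ[F] Fs) :=
  (MulAction.stabilizer (Sig F Fs) ({α, neg F Fs α} : Set R)).comap (MonoidHom.inl _ _)

variable (R) in
/-- `Γ` acts continuously on the discrete set `R`: all stabilizers are open in the Krull
topology. -/
def IsContinuousAction : Prop := ∀ α : R, IsOpen (stab F Fs α : Set (Fs ≃ₐ[F] Fs))

/-- `F_α`, the fixed field of `Γ_α`. -/
def fld (α : R) : IntermediateField F Fs := IntermediateField.fixedField (stab F Fs α)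

/-- `F_{±α}`, the fixed field of `Γ_{±α}`. -/
def fldPM (α : R) : IntermediateField F Fs := IntermediateField.fixedField (stabPM F Fs α)

variable {F Fs} in
theorem mem_stab {α : R} {σ : Fs ≃ₐ[F] Fs} : σ ∈ stab F Fs α ↔ gal σ α = α := Iff.rfl

open scoped Pointwise in
theorem stab_le_stabPM (α : R) : stab F Fs α ≤ stabPM F Fs α := by
  intro σ hσ
  have h1 : ((σ, 1) : Sig F Fs) • α = α := hσ
  have h2 : ((σ, 1) : Sig F Fs) • neg F Fs α = neg F Fs α := by
    conv_rhs => rw [← h1]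
    simp only [neg, smul_smul, Prod.mk_mul_mk, one_mul, mul_one]
  change ((σ, 1) : Sig F Fs) • ({α, neg F Fs α} : Set R) = {α, neg F Fs α}
  rw [← Set.image_smul, Set.image_pair, h1, h2]

theorem fldPM_le_fld (α : R) : fldPM F Fs α ≤ fld F Fs α := by
  intro x hx σ
  exact hx ⟨σ.1, stab_le_stabPM F Fs α σ.2⟩

variable {F Fs} in
theorem fld_map_le {R' : Type*} [MulAction (Sig F Fs) R'] (f : R →[Sig F Fs] R') (α : R) :
    fld F Fs (f α) ≤ fld F Fs α := by
  intro x hx σ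
  refine hx ⟨σ.1, ?_⟩
  have h : ((σ.1, 1) : Sig F Fs) • α = α := σ.2
  change ((σ.1, 1) : Sig F Fs) • f α = f α
  rw [← map_smul, h]

/-- `α` is symmetric: its `Σ`-orbit is a single `Γ`-orbit, that is, `-α ∈ Γα`. -/
def IsSym (α : R) : Prop := ∃ σ : Fs ≃ₐ[F] Fs, gal σ α = neg F Fs α

section Local

variable [ValuativeRel F] [TopologicalSpace F] [IsNonarchimedeanLocalField F] [IsSepClosure F Fs]

/-- `α` is symmetric and `F_α / F_{±α}` is unramified. -/
def IsSymUnram (α : R) : Prop := IsSym F Fs α ∧ ramIndex (fldPM_le_fld F Fs α) = 1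

/-- `α` is symmetric and `F_α / F_{±α}` is ramified. -/
def IsSymRam (α : R) : Prop := IsSym F Fs α ∧ ramIndex (fldPM_le_fld F Fs α) ≠ 1

end Local

/-! ### `χ`-data and `ζ`-data -/

variable (R) in
/-- A family of homomorphisms `χ_α : F_αˣ → ℂˣ`, `α ∈ R`. -/
abbrev CharFamily : Type _ := ∀ α : R, (fld F Fs α)ˣ →* ℂˣ

section Data

variable [ValuativeRel F] [TopologicalSpace F] [IsNonarchimedeanLocalField F] [IsSepClosure F Fs]

open scoped Classical in
/-- The quadratic character `κ_α` of `F_{±α}ˣ` attached to `F_α / F_{±α}` for symmetric `α`: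
it is `1` on norms from `F_αˣ` (a subgroup of index two) and `-1` elsewhere. -/
def kappa (α : R) (x : (fldPM F Fs α)ˣ) : ℂˣ :=
  if x ∈ (unitsNorm (fldPM_le_fld F Fs α)).range then 1 else -1

variable {F Fs}

/-- The conditions common to `χ`-data and `ζ`-data: every member is a (continuous) character,
`χ_{σα} = χ_α ∘ σ⁻¹`, and `χ_{-α} = χ_α⁻¹` (where `F_{-α} = F_α`). -/
structure IsEquivariantFamily (χ : CharFamily F Fs R) : Prop where
  continuous : ∀ α, IsContinuousChar (χ α)
  gal : ∀ (σ : Fs ≃ₐ[F] Fs) (α : R) (x : (fld F Fs α)ˣ) (y : (fld F Fs (gal σ α))ˣ),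
    ((y : fld F Fs (TorusSigns.gal σ α)) : Fs) = σ ((x : fld F Fs α) : Fs) →
      χ (TorusSigns.gal σ α) y = χ α x
  neg : ∀ (α : R) (x : (fld F Fs α)ˣ) (y : (fld F Fs (neg F Fs α))ˣ),
    ((y : fld F Fs (TorusSigns.neg F Fs α)) : Fs) = ((x : fld F Fs α) : Fs) →
      χ (TorusSigns.neg F Fs α) y = (χ α x)⁻¹

/-- A set of `χ`-data for `R`. -/
structure IsChiData (χ : CharFamily F Fs R) : Prop extends IsEquivariantFamily χ where
  restrict : ∀ α : R, IsSym F Fs α → ∀ x : (fldPM F Fs α)ˣ,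
    χ α (unitsIncl (fldPM_le_fld F Fs α) x) = kappa F Fs α x

/-- A set of `ζ`-data for `R`. -/
structure IsZetaData (ζ : CharFamily F Fs R) : Prop extends IsEquivariantFamily ζ where
  restrict : ∀ α : R, IsSym F Fs α → ∀ x : (fldPM F Fs α)ˣ,
    ζ α (unitsIncl (fldPM_le_fld F Fs α) x) = 1

/-- A set of minimally ramified `χ`-data for `R`. -/
structure IsMinimallyRamified (χ : CharFamily F Fs R) : Prop extends IsChiData χ where
  asym : ∀ α : R, ¬ IsSym F Fs α → χ α = 1
  unram : ∀ α : R, IsSymUnram F Fs α → IsUnramifiedChar (χ α)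
  ram : ∀ α : R, IsSymRam F Fs α → IsTameChar (χ α)

/-- `inf χ'`, the family `α ↦ χ'_{f(α)} ∘ N_{F_α / F_{f(α)}}`. -/
def infData {R' : Type*} [MulAction (Sig F Fs) R'] (f : R →[Sig F Fs] R')
    (χ' : CharFamily F Fs R') : CharFamily F Fs R :=
  fun α => (χ' (f α)).comp (unitsNorm (fld_map_le f α))

variable (F Fs) in
/-- The unramified extension of `κ_α` to `F_αˣ`, for symmetric unramified `α`; it exists and is
unique in that case. -/
def unramExtension (α : R) : (fld F Fs α)ˣ →* ℂˣ :=
  Classical.epsilon fun ψ => IsUnramifiedChar ψ ∧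
    ∀ x : (fldPM F Fs α)ˣ, ψ (unitsIncl (fldPM_le_fld F Fs α) x) = kappa F Fs α x

open scoped Classical in
/-- `min χ`: trivial at asymmetric `α`, the unramified extension of `κ_α` at symmetric unramified
`α`, and `χ_α` at symmetric ramified `α`. -/
def minData (χ : CharFamily F Fs R) : CharFamily F Fs R := fun α =>
  if IsSym F Fs α then
    if IsSymUnram F Fs α then unramExtension F Fs α else χ α
  else 1

/-- The family `ζ = (min inf χ') · (inf χ')⁻¹`. -/
def zetaData {R' : Type*} [MulAction (Sig F Fs) R'] (f : R →[Sig F Fs] R')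
    (χ' : CharFamily F Fs R') : CharFamily F Fs R :=
  fun α => minData (infData f χ') α * (infData f χ' α)⁻¹

end Data

end SigmaSets

/-! ### Tori

An affine group scheme `S` over `F` is given by its coordinate ring `A`, a commutative Hopf algebra
over `F`. The base change to `Fs` has coordinate ring `Fs ⊗[F] A`. -/

section Tori

variable (F Fs : Type*) [Field F] [Field Fs] [Algebra F Fs]

/-- `Spec A` is an algebraic torus over `F`: over the separable closure `Fs` it becomes isomorphic,
as a group scheme, to `𝔾_m ^ n`, whose coordinate ring is the group algebra of `ℤ ^ n`. -/
def IsTorus (A : Type*) [CommRing A] [HopfAlgebra F A] : Prop :=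
  ∃ n : ℕ, Nonempty (Fs ⊗[F] A ≃ₐc[Fs] AddMonoidAlgebra Fs (Fin n → ℤ))

/-- The group `S(F)` of rational points. -/
abbrev Points (A : Type*) [CommRing A] [HopfAlgebra F A] : Type _ := WithConv (A →ₐ[F] F)

/-- The character module `X^*(S)`, written multiplicatively: homomorphisms `S_{Fs} → 𝔾_m` are the
group-like elements of the coordinate ring of `S_{Fs}`. -/
abbrev Chars (A : Type*) [CommRing A] [HopfAlgebra F A] : Type _ := GroupLike Fs (Fs ⊗[F] A)

variable {F Fs}
variable {A : Type*} [CommRing A] [HopfAlgebra F A] {B : Type*} [CommRing B] [HopfAlgebra F B]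
variable {R : Type*} [MulAction (Sig F Fs) R]

/-- The map `α ↦ ᾱ` from `R` to `X^*(S)` is `Σ`-equivariant; `σ ∈ Γ` acts on the functions
`Fs ⊗[F] A` on `S_{Fs}` through `σ ⊗ id`, and `-1` acts on `X^*(S)` by inversion (negation in
additive notation). -/
structure IsSigmaEquivariant (bar : R → Chars F Fs A) : Prop where
  gal : ∀ (σ : Fs ≃ₐ[F] Fs) (α : R), (bar (gal σ α)).val =
    Algebra.TensorProduct.map (σ : Fs →ₐ[F] Fs) (AlgHom.id F A) (bar α).val
  neg : ∀ α : R, bar (neg F Fs α) = (bar α)⁻¹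

/-- Evaluation at `γ ∈ S(F)` of functions on `S_{Fs}`. -/
def evalAt (γ : Points F A) : Fs ⊗[F] A →ₐ[Fs] Fs :=
  Algebra.TensorProduct.lift (AlgHom.id Fs Fs) ((Algebra.ofId F Fs).comp γ.ofConv)
    fun _ _ => Commute.all _ _

theorem evalAt_map (γ : Points F A) (σ : Fs ≃ₐ[F] Fs) (z : Fs ⊗[F] A) :
    evalAt γ (Algebra.TensorProduct.map (σ : Fs →ₐ[F] Fs) (AlgHom.id F A) z)
      = σ (evalAt γ z) := by
  induction z with
  | zero => simp
  | tmul x a => simp [evalAt, Algebra.ofId_apply]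
  | add x y hx hy => simp only [map_add, hx, hy]

/-- The value `ᾱ(γ)`, as an element of `F_αˣ`. -/
def charVal {bar : R → Chars F Fs A} (hbar : IsSigmaEquivariant bar) (α : R) (γ : Points F A) :
    (fld F Fs α)ˣ :=
  Units.mk0 ⟨evalAt γ (bar α).val, by
    intro σ
    change σ.1 (evalAt γ (bar α).val) = _
    rw [← evalAt_map, ← hbar.gal, mem_stab.1 σ.2]⟩ (by
    intro h
    have h0 : evalAt γ (bar α).val = 0 := congrArg Subtype.val h
    exact (((bar α).isGroupLikeElem_val.isUnit).map (evalAt γ)).ne_zero h0)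

/-- The homomorphism `S(F) → T(F)` given by a homomorphism `S → T`, that is, by a bialgebra
homomorphism `φ : B → A` of coordinate rings. -/
def pointsMap (φ : B →ₐc[F] A) : Points F A →* Points F B where
  toFun γ := WithConv.toConv (γ.ofConv.comp (φ : B →ₐ[F] A))
  map_one' := by
    ext b
    simp [AlgHom.convOne_def]
  map_mul' γ δ := congrArg WithConv.toConv (AlgHom.convMul_comp_bialgHom_distrib γ δ φ)

/-- The pullback `X^*(T) → X^*(S)` of characters along `S → T`. -/
def charsMap (φ : B →ₐc[F] A) (χ : Chars F Fs B) : Chars F Fs A :=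
  ⟨Bialgebra.TensorProduct.map (BialgHom.id Fs Fs) φ χ.val, χ.isGroupLikeElem_val.map _⟩

/-- `S → T` is dual to the inclusion into `X^*(S)` of the subgroup generated by the image
of `R`: it identifies `X^*(T)` with that subgroup. -/
structure IsDualToSpan (bar : R → Chars F Fs A) (φ : B →ₐc[F] A) : Prop where
  injective : Function.Injective (charsMap (Fs := Fs) φ)
  range_eq : Set.range (charsMap (Fs := Fs) φ) = (Subgroup.closure (Set.range bar) : Set _)

section Bounded

variable [ValuativeRel F]

/-- A set of rational points is bounded if every regular function is bounded on it. -/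
def IsBoundedSet (U : Set (Points F B)) : Prop :=
  ∀ b : B, ∃ c : ValuativeRel.ValueGroupWithZero F,
    ∀ t ∈ U, ValuativeRel.valuation F (t.ofConv b) ≤ c

variable (F B) in
/-- `T(F)_b`, the largest bounded subgroup of `T(F)`. -/
def boundedSubgroup : Subgroup (Points F B) :=
  sSup {U | IsBoundedSet (U : Set (Points F B))}

/-- `S(F)_c`, the preimage of `T(F)_b` in `S(F)`. -/
def pointsC (φ : B →ₐc[F] A) : Subgroup (Points F A) := (boundedSubgroup F B).comap (pointsMap φ)

end Bounded

section ZetaS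

variable [ValuativeRel F] [TopologicalSpace F] [IsNonarchimedeanLocalField F] [IsSepClosure F Fs]

/-- An element `δ ∈ F_αˣ` with `δ / τ_α(δ) = u`, for symmetric `α` and `u ∈ F_α^1`, where `τ_α` is
the non-trivial element of `Γ_{±α} / Γ_α`. -/
def halfElement (α : R) (u : (fld F Fs α)ˣ) : (fld F Fs α)ˣ :=
  Classical.epsilon fun δ => ∀ τ : Fs ≃ₐ[F] Fs, gal τ α = neg F Fs α →
    ((δ : fld F Fs α) : Fs) / τ ((δ : fld F Fs α) : Fs) = ((u : fld F Fs α) : Fs)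

open scoped Classical in
/-- The contribution to `ζ_S(γ)` of the `Σ`-orbit of `α`: it is `ζ_α(ᾱ(γ))` if `α` is asymmetric,
and `ζ_α(δ)` with `δ / τ_α(δ) = ᾱ(γ)` if `α` is symmetric. For `ζ`-data it does not depend on the
choice of `α` in its orbit or of `δ`. -/
def orbitChar {bar : R → Chars F Fs A} (hbar : IsSigmaEquivariant bar) (ζ : CharFamily F Fs R)
    (α : R) (γ : Points F A) : ℂˣ :=
  if IsSym F Fs α then ζ α (halfElement α (charVal hbar α γ)) else ζ α (charVal hbar α γ)

/-- The values of the character `ζ_S : S(F) → ℂˣ` attached to a set of `ζ`-data: the product of the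
contributions of all `Σ`-orbits in `R`. -/
def zetaS {bar : R → Chars F Fs A} (hbar : IsSigmaEquivariant bar) (ζ : CharFamily F Fs R)
    (γ : Points F A) : ℂˣ :=
  ∏ᶠ O : MulAction.orbitRel.Quotient (Sig F Fs) R, orbitChar hbar ζ O.out γ

open scoped Classical in
/-- The product of `sgn_{k_αˣ}(ᾱ(γ)) ^ e(α/α')` over the asymmetric `Σ`-orbits in `R` with
symmetric ramified image in `R'`, times the product of `sgn_{k_α^1}(ᾱ(γ)) ^ e(α/α')` over the
symmetric unramified orbits in `R` with symmetric ramified image in `R'`. (A symmetric `Σ`-orbit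
is the same as a `Γ`-orbit of symmetric elements.) -/
def signProduct {bar : R → Chars F Fs A} (hbar : IsSigmaEquivariant bar) {R' : Type*}
    [MulAction (Sig F Fs) R'] (f : R →[Sig F Fs] R') (γ : Points F A) : ℤˣ :=
  (∏ᶠ O : MulAction.orbitRel.Quotient (Sig F Fs) R,
    if ¬ IsSym F Fs O.out ∧ IsSymRam F Fs (f O.out) then
      sgnResidue (charVal hbar O.out γ) ^ ramIndex (fld_map_le f O.out)
    else 1) *
  ∏ᶠ O : MulAction.orbitRel.Quotient (Sig F Fs) R,
    if IsSymUnram F Fs O.out ∧ IsSymRam F Fs (f O.out) then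
      sgnResidueNormOne (fldPM_le_fld F Fs O.out) (charVal hbar O.out γ) ^
        ramIndex (fld_map_le f O.out)
    else 1

end ZetaS

end Tori

end TorusSigns

end

/-!
The restriction of `ζ_S` to `S(F)_c` is computed orbit by orbit, inside `Fs` with its Galois
invariant absolute value (`absVal`). Since `p ≠ 2`, a unit of a finite extension `L` of `F` is a
square if and only if its residue class is a square (`isSquare_residue_iff`), so that the sign
characters of residue fields become statements about squares in `L`, and quadratic extensions are
treated through a generator `s` with `τ(s) = -s` (`IsQuad`, `IsAnti`).

If `α` is symmetric ramified, then `ζ_α = 1`. If `α` is asymmetric, then `ζ_α` is the inverse of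
`χ'_{α'} ∘ N`, where `N` is the norm from `F_α` to `F_{α'}`. If `α` is symmetric unramified, then
both the unramified extension of `κ_α` and `χ'_{α'} ∘ N` restrict to `κ_α` on `F_{±α}ˣ`, so `ζ_α`
is trivial there. As `F_αˣ` is generated by `F_{±α}ˣ` and units, the element `δ` with
`δ/τ_α(δ) = ᾱ(γ)` may be replaced by a unit `v`, and `ζ_α(v) = χ'_{α'}(N(v))⁻¹`. For `γ ∈ S(F)_c`
the value `ᾱ(γ)` is a unit (`absVal_charVal`), so in all cases only `χ'_{α'} ∘ N` on units matters.
It is trivial there unless `α'` is symmetric ramified. In that case `χ'_{α'}` is the sign character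
on units (`apply_unit_of_symRam`), because it is tame and extends `κ_{α'}`, and composing with the
norm raises signs to the power `e(α/α')` (`isSqIn_relNorm_iff`). Finally the sign of `v` in `k_αˣ`
is the sign of `v/τ_α(v) = ᾱ(γ)` in `k_α^1`, by Hilbert 90 for the residue fields
(`IsQuad.sgnResidueNormOne_eq`).

That `χ'_{α'} ∘ N` extends `κ_α` for symmetric unramified `α` (`infData_unitsIncl`) amounts to the
identity `κ_α = κ_{α'} ∘ N` on `F_{±α}ˣ`, where now `N` is the norm from `F_{±α}` to `F_{±α'}`
(`kappa_unitsNorm`). Local class field theory would give it at once. Here it is deduced from the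
explicit description of the norms of quadratic extensions, by induction on the degree through
unramified quadratic subextensions, which reduces to the case of odd residue degree
(`exists_sq_of_isForm_relNorm`).
-/

open scoped NNReal

set_option linter.unusedSectionVars false
set_option linter.style.haveILetI false

noncomputable section

namespace TorusSigns

/-! ### The absolute value of the separable closure -/

section AbsoluteValue

variable (F Fs : Type*) [Field F] [ValuativeRel F] [TopologicalSpace F]
  [IsNonarchimedeanLocalField F] [Field Fs] [Algebra F Fs] [IsSepClosure F Fs]

open scoped Valued in
/-- The spectral norm on `Fs` is a Galois invariant real valuation whose valuation ring is the
integral closure of `O_F`, and which is discrete on `F`. -/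
theorem exists_valuation : ∃ v : Valuation Fs ℝ≥0,
    (∀ (σ : Fs ≃ₐ[F] Fs) (x : Fs), v (σ x) = v x) ∧
    (∀ x : Fs, IsIntegral (ValuativeRel.valuation F).integer x ↔ v x ≤ 1) ∧
    (∃ q : ℝ≥0, 0 < q ∧ q < 1 ∧ (∃ x : F, v (algebraMap F Fs x) = q) ∧
      ∀ x : F, x ≠ 0 → ∃ k : ℤ, v (algebraMap F Fs x) = q ^ k) ∧
    (∀ x y : F, v (algebraMap F Fs x) ≤ v (algebraMap F Fs y) ↔
      ValuativeRel.valuation F x ≤ ValuativeRel.valuation F y) := by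
  have : Algebra.IsSeparable F Fs := IsSepClosure.separable
  let := IsTopologicalAddGroup.rightUniformSpace F
  have := isUniformAddGroup_of_addCommGroup (G := F)
  let : (Valued.v (R := F)).RankOne :=
    { hom' := ValuativeRel.IsRankLeOne.nonempty.some.emb (R := F) |>.comp
        MonoidWithZeroHom.ValueGroup₀.embedding
      strictMono' := ValuativeRel.IsRankLeOne.nonempty.some.strictMono.comp
        MonoidWithZeroHom.ValueGroup₀.embedding_strictMono }
  have : CompleteSpace F := inferInstance
  let v : Valuation Fs ℝ≥0 :=
    { toFun x := ⟨spectralNorm F Fs x, spectralNorm_nonneg x⟩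
      map_zero' := by ext; exact spectralNorm_zero
      map_one' := by ext; exact spectralNorm_one
      map_mul' x y := by ext; exact spectralAlgNorm_mul x y
      map_add_le_max' x y := by
        have h := isNonarchimedean_spectralNorm (K := F) (L := Fs) x y
        rcases le_max_iff.1 h with h | h
        · exact le_max_of_le_left h
        · exact le_max_of_le_right h }
  have hext (x : F) : (v (algebraMap F Fs x) : ℝ) = ‖x‖ := spectralNorm_extends x
  have hle (x y : F) : v (algebraMap F Fs x) ≤ v (algebraMap F Fs y) ↔
      ValuativeRel.valuation F x ≤ ValuativeRel.valuation F y := by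
    rw [← NNReal.coe_le_coe, hext, hext]
    exact Valued.toNormedField.norm_le_iff
  have hle1 (x : F) : v (algebraMap F Fs x) ≤ 1 ↔ ValuativeRel.valuation F x ≤ 1 := by
    simpa using hle x 1
  refine ⟨v, ?_, ?_, ?_, hle⟩
  · intro σ x
    ext
    exact (spectralNorm_eq_of_equiv σ x).symm
  · intro x
    constructor
    · intro hx
      have hO : v.Integers v.integer := Valuation.integer.integers v
      let i : (ValuativeRel.valuation F).integer →+* v.integer :=
        ((algebraMap F Fs).comp (ValuativeRel.valuation F).integer.subtype).codRestrict v.integer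
          fun a => (hle1 a).2 a.2
      let := i.toAlgebra
      have : IsScalarTower (ValuativeRel.valuation F).integer v.integer Fs :=
        IsScalarTower.of_algebraMap_eq fun a => rfl
      exact hO.mem_of_integral hx.tower_top
    · intro hx
      rcases isIntegral_or_isIntegral_inv F Fs x with h | h
      · exact h
      have hm : (minpoly F x).Monic := minpoly.monic (Algebra.IsIntegral.isIntegral x)
      have hy : spectralNorm F Fs x ≤ 1 := hx
      rw [spectralNorm, spectralValue_le_one_iff hm] at hy
      have hl : minpoly F x ∈
          Polynomial.lifts (algebraMap (ValuativeRel.valuation F).integer F) := by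
        rw [Polynomial.lifts_iff_coeff_lifts]
        intro n
        exact ⟨⟨(minpoly F x).coeff n, (Valued.toNormedField.norm_le_one_iff).1 (hy n)⟩, rfl⟩
      obtain ⟨q, hq, -, hqm⟩ := Polynomial.lifts_and_natDegree_eq_and_monic hl hm
      refine ⟨q, hqm, ?_⟩
      have := minpoly.aeval F x
      rw [← hq, Polynomial.aeval_map_algebraMap] at this
      exact this
  · obtain ⟨ϖ, hϖ⟩ := IsDiscreteValuationRing.exists_irreducible
      (ValuativeRel.valuation F).integer
    have hlt (x : F) : v (algebraMap F Fs x) < 1 ↔ ValuativeRel.valuation F x < 1 := by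
      simpa using (hle 1 x).not
    have h0 : (ϖ : F) ≠ 0 := fun h => hϖ.ne_zero (Subtype.ext h)
    have hunit (a : (ValuativeRel.valuation F).integerˣ) : v (algebraMap F Fs (a : _)) = 1 := by
      have h1 := (hle1 _).2 (a : (ValuativeRel.valuation F).integer).2
      have h2 := (hle1 _).2 ((a⁻¹ : _ˣ) : (ValuativeRel.valuation F).integer).2
      have h3 : v (algebraMap F Fs ((a : (ValuativeRel.valuation F).integer) : F)) *
          v (algebraMap F Fs (((a⁻¹ : _ˣ) : (ValuativeRel.valuation F).integer) : F)) = 1 := by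
        rw [← map_mul, ← map_mul, ← Subring.coe_mul, Units.mul_inv]
        simp
      refine le_antisymm h1 ?_
      rw [← h3]
      exact mul_le_of_le_one_right' h2
    refine ⟨v (algebraMap F Fs ϖ), ?_, ?_, ⟨ϖ, rfl⟩, ?_⟩
    · rw [pos_iff_ne_zero]
      simpa using h0
    · refine lt_of_le_of_ne ((hle1 _).2 ϖ.2) fun h => hϖ.not_isUnit ?_
      have hinv : ValuativeRel.valuation F (ϖ : F)⁻¹ ≤ 1 := by
        rw [← hle1, map_inv₀, map_inv₀, h, inv_one]
      exact IsUnit.of_mul_eq_one ⟨(ϖ : F)⁻¹, hinv⟩ (Subtype.ext (mul_inv_cancel₀ h0))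
    · have key (x : (ValuativeRel.valuation F).integer) (hx : x ≠ 0) :
          ∃ k : ℕ, v (algebraMap F Fs x) = v (algebraMap F Fs ϖ) ^ k := by
        obtain ⟨n, u, rfl⟩ := IsDiscreteValuationRing.eq_unit_mul_pow_irreducible hx hϖ
        refine ⟨n, ?_⟩
        rw [Subring.coe_mul, map_mul, map_mul, hunit, one_mul]
        simp
      intro x hx
      rcases le_total (ValuativeRel.valuation F x) 1 with h | h
      · obtain ⟨k, hk⟩ := key ⟨x, h⟩ (fun h => hx (congrArg Subtype.val h))
        exact ⟨k, by simpa using hk⟩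
      · have h' : ValuativeRel.valuation F x⁻¹ ≤ 1 := by
          rw [map_inv₀]
          exact inv_le_one_of_one_le₀ h
        obtain ⟨k, hk⟩ := key ⟨x⁻¹, h'⟩ (fun h => inv_ne_zero hx (congrArg Subtype.val h))
        refine ⟨-k, ?_⟩
        simp only [map_inv₀] at hk
        rw [zpow_neg, zpow_natCast, ← hk, inv_inv]

/-- The absolute value of `Fs`, that is, the spectral norm, as a real valued valuation. -/
def absVal : Valuation Fs ℝ≥0 := (exists_valuation F Fs).choose

variable {F Fs}

theorem absVal_gal (σ : Fs ≃ₐ[F] Fs) (x : Fs) : absVal F Fs (σ x) = absVal F Fs x :=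
  (exists_valuation F Fs).choose_spec.1 σ x

theorem isIntegral_iff_absVal_le_one {x : Fs} :
    IsIntegral (ValuativeRel.valuation F).integer x ↔ absVal F Fs x ≤ 1 :=
  (exists_valuation F Fs).choose_spec.2.1 x

variable (F Fs) in
theorem absVal_discrete :
    ∃ q : ℝ≥0, 0 < q ∧ q < 1 ∧ (∃ x : F, absVal F Fs (algebraMap F Fs x) = q) ∧
      ∀ x : F, x ≠ 0 → ∃ k : ℤ, absVal F Fs (algebraMap F Fs x) = q ^ k :=
  (exists_valuation F Fs).choose_spec.2.2.1

theorem absVal_algebraMap_le_iff {x y : F} :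
    absVal F Fs (algebraMap F Fs x) ≤ absVal F Fs (algebraMap F Fs y) ↔
      ValuativeRel.valuation F x ≤ ValuativeRel.valuation F y :=
  (exists_valuation F Fs).choose_spec.2.2.2 x y

theorem mem_integers_iff_absVal {L : IntermediateField F Fs} {x : L} :
    x ∈ integers L ↔ absVal F Fs x ≤ 1 := by
  rw [mem_integers, ← isIntegral_iff_absVal_le_one]
  exact (isIntegral_algHom_iff (L.val.restrictScalars (ValuativeRel.valuation F).integer)
    Subtype.val_injective).symm

theorem absVal_ne_zero {x : Fs} (hx : x ≠ 0) : absVal F Fs x ≠ 0 := by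
  simpa using hx

theorem absVal_pos {x : Fs} (hx : x ≠ 0) : 0 < absVal F Fs x :=
  pos_iff_ne_zero.2 (absVal_ne_zero hx)

theorem isEquiv_valuation_absVal (L : IntermediateField F Fs) :
    (integers L).valuation.IsEquiv ((absVal F Fs).comap (algebraMap L Fs)) := by
  rw [Valuation.isEquiv_iff_val_le_one]
  intro x
  rw [ValuationSubring.valuation_le_one_iff]
  exact mem_integers_iff_absVal

theorem mem_unitGroup_iff_absVal {L : IntermediateField F Fs} {x : Lˣ} :
    x ∈ (integers L).unitGroup ↔ absVal F Fs (x : L) = 1 :=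
  (isEquiv_valuation_absVal L).eq_one_iff_eq_one

theorem mem_principalUnitGroup_iff_absVal {L : IntermediateField F Fs} {x : Lˣ} :
    x ∈ (integers L).principalUnitGroup ↔ absVal F Fs ((x : L) - 1 : Fs) < 1 :=
  (isEquiv_valuation_absVal L).lt_one_iff_lt_one

theorem mem_maximalIdeal_iff_absVal {L : IntermediateField F Fs} {x : integers L} :
    x ∈ IsLocalRing.maximalIdeal (integers L) ↔ absVal F Fs (x : L) < 1 := by
  rw [(integers L).valuation_lt_one_iff]
  exact (isEquiv_valuation_absVal L).lt_one_iff_lt_one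

end AbsoluteValue

/-! ### Norms and degrees of finite extensions -/

section Norm

variable {F Fs : Type*} [Field F] [ValuativeRel F] [TopologicalSpace F]
  [IsNonarchimedeanLocalField F] [Field Fs] [Algebra F Fs] [IsSepClosure F Fs]

theorem absVal_multiset_prod_eq_pow (s : Multiset Fs) (c : ℝ≥0)
    (h : ∀ x ∈ s, absVal F Fs x = c) : absVal F Fs s.prod = c ^ Multiset.card s := by
  rw [map_multiset_prod, Multiset.map_congr rfl h, Multiset.map_const', Multiset.prod_replicate]

theorem absVal_eq_one_of_sub_lt {x y : Fs} (hy : absVal F Fs y = 1)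
    (h : absVal F Fs (x - y) < 1) : absVal F Fs x = 1 := by
  rw [← hy] at h
  rw [← hy, ← (absVal F Fs).map_add_eq_of_lt_left h, add_sub_cancel]

section General

variable (K L : Type*) [Field K] [Field L] [Algebra F K] [Algebra K Fs] [IsScalarTower F K Fs]
  [Algebra K L] [Algebra L Fs] [IsScalarTower K L Fs]

theorem splits_minpoly (F : Type*) {Fs : Type*} [Field F] [Field Fs] [Algebra F Fs]
    [IsSepClosure F Fs] (K L : Type*) [Field K] [Field L] [Algebra F K] [Algebra K Fs]
    [IsScalarTower F K Fs] [Algebra K L] [Algebra L Fs] [IsScalarTower K L Fs] (x : L) :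
    ((minpoly K x).map (algebraMap K Fs)).Splits := by
  have : IsGalois F Fs := IsSepClosure.isGalois
  have : Normal K Fs := Normal.tower_top_of_normal F K Fs
  rw [← minpoly.algebraMap_eq (algebraMap L Fs).injective]
  exact this.splits _

/-- The roots of the minimal polynomial of `x` over `K` are Galois conjugates of `x`. -/
theorem exists_gal_of_mem_aroots (x : L) {y : Fs} (hy : y ∈ (minpoly K x).aroots Fs) :
    ∃ σ : Fs ≃ₐ[F] Fs, y = σ (algebraMap L Fs x) := by
  have : IsGalois F Fs := IsSepClosure.isGalois
  have : Normal K Fs := Normal.tower_top_of_normal F K Fs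
  rw [Polynomial.mem_aroots, ← minpoly.algebraMap_eq (algebraMap L Fs).injective] at hy
  have := Algebra.IsAlgebraic.tower_top (K := F) K (A := Fs)
  obtain ⟨σ, hσ⟩ := minpoly.exists_algEquiv_of_root
    (Algebra.IsAlgebraic.isAlgebraic (R := K) (algebraMap L Fs x)) hy.2
  exact ⟨(σ.restrictScalars F).symm, hσ ▸ ((σ.restrictScalars F).symm_apply_apply y).symm⟩

variable [FiniteDimensional K L]

/-- The norm of `x` is a product of conjugates of `x`, which all have the same absolute value. -/
theorem absVal_norm (x : L) : absVal F Fs (algebraMap K Fs (Algebra.norm K x)) =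
    absVal F Fs (algebraMap L Fs x) ^ Module.finrank K L := by
  have hs := splits_minpoly F (Fs := Fs) K L x
  rw [Algebra.norm_eq_prod_roots _ hs, map_pow, absVal_multiset_prod_eq_pow _
    (absVal F Fs (algebraMap L Fs x)), ← pow_mul]
  · congr 1
    rw [Polynomial.aroots, ← hs.natDegree_eq_card_roots, Polynomial.natDegree_map,
      ← IntermediateField.adjoin.finrank (Algebra.IsIntegral.isIntegral x)]
    exact Module.finrank_mul_finrank _ _ _
  · intro y hy
    obtain ⟨σ, rfl⟩ := exists_gal_of_mem_aroots (F := F) K L x hy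
    exact absVal_gal _ _

end General

variable {K M L : IntermediateField F Fs}

/-- The algebra structure of `L` over a subfield `K`, for `K ≤ L`. -/
abbrev inclAlgebra (h : K ≤ L) : Algebra K L := (IntermediateField.inclusion h).toRingHom.toAlgebra

/-- The degree `[L : K]`, for `K ≤ L`. -/
def relDegree (h : K ≤ L) : ℕ :=
  letI := inclAlgebra h
  Module.finrank K L

theorem finiteDimensional_incl (h : K ≤ L) [FiniteDimensional F L] :
    letI := inclAlgebra h
    FiniteDimensional K L := by
  letI := inclAlgebra h
  have : IsScalarTower F K L := IsScalarTower.of_algebraMap_eq fun _ => rfl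
  exact FiniteDimensional.right F K L

theorem finiteDimensional_of_le (h : K ≤ L) [FiniteDimensional F L] : FiniteDimensional F K :=
  Module.Finite.of_injective (IntermediateField.inclusion h).toLinearMap
    (IntermediateField.inclusion_injective h)

theorem relDegree_pos (h : K ≤ L) [FiniteDimensional F L] : 0 < relDegree h := by
  letI := inclAlgebra h
  have := finiteDimensional_incl h
  exact Module.finrank_pos

theorem relDegree_mul (h : K ≤ M) (h' : M ≤ L) :
    relDegree h * relDegree h' = relDegree (h.trans h') := by
  letI := inclAlgebra h
  letI := inclAlgebra h'
  letI := inclAlgebra (h.trans h')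
  have : IsScalarTower K M L := IsScalarTower.of_algebraMap_eq fun _ => rfl
  exact Module.finrank_mul_finrank K M L

/-- The norm `N_{L/K} : L → K`, for `K ≤ L`. -/
def relNorm (h : K ≤ L) : L →* K :=
  letI := inclAlgebra h
  Algebra.norm K

theorem coe_unitsNorm (h : K ≤ L) (x : Lˣ) : (unitsNorm h x : K) = relNorm h (x : L) := rfl

theorem relNorm_ne_zero (h : K ≤ L) {x : L} (hx : x ≠ 0) : relNorm h x ≠ 0 :=
  (unitsNorm h (Units.mk0 x hx)).ne_zero

theorem relNorm_trans (h : K ≤ M) (h' : M ≤ L) [FiniteDimensional F L] (x : L) :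
    relNorm h (relNorm h' x) = relNorm (h.trans h') x := by
  letI := inclAlgebra h
  letI := inclAlgebra h'
  letI := inclAlgebra (h.trans h')
  have : IsScalarTower K M L := IsScalarTower.of_algebraMap_eq fun _ => rfl
  have := finiteDimensional_of_le h'
  have := finiteDimensional_incl h
  have := finiteDimensional_incl h'
  have := Module.Free.of_divisionRing K M
  have := Module.Free.of_divisionRing M L
  exact Algebra.norm_norm

theorem relNorm_inclusion (h : K ≤ L) (x : K) :
    relNorm h (IntermediateField.inclusion h x) = x ^ relDegree h := by
  letI := inclAlgebra h
  exact Algebra.norm_algebraMap x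

theorem absVal_relNorm (h : K ≤ L) [FiniteDimensional F L] (x : L) :
    absVal F Fs (relNorm h x : K) = absVal F Fs (x : Fs) ^ relDegree h := by
  letI := inclAlgebra h
  have : IsScalarTower K L Fs := IsScalarTower.of_algebraMap_eq fun _ => rfl
  have := finiteDimensional_incl h
  exact absVal_norm K L x

/-- The norm commutes with the Galois action: `N_{σL/σK} ∘ σ = σ ∘ N_{L/K}`. -/
theorem relNorm_gal {K' L' : IntermediateField F Fs} (h : K ≤ L) (h' : K' ≤ L')
    (σ : Fs ≃ₐ[F] Fs) (hK : K.map (σ : Fs →ₐ[F] Fs) = K') (hL : L.map (σ : Fs →ₐ[F] Fs) = L')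
    (x : L) (y : L') (hxy : (y : Fs) = σ x) : (relNorm h' y : Fs) = σ (relNorm h x : Fs) := by
  subst hK hL
  letI := inclAlgebra h
  letI := inclAlgebra h'
  have := Algebra.norm_eq_of_equiv_equiv (K.equivMap (σ : Fs →ₐ[F] Fs)).toRingEquiv
    (L.equivMap (σ : Fs →ₐ[F] Fs)).toRingEquiv (RingHom.ext fun _ => Subtype.ext rfl) x
  have hy : (L.equivMap (σ : Fs →ₐ[F] Fs)).toRingEquiv x = y := Subtype.ext hxy.symm
  rw [hy, RingEquiv.eq_symm_apply] at this
  exact (congrArg Subtype.val this).symm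

/-- If a basis of `L/K` is also a basis of `L'/K'`, then the two norms agree on `L`. -/
theorem norm_eq_of_basis {K L K' L' ι : Type*} [Field K] [Field L] [Field K'] [Field L']
    [Algebra K L] [Algebra K' L'] [Algebra K K'] [Algebra L L'] [Algebra K L']
    [IsScalarTower K L L'] [IsScalarTower K K' L'] [Fintype ι] (b : Module.Basis ι K L)
    (b' : Module.Basis ι K' L') (hb : ∀ i, b' i = algebraMap L L' (b i)) (x : L) :
    Algebra.norm K' (algebraMap L L' x) = algebraMap K K' (Algebra.norm K x) := by
  classical
  have hrepr (y : L) (i : ι) : b'.repr (algebraMap L L' y) i = algebraMap K K' (b.repr y i) := by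
    have h : algebraMap L L' y = ∑ j, algebraMap K K' (b.repr y j) • b' j := by
      conv_lhs => rw [← b.sum_repr y, map_sum]
      refine Finset.sum_congr rfl fun j _ => ?_
      rw [Algebra.smul_def, map_mul, hb, Algebra.smul_def, ← IsScalarTower.algebraMap_apply,
        ← IsScalarTower.algebraMap_apply]
    rw [h, b'.repr_sum_self]
  rw [Algebra.norm_eq_matrix_det b', Algebra.norm_eq_matrix_det b, RingHom.map_det]
  congr 1
  ext i j
  rw [RingHom.mapMatrix_apply, Matrix.map_apply, Algebra.leftMulMatrix_eq_repr_mul,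
    Algebra.leftMulMatrix_eq_repr_mul, hb, ← map_mul, hrepr]

end Norm

/-! ### Uniformizers and the fundamental identity -/

section Uniformizer

variable {F Fs : Type*} [Field F] [ValuativeRel F] [TopologicalSpace F]
  [IsNonarchimedeanLocalField F] [Field Fs] [Algebra F Fs] [IsSepClosure F Fs]

/-- `w` is a uniformizer of `K`: a non-zero element of `K` of largest absolute value less
than `1`. -/
structure IsUniformizer (K : IntermediateField F Fs) (w : Fs) : Prop where
  mem : w ∈ K
  ne_zero : w ≠ 0
  lt_one : absVal F Fs w < 1
  le_of_lt : ∀ x ∈ K, absVal F Fs x < 1 → absVal F Fs x ≤ absVal F Fs w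

theorem exists_isUniformizer (K : IntermediateField F Fs) [FiniteDimensional F K] :
    ∃ w, IsUniformizer K w := by
  classical
  obtain ⟨q, hq0, hq1, ⟨x₀, hx₀⟩, hq⟩ := absVal_discrete F Fs
  have hN (x : Fs) (hx : x ∈ K) (hx0 : x ≠ 0) :
      ∃ k : ℤ, absVal F Fs x ^ Module.finrank F K = q ^ k := by
    have h := absVal_norm (F := F) (Fs := Fs) F K ⟨x, hx⟩
    rw [show algebraMap K Fs ⟨x, hx⟩ = x from rfl] at h
    rw [← h]
    exact hq _ (Algebra.norm_ne_zero_iff.2 fun h0 => hx0 (congrArg Subtype.val h0))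
  have hn : 0 < Module.finrank F K := Module.finrank_pos
  -- the norm to `F` identifies `v(x) ^ [K : F]` with a power of `q`; `w` has the least positive
  -- exponent
  let P (k : ℕ) : Prop := 0 < k ∧ ∃ x ∈ K, x ≠ 0 ∧ absVal F Fs x ^ Module.finrank F K = q ^ k
  have hP : ∃ k, P k := by
    refine ⟨_, hn, algebraMap F Fs x₀, K.algebraMap_mem x₀, ?_, by rw [hx₀]⟩
    intro h0
    rw [h0, map_zero] at hx₀
    exact hq0.ne hx₀
  obtain ⟨hk0, w, hwK, hw0, hw⟩ := Nat.find_spec hP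
  refine ⟨w, hwK, hw0, ?_, ?_⟩
  · rw [← pow_lt_one_iff_of_nonneg zero_le hn.ne', hw]
    exact pow_lt_one₀ zero_le hq1 hk0.ne'
  · intro x hx hx1
    by_cases hx0 : x = 0
    · simp [hx0]
    obtain ⟨k, hk⟩ := hN x hx hx0
    have hklt : (0 : ℤ) < k := by
      rw [← zpow_lt_one_iff_right_of_lt_one₀ hq0 hq1, ← hk]
      exact pow_lt_one₀ zero_le hx1 hn.ne'
    lift k to ℕ using hklt.le
    have hPk : P k := ⟨by exact_mod_cast hklt, x, hx, hx0, by simpa using hk⟩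
    rw [← pow_le_pow_iff_left₀ zero_le zero_le hn.ne', hw, hk, zpow_natCast]
    exact pow_le_pow_of_le_one zero_le hq1.le (Nat.find_min' hP hPk)

variable {K L : IntermediateField F Fs} {w : Fs}

theorem IsUniformizer.val_pos (hw : IsUniformizer K w) : 0 < absVal F Fs w :=
  absVal_pos hw.ne_zero

/-- The value group of `K` is generated by the absolute value of a uniformizer. -/
theorem IsUniformizer.exists_zpow (hw : IsUniformizer K w) {x : Fs} (hx : x ∈ K) (hx0 : x ≠ 0) :
    ∃ k : ℤ, absVal F Fs x = absVal F Fs w ^ k := by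
  obtain ⟨n, h1, h2⟩ := exists_mem_Ico_zpow (TorusSigns.absVal_pos (F := F) hx0)
    ((one_lt_inv₀ hw.val_pos).2 hw.lt_one)
  have hw0 := hw.val_pos.ne'
  rw [inv_zpow'] at h1 h2
  refine ⟨-n, le_antisymm ?_ h1⟩
  by_contra! hlt
  have hy : w ^ (-n) * x⁻¹ ∈ K := K.mul_mem (zpow_mem hw.mem _) (K.inv_mem hx)
  have hv : absVal F Fs (w ^ (-n) * x⁻¹) = absVal F Fs w ^ (-n) / absVal F Fs x := by
    rw [map_mul, map_zpow₀, map_inv₀, div_eq_mul_inv]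
  have hle := hw.le_of_lt _ hy (by rwa [hv, div_lt_one₀ (absVal_pos hx0)])
  rw [hv, div_le_iff₀ (absVal_pos hx0)] at hle
  refine absurd h2 (not_lt.2 ?_)
  rw [neg_add, zpow_add₀ hw0, zpow_neg_one, ← div_eq_mul_inv, div_le_iff₀ hw.val_pos, mul_comm]
  exact hle

theorem IsUniformizer.zpow_inj (hw : IsUniformizer K w) {a b : ℤ}
    (h : absVal F Fs w ^ a = absVal F Fs w ^ b) : a = b :=
  zpow_right_injective₀ hw.val_pos hw.lt_one.ne h

theorem IsUniformizer.pow_inj (hw : IsUniformizer K w) {a b : ℕ}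
    (h : absVal F Fs w ^ a = absVal F Fs w ^ b) : a = b := by
  have := hw.zpow_inj (a := a) (b := b) (by simpa using h)
  exact_mod_cast this

theorem IsUniformizer.of_absVal_eq (hw : IsUniformizer K w) {z : Fs} (hz : z ∈ K)
    (h : absVal F Fs z = absVal F Fs w) : IsUniformizer K z where
  mem := hz
  ne_zero := by
    rintro rfl
    rw [map_zero] at h
    exact hw.val_pos.ne h
  lt_one := h ▸ hw.lt_one
  le_of_lt := by
    rw [h]
    exact hw.le_of_lt

theorem mem_maximalIdeal_pow_iff (hw : IsUniformizer K w) (n : ℕ) {x : integers K} :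
    x ∈ IsLocalRing.maximalIdeal (integers K) ^ n ↔ absVal F Fs (x : K) ≤ absVal F Fs w ^ n := by
  let w' : integers K := ⟨⟨w, hw.mem⟩, mem_integers_iff_absVal.2 hw.lt_one.le⟩
  have key (y z : integers K) (hz : (z : K) ≠ 0) :
      z ∣ y ↔ absVal F Fs (y : K) ≤ absVal F Fs (z : K) := by
    have hz' : ((z : K) : Fs) ≠ 0 := fun h => hz (Subtype.ext h)
    constructor
    · rintro ⟨c, rfl⟩
      have hc := mem_integers_iff_absVal.1 c.2
      have h : (((z * c : integers K) : K) : Fs) = ((z : K) : Fs) * ((c : K) : Fs) := rfl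
      rw [h, map_mul]
      exact mul_le_of_le_one_right' hc
    · intro h
      refine ⟨⟨(y : K) / (z : K), mem_integers_iff_absVal.2 ?_⟩, Subtype.ext ?_⟩
      · have h' : (((y : K) / (z : K) : K) : Fs) = ((y : K) : Fs) / ((z : K) : Fs) := rfl
        rw [h', map_div₀, div_le_one₀ (absVal_pos hz')]
        exact h
      · exact (mul_div_cancel₀ _ hz).symm
  have hw0 : (w' : K) ≠ 0 := fun h => hw.ne_zero (congrArg Subtype.val h)
  have hspan : IsLocalRing.maximalIdeal (integers K) = Ideal.span {w'} := by
    ext y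
    rw [Ideal.mem_span_singleton, key _ _ hw0, mem_maximalIdeal_iff_absVal]
    exact ⟨fun h => hw.le_of_lt _ (y : K).2 h, fun h => h.trans_lt hw.lt_one⟩
  rw [hspan, Ideal.span_singleton_pow, Ideal.mem_span_singleton, key]
  · have h : (((w' ^ n : integers K) : K) : Fs) = w ^ n := rfl
    rw [h, map_pow]
  · exact pow_ne_zero n hw0

theorem IsUniformizer.exists_pow_eq (h : K ≤ L) {wL : Fs} (hw : IsUniformizer K w)
    (hwL : IsUniformizer L wL) : ∃ e : ℕ, e ≠ 0 ∧ absVal F Fs w = absVal F Fs wL ^ e := by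
  obtain ⟨k, hk⟩ := hwL.exists_zpow (h hw.mem) hw.ne_zero
  have hk0 : (0 : ℤ) < k := by
    rw [← zpow_lt_one_iff_right_of_lt_one₀ hwL.val_pos hwL.lt_one, ← hk]
    exact hw.lt_one
  lift k to ℕ using hk0.le
  exact ⟨k, by exact_mod_cast hk0.ne', by simpa using hk⟩

/-- The ramification index, defined through ideals, is the index of the value groups. -/
theorem IsUniformizer.absVal_eq_pow_ramIndex (h : K ≤ L) {wL : Fs} (hw : IsUniformizer K w)
    (hwL : IsUniformizer L wL) : absVal F Fs w = absVal F Fs wL ^ ramIndex h := by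
  obtain ⟨e, he0, he⟩ := hw.exists_pow_eq h hwL
  have hram : ramIndex h = e := by
    letI : Algebra (integers K) (integers L) := (integersMap h).toAlgebra
    refine Ideal.ramificationIdx'_spec ?_ ?_
    · rw [Ideal.map_le_iff_le_comap]
      intro x hx
      rw [Ideal.mem_comap, mem_maximalIdeal_pow_iff hwL, ← he]
      exact hw.le_of_lt _ (x : K).2 (mem_maximalIdeal_iff_absVal (L := K).1 hx)
    · rw [Ideal.map_le_iff_le_comap]
      intro hle
      have hm : (⟨⟨w, hw.mem⟩, mem_integers_iff_absVal.2 hw.lt_one.le⟩ : integers K) ∈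
          IsLocalRing.maximalIdeal (integers K) := mem_maximalIdeal_iff_absVal.2 hw.lt_one
      have := hle hm
      rw [Ideal.mem_comap, mem_maximalIdeal_pow_iff hwL] at this
      have h' : absVal F Fs w ≤ absVal F Fs wL ^ (e + 1) := this
      rw [he, pow_le_pow_iff_right_of_lt_one₀ hwL.val_pos hwL.lt_one] at h'
      omega
  rw [hram, he]

theorem ramIndex_ne_zero (h : K ≤ L) [FiniteDimensional F L] : ramIndex h ≠ 0 := by
  have := finiteDimensional_of_le h
  obtain ⟨w, hw⟩ := exists_isUniformizer K
  obtain ⟨wL, hwL⟩ := exists_isUniformizer L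
  intro h0
  have := hw.absVal_eq_pow_ramIndex h hwL
  rw [h0, pow_zero] at this
  exact hw.lt_one.ne this

theorem ramIndex_mul {M : IntermediateField F Fs} (h : K ≤ M) (h' : M ≤ L)
    [FiniteDimensional F L] : ramIndex h * ramIndex h' = ramIndex (h.trans h') := by
  have := finiteDimensional_of_le h'
  have := finiteDimensional_of_le h
  obtain ⟨w, hw⟩ := exists_isUniformizer K
  obtain ⟨wM, hwM⟩ := exists_isUniformizer M
  obtain ⟨wL, hwL⟩ := exists_isUniformizer L
  apply hwL.pow_inj
  rw [← hw.absVal_eq_pow_ramIndex (h.trans h') hwL, hw.absVal_eq_pow_ramIndex h hwM,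
    hwM.absVal_eq_pow_ramIndex h' hwL, ← pow_mul, mul_comm]

/-- The ramification index is `1` if and only if the value groups agree. -/
theorem ramIndex_eq_one_iff (h : K ≤ L) [FiniteDimensional F L] :
    ramIndex h = 1 ↔ ∀ x ∈ L, x ≠ 0 → ∃ y ∈ K, absVal F Fs x = absVal F Fs y := by
  have := finiteDimensional_of_le h
  obtain ⟨w, hw⟩ := exists_isUniformizer K
  obtain ⟨wL, hwL⟩ := exists_isUniformizer L
  have he := hw.absVal_eq_pow_ramIndex h hwL
  constructor
  · intro h1 x hx hx0
    rw [h1, pow_one] at he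
    obtain ⟨k, hk⟩ := hwL.exists_zpow hx hx0
    exact ⟨w ^ k, zpow_mem hw.mem k, by rw [hk, ← he, map_zpow₀]⟩
  · intro H
    obtain ⟨y, hy, hyw⟩ := H wL hwL.mem hwL.ne_zero
    have hle := hw.le_of_lt y hy (hyw ▸ hwL.lt_one)
    rw [← hyw, he] at hle
    by_contra h1
    have h2 : 1 < ramIndex h := by
      have := ramIndex_ne_zero h
      omega
    have := pow_lt_pow_right_of_lt_one₀ hwL.val_pos hwL.lt_one h2
    rw [pow_one] at this
    exact absurd hle (not_le.2 this)

end Uniformizer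

section Residue

variable {F Fs : Type*} [Field F] [ValuativeRel F] [TopologicalSpace F]
  [IsNonarchimedeanLocalField F] [Field Fs] [Algebra F Fs] [IsSepClosure F Fs]

/-- `O_K` is finite over the discrete valuation ring `O_F`; hence it is a Dedekind domain, and its
residue field is finite. -/
theorem isDedekindDomain_integers_and_finite (K : IntermediateField F Fs) [FiniteDimensional F K] :
    IsDedekindDomain (integers K) ∧ Finite (ResidueField K) := by
  have : Algebra.IsSeparable F Fs := IsSepClosure.separable
  let i : (ValuativeRel.valuation F).integer →+* integers K :=
    (algebraMap (ValuativeRel.valuation F).integer K).codRestrict (integers K)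
      fun a => mem_integers.2 isIntegral_algebraMap
  letI : Algebra (ValuativeRel.valuation F).integer (integers K) := i.toAlgebra
  have : IsScalarTower (ValuativeRel.valuation F).integer (integers K) K :=
    IsScalarTower.of_algebraMap_eq fun _ => rfl
  have : IsFractionRing (ValuativeRel.valuation F).integer F :=
    (Valuation.integer.integers (ValuativeRel.valuation F)).isFractionRing
  have : IsIntegralClosure (integers K) (ValuativeRel.valuation F).integer K :=
    ⟨Subtype.val_injective, fun {x} => ⟨fun h => ⟨⟨x, h⟩, rfl⟩, fun ⟨y, hy⟩ => hy ▸ y.2⟩⟩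
  have hfin : Module.Finite (ValuativeRel.valuation F).integer (integers K) :=
    IsIntegralClosure.finite _ F K _
  refine ⟨IsIntegralClosure.isDedekindDomain (ValuativeRel.valuation F).integer F K _, ?_⟩
  have : IsLocalHom (algebraMap (ValuativeRel.valuation F).integer (integers K)) := by
    have : Algebra.IsIntegral (ValuativeRel.valuation F).integer (integers K) :=
      Algebra.IsIntegral.of_finite _ _
    have : FaithfulSMul (ValuativeRel.valuation F).integer (integers K) := by
      rw [faithfulSMul_iff_algebraMap_injective]
      intro a b hab
      have h1 : algebraMap F K a = algebraMap F K b := congrArg Subtype.val hab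
      exact Subtype.ext ((algebraMap F K).injective h1)
    infer_instance
  exact IsLocalRing.ResidueField.finite_of_finite
    (R := (ValuativeRel.valuation F).integer) inferInstance

variable {K L : IntermediateField F Fs}

/-- The algebra structure of `O_L` over `O_K`, for `K ≤ L`. -/
abbrev integersAlgebra (h : K ≤ L) : Algebra (integers K) (integers L) := (integersMap h).toAlgebra

/-- The algebra structure of `k_L` over `k_K`, for `K ≤ L`. -/
abbrev residueAlgebra (h : K ≤ L) : Algebra (ResidueField K) (ResidueField L) :=
  (IsLocalRing.ResidueField.map (integersMap h)).toAlgebra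

/-- The residue degree `f(L/K)`, for `K ≤ L`. -/
def resDegree (h : K ≤ L) : ℕ :=
  letI : Module (ResidueField K) (ResidueField L) := (residueAlgebra h).toModule
  Module.finrank (ResidueField K) (ResidueField L)

set_option linter.deprecated false in
set_option maxHeartbeats 800000 in
/-- The fundamental identity `[L : K] = e f`. -/
theorem relDegree_eq (h : K ≤ L) [FiniteDimensional F L] :
    relDegree h = ramIndex h * resDegree h := by
  have : Algebra.IsSeparable F Fs := IsSepClosure.separable
  have := finiteDimensional_of_le h
  letI := inclAlgebra h
  letI := integersAlgebra h
  letI : Algebra (integers K) L := ((algebraMap K L).comp (algebraMap (integers K) K)).toAlgebra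
  have := finiteDimensional_incl h
  have : IsScalarTower (integers K) K L := IsScalarTower.of_algebraMap_eq fun _ => rfl
  have : IsScalarTower (integers K) (integers L) L := IsScalarTower.of_algebraMap_eq fun _ => rfl
  have : IsScalarTower F K L := IsScalarTower.of_algebraMap_eq fun _ => rfl
  have : Algebra.IsSeparable K L := Algebra.isSeparable_tower_top_of_isSeparable F K L
  have := (isDedekindDomain_integers_and_finite K).1
  have := (isDedekindDomain_integers_and_finite L).1
  have : IsIntegralClosure (integers L) (integers K) L := by
    refine ⟨Subtype.val_injective, fun {x} => ⟨fun hx => ?_, ?_⟩⟩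
    · let i : (ValuativeRel.valuation F).integer →+* integers K :=
        (algebraMap (ValuativeRel.valuation F).integer K).codRestrict (integers K)
          fun a => mem_integers.2 isIntegral_algebraMap
      letI : Algebra (ValuativeRel.valuation F).integer (integers K) := i.toAlgebra
      have : IsScalarTower (ValuativeRel.valuation F).integer (integers K) L :=
        IsScalarTower.of_algebraMap_eq fun _ => rfl
      have : Algebra.IsIntegral (ValuativeRel.valuation F).integer (integers K) := by
        refine ⟨fun y => ?_⟩
        have hy : IsIntegral (ValuativeRel.valuation F).integer (y : K) := y.2
        have : IsScalarTower (ValuativeRel.valuation F).integer (integers K) K :=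
          IsScalarTower.of_algebraMap_eq fun _ => rfl
        exact (isIntegral_algebraMap_iff (B := K) Subtype.val_injective).1 hy
      exact ⟨⟨x, isIntegral_trans (A := integers K) x hx⟩, rfl⟩
    · rintro ⟨y, rfl⟩
      have hy : IsIntegral (ValuativeRel.valuation F).integer (y : L) := y.2
      obtain ⟨p, hp, hpy⟩ := hy
      let i : (ValuativeRel.valuation F).integer →+* integers K :=
        (algebraMap (ValuativeRel.valuation F).integer K).codRestrict (integers K)
          fun a => mem_integers.2 isIntegral_algebraMap
      refine ⟨p.map i, hp.map i, ?_⟩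
      rw [Polynomial.eval₂_map]
      exact hpy
  have : Module.Finite (integers K) (integers L) := IsIntegralClosure.finite _ K L _
  have hp0 : IsLocalRing.maximalIdeal (integers K) ≠ ⊥ := by
    obtain ⟨w, hw⟩ := exists_isUniformizer K
    intro h0
    have hm : (⟨⟨w, hw.mem⟩, mem_integers_iff_absVal.2 hw.lt_one.le⟩ : integers K) ∈
      IsLocalRing.maximalIdeal (integers K) := mem_maximalIdeal_iff_absVal.2 hw.lt_one
    rw [h0, Ideal.mem_bot] at hm
    exact hw.ne_zero (congrArg (fun z : integers K => ((z : K) : Fs)) hm)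
  have key := Ideal.ramificationIdx_mul_inertiaDeg_of_isLocalRing (R := integers K) (integers L)
    K L hp0
  have : IsLocalHom (algebraMap (integers K) (integers L)) := integersMap_isLocalHom h
  have : (IsLocalRing.maximalIdeal (integers L)).LiesOver (IsLocalRing.maximalIdeal (integers K)) :=
    inferInstance
  rw [Ideal.inertiaDeg'_algebraMap] at key
  refine key.symm.trans (congrArg (ramIndex h * ·) ?_)
  letI := residueAlgebra h
  refine Algebra.finrank_eq_of_equiv_equiv (RingEquiv.refl (ResidueField K))
    (RingEquiv.refl (ResidueField L)) ?_
  refine RingHom.ext fun x => ?_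
  obtain ⟨x, rfl⟩ := Ideal.Quotient.mk_surjective x
  rfl

end Residue

/-! ### Squares and residue fields -/

section Squares

variable {F Fs : Type*} [Field F] [ValuativeRel F] [TopologicalSpace F]
  [IsNonarchimedeanLocalField F] [Field Fs] [Algebra F Fs] [IsSepClosure F Fs]

theorem absVal_two
    (hp : ringChar (IsLocalRing.ResidueField (ValuativeRel.valuation F).integer) ≠ 2) :
    absVal F Fs 2 = 1 := by
  have h2 : (2 : IsLocalRing.ResidueField (ValuativeRel.valuation F).integer) ≠ 0 :=
    Ring.two_ne_zero hp
  have hu : IsUnit (2 : (ValuativeRel.valuation F).integer) := by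
    by_contra hu
    apply h2
    rw [← map_ofNat (IsLocalRing.residue (ValuativeRel.valuation F).integer) 2]
    exact (IsLocalRing.residue_eq_zero_iff _).2 ((IsLocalRing.mem_maximalIdeal _).2 hu)
  have hv : ValuativeRel.valuation F 2 = 1 := by
    have := (Valuation.integer.integers (ValuativeRel.valuation F)).isUnit_iff_valuation_eq_one.1 hu
    exact this
  have h1 : absVal F Fs (algebraMap F Fs 2) ≤ absVal F Fs (algebraMap F Fs 1) :=
    absVal_algebraMap_le_iff.2 (by rw [hv, map_one])
  have h1' : absVal F Fs (algebraMap F Fs 1) ≤ absVal F Fs (algebraMap F Fs 2) :=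
    absVal_algebraMap_le_iff.2 (by rw [hv, map_one])
  have := le_antisymm h1 h1'
  rwa [map_ofNat, map_one, map_one] at this

variable {K L : IntermediateField F Fs}

theorem mem_of_forall_gal_eq {x : Fs} (h : ∀ σ : Fs ≃ₐ[F] Fs, (∀ y ∈ L, σ y = y) → σ x = x) :
    x ∈ L := by
  have : IsGalois F Fs := IsSepClosure.isGalois
  rw [← InfiniteGalois.fixedField_fixingSubgroup L, IntermediateField.mem_fixedField_iff]
  intro σ hσ
  exact h σ fun y hy => (IntermediateField.mem_fixingSubgroup_iff L σ).1 hσ y hy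

/-- `x` is the square of an element of `L`. -/
def IsSqIn (L : IntermediateField F Fs) (x : Fs) : Prop := ∃ y ∈ L, x = y ^ 2

theorem IsSqIn.mul {x y : Fs} (hx : IsSqIn L x) (hy : IsSqIn L y) : IsSqIn L (x * y) := by
  obtain ⟨a, ha, rfl⟩ := hx
  obtain ⟨b, hb, rfl⟩ := hy
  exact ⟨a * b, L.mul_mem ha hb, by ring⟩

theorem IsSqIn.inv {x : Fs} (hx : IsSqIn L x) : IsSqIn L x⁻¹ := by
  obtain ⟨a, ha, rfl⟩ := hx
  exact ⟨a⁻¹, L.inv_mem ha, by rw [inv_pow]⟩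

theorem IsSqIn.of_mul_left {x y : Fs} (hy : IsSqIn L y) (hy0 : y ≠ 0) (h : IsSqIn L (x * y)) :
    IsSqIn L x := by
  have := h.mul hy.inv
  rwa [mul_inv_cancel_right₀ hy0] at this

theorem IsSqIn.mono (h : K ≤ L) {x : Fs} (hx : IsSqIn K x) : IsSqIn L x := by
  obtain ⟨a, ha, rfl⟩ := hx
  exact ⟨a, h ha, rfl⟩

theorem exists_sq_eq (h2 : absVal F Fs 2 = 1) (x : Fs) : ∃ s : Fs, s ^ 2 = x := by
  have : IsSepClosed Fs := IsSepClosure.sep_closed F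
  have h20 : (2 : Fs) ≠ 0 := by
    intro h0
    rw [h0, map_zero] at h2
    exact zero_ne_one h2
  have : NeZero ((2 : ℕ) : Fs) := ⟨by exact_mod_cast h20⟩
  exact IsSepClosed.exists_pow_nat_eq x 2

/-- Hensel's lemma for squares: `1 + 𝔪_L` consists of squares, since otherwise some automorphism
over `L` would exchange a square root near `1` with its negative. -/
theorem isSqIn_of_sub_one_lt (h2 : absVal F Fs 2 = 1) {x : Fs} (hx : x ∈ L)
    (h : absVal F Fs (x - 1) < 1) : IsSqIn L x := by
  obtain ⟨s, hs⟩ : ∃ s : Fs, s ^ 2 = x ∧ absVal F Fs (s - 1) < 1 := by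
    obtain ⟨s, rfl⟩ := exists_sq_eq h2 x
    rw [show s ^ 2 - 1 = (s - 1) * (s + 1) by ring, map_mul] at h
    by_cases h1 : absVal F Fs (s - 1) < 1
    · exact ⟨s, rfl, h1⟩
    · refine ⟨-s, by ring, ?_⟩
      rw [show -s - 1 = -(s + 1) by ring, Valuation.map_neg]
      by_contra h3
      exact absurd h (not_lt.2 (one_le_mul (not_lt.1 h1) (not_lt.1 h3)))
  refine ⟨s, mem_of_forall_gal_eq fun σ hσ => ?_, hs.1.symm⟩
  have hσs : (σ s) ^ 2 = s ^ 2 := by rw [← map_pow, hs.1, hσ x hx]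
  rcases sq_eq_sq_iff_eq_or_eq_neg.1 hσs with h' | h'
  · exact h'
  exfalso
  have h1 : absVal F Fs (s + 1) < 1 := by
    rw [← Valuation.map_neg, show -(s + 1) = -s - 1 by ring, ← h', ← map_one σ, ← map_sub,
      absVal_gal]
    exact hs.2
  have h3 := (absVal F Fs).map_sub_lt h1 hs.2
  rw [show s + 1 - (s - 1) = 2 by ring, h2] at h3
  exact h3.false

theorem isSqIn_of_sub_sq_lt (h2 : absVal F Fs 2 = 1) {x y : Fs} (hx : x ∈ L) (hy : y ∈ L)
    (hx1 : absVal F Fs x = 1) (h : absVal F Fs (x - y ^ 2) < 1) : IsSqIn L x := by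
  have hy1 : absVal F Fs (y ^ 2) = 1 := by
    apply absVal_eq_one_of_sub_lt hx1
    rwa [Valuation.map_sub_swap]
  have hy0 : y ^ 2 ≠ 0 := by
    intro h0
    rw [h0, map_zero] at hy1
    exact zero_ne_one hy1
  have h3 : IsSqIn L (x / y ^ 2) := by
    apply isSqIn_of_sub_one_lt h2 (L.div_mem hx (pow_mem hy 2))
    rw [div_sub_one hy0, map_div₀, hy1, div_one]
    exact h
  have := h3.mul (⟨y, hy, rfl⟩ : IsSqIn L (y ^ 2))
  rwa [div_mul_cancel₀ _ hy0] at this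

theorem residue_eq_residue_iff {x y : integers L} :
    IsLocalRing.residue (integers L) x = IsLocalRing.residue (integers L) y ↔
      absVal F Fs ((x : L) - (y : L) : Fs) < 1 := by
  rw [← sub_eq_zero, ← map_sub, IsLocalRing.residue_eq_zero_iff, mem_maximalIdeal_iff_absVal]
  rfl

/-- A unit is a square in `L` if and only if its residue class is a square: this translates
statements on residue fields into statements on elements of `Fs`. -/
theorem isSquare_residue_iff (h2 : absVal F Fs 2 = 1) {x : integers L}
    (hx : absVal F Fs (x : L) = 1) :
    IsSquare (IsLocalRing.residue (integers L) x) ↔ IsSqIn L (x : L) := by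
  constructor
  · rintro ⟨y, hy⟩
    obtain ⟨y, rfl⟩ := IsLocalRing.residue_surjective y
    rw [← map_mul, residue_eq_residue_iff] at hy
    refine isSqIn_of_sub_sq_lt h2 (x : L).2 (y : L).2 hx ?_
    rw [sq]
    exact hy
  · rintro ⟨y, hy, hxy⟩
    have hy1 : absVal F Fs y ≤ 1 := by
      rw [hxy, map_pow] at hx
      exact (pow_le_one_iff_of_nonneg zero_le two_ne_zero).1 hx.le
    refine ⟨IsLocalRing.residue (integers L) ⟨⟨y, hy⟩, mem_integers_iff_absVal.2 hy1⟩, ?_⟩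
    rw [← map_mul]
    congr 1
    exact Subtype.ext (Subtype.ext (hxy.trans (sq y)))

theorem ringChar_residueField_ne_two (h2 : absVal F Fs 2 = 1) (L : IntermediateField F Fs) :
    ringChar (ResidueField L) ≠ 2 := by
  intro h
  have h0 : (2 : ResidueField L) = 0 := by
    have := ringChar.Nat.cast_ringChar (R := ResidueField L)
    rw [h] at this
    exact_mod_cast this
  rw [← map_ofNat (IsLocalRing.residue (integers L)) 2, IsLocalRing.residue_eq_zero_iff,
    mem_maximalIdeal_iff_absVal] at h0
  have h3 : absVal F Fs (2 : Fs) < 1 := h0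
  exact h3.ne h2

theorem residue_ne_zero {x : integers L} (hx : absVal F Fs (x : L) = 1) :
    IsLocalRing.residue (integers L) x ≠ 0 := by
  rw [ne_eq, IsLocalRing.residue_eq_zero_iff, mem_maximalIdeal_iff_absVal, hx]
  exact lt_irrefl 1

theorem absVal_eq_one_of_residue_ne_zero {x : integers L}
    (hx : IsLocalRing.residue (integers L) x ≠ 0) : absVal F Fs (x : L) = 1 := by
  rw [ne_eq, IsLocalRing.residue_eq_zero_iff, mem_maximalIdeal_iff_absVal, not_lt] at hx
  exact le_antisymm (mem_integers_iff_absVal.1 x.2) hx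

theorem exists_not_isSqIn (h2 : absVal F Fs 2 = 1) (L : IntermediateField F Fs)
    [FiniteDimensional F L] : ∃ u ∈ L, absVal F Fs u = 1 ∧ ¬ IsSqIn L u := by
  have := (isDedekindDomain_integers_and_finite L).2
  obtain ⟨a, ha⟩ := FiniteField.exists_nonsquare (ringChar_residueField_ne_two h2 L)
  obtain ⟨a, rfl⟩ := IsLocalRing.residue_surjective a
  have ha1 : absVal F Fs (a : L) = 1 := by
    apply absVal_eq_one_of_residue_ne_zero
    intro h0
    rw [h0] at ha
    exact ha IsSquare.zero
  exact ⟨(a : L), (a : L).2, ha1, fun h => ha ((isSquare_residue_iff h2 ha1).2 h)⟩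

/-- The product of two non-square units is a square, as in a finite field. -/
theorem isSqIn_mul_of_not [FiniteDimensional F L] (h2 : absVal F Fs 2 = 1) {u u' : Fs}
    (hu : u ∈ L) (hu' : u' ∈ L) (h1 : absVal F Fs u = 1) (h1' : absVal F Fs u' = 1)
    (hn : ¬ IsSqIn L u) (hn' : ¬ IsSqIn L u') : IsSqIn L (u * u') := by
  classical
  have := (isDedekindDomain_integers_and_finite L).2
  have := Fintype.ofFinite (ResidueField L)
  let x : integers L := ⟨⟨u, hu⟩, mem_integers_iff_absVal.2 h1.le⟩
  let y : integers L := ⟨⟨u', hu'⟩, mem_integers_iff_absVal.2 h1'.le⟩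
  have hx := (isSquare_residue_iff (x := x) h2 h1).not.2 hn
  have hy := (isSquare_residue_iff (x := y) h2 h1').not.2 hn'
  have hxy1 : absVal F Fs ((x * y : integers L) : L) = 1 := by
    change absVal F Fs (u * u') = 1
    rw [map_mul, h1, h1', one_mul]
  have hxy := isSquare_residue_iff (x := x * y) h2 hxy1
  refine hxy.1 ?_
  rw [← quadraticChar_neg_one_iff_not_isSquare] at hx hy
  rw [← quadraticChar_one_iff_isSquare (residue_ne_zero hxy1), map_mul, map_mul, hx, hy]
  norm_num

/-- Over a residue field of odd characteristic every unit is, modulo the maximal ideal, a value of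
the binary quadratic form `a² - c b²`. -/
theorem exists_sub_sq_mul_sq (h2 : absVal F Fs 2 = 1) [FiniteDimensional F L] {c d : Fs}
    (hc : c ∈ L) (hc1 : absVal F Fs c = 1) (hd : d ∈ L) (hd1 : absVal F Fs d = 1) :
    ∃ a ∈ L, ∃ b ∈ L, absVal F Fs (a ^ 2 - c * b ^ 2 - d) < 1 := by
  have := (isDedekindDomain_integers_and_finite L).2
  have := Fintype.ofFinite (ResidueField L)
  let x : integers L := ⟨⟨c, hc⟩, mem_integers_iff_absVal.2 hc1.le⟩
  let y : integers L := ⟨⟨d, hd⟩, mem_integers_iff_absVal.2 hd1.le⟩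
  have hx := residue_ne_zero (x := x) hc1
  have hodd : Fintype.card (ResidueField L) % 2 = 1 :=
    FiniteField.odd_card_of_char_ne_two (ringChar_residueField_ne_two h2 L)
  obtain ⟨a, b, hab⟩ := FiniteField.exists_root_sum_quadratic
    (f := (Polynomial.X ^ 2 : Polynomial (ResidueField L)))
    (g := Polynomial.C (-IsLocalRing.residue (integers L) x) * Polynomial.X ^ 2 +
      Polynomial.C 0 * Polynomial.X + Polynomial.C (-IsLocalRing.residue (integers L) y))
    (Polynomial.degree_X_pow 2) (Polynomial.degree_quadratic (neg_ne_zero.2 hx)) hodd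
  obtain ⟨a, rfl⟩ := IsLocalRing.residue_surjective a
  obtain ⟨b, rfl⟩ := IsLocalRing.residue_surjective b
  refine ⟨(a : L), (a : L).2, (b : L), (b : L).2, ?_⟩
  have h0 : IsLocalRing.residue (integers L) (a ^ 2 - x * b ^ 2 - y) = 0 := by
    simp only [map_sub, map_mul, map_pow]
    simp at hab
    linear_combination hab
  rw [IsLocalRing.residue_eq_zero_iff, mem_maximalIdeal_iff_absVal] at h0
  exact h0

/-- If the residue degree is even, then the units of `K` become squares in `L`. -/
theorem odd_resDegree_or (h2 : absVal F Fs 2 = 1) (h : K ≤ L) [FiniteDimensional F L] :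
    Odd (resDegree h) ∨ ∀ u ∈ K, absVal F Fs u = 1 → IsSqIn L u := by
  rw [or_iff_not_imp_left, Nat.not_odd_iff_even]
  rintro ⟨g, hg⟩ u hu hu1
  have := finiteDimensional_of_le h
  have := (isDedekindDomain_integers_and_finite K).2
  have := (isDedekindDomain_integers_and_finite L).2
  have := Fintype.ofFinite (ResidueField K)
  have := Fintype.ofFinite (ResidueField L)
  let x : integers K := ⟨⟨u, hu⟩, mem_integers_iff_absVal.2 hu1.le⟩
  have hx0 := residue_ne_zero (x := x) hu1
  have hxL : absVal F Fs ((integersMap h x : integers L) : L) = 1 := hu1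
  refine (isSquare_residue_iff (x := integersMap h x) h2 hxL).1 ?_
  rw [FiniteField.isSquare_iff (ringChar_residueField_ne_two h2 L) (residue_ne_zero hxL)]
  have hcard : Fintype.card (ResidueField L) = Fintype.card (ResidueField K) ^ resDegree h := by
    letI : Module (ResidueField K) (ResidueField L) := (residueAlgebra h).toModule
    exact Module.card_eq_pow_finrank
  set q := Fintype.card (ResidueField K) with hq
  have hq1 : 1 ≤ q ^ g := Nat.one_le_pow _ _ Fintype.card_pos
  have hqodd : Odd q := Nat.odd_iff.2
    (FiniteField.odd_card_of_char_ne_two (ringChar_residueField_ne_two h2 K))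
  obtain ⟨m, hm⟩ := hqodd.pow (n := g)
  have hdiv : Fintype.card (ResidueField L) / 2 = (q ^ g - 1) * (m + 1) := by
    rw [hcard, hg, pow_add, hm, Nat.add_sub_cancel]
    have : (2 * m + 1) * (2 * m + 1) = 2 * (2 * m * (m + 1)) + 1 := by ring
    omega
  have hpow : IsLocalRing.residue (integers K) x ^ (q ^ g - 1) = 1 := by
    have h1 : IsLocalRing.residue (integers K) x ^ (q ^ g) = IsLocalRing.residue (integers K) x :=
      FiniteField.pow_card_pow g _
    apply mul_right_cancel₀ hx0
    rw [← pow_succ, Nat.sub_add_cancel hq1, h1, one_mul]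
  rw [hdiv, pow_mul]
  have hmap : IsLocalRing.residue (integers L) (integersMap h x) =
      IsLocalRing.ResidueField.map (integersMap h) (IsLocalRing.residue (integers K) x) := rfl
  rw [hmap, ← map_pow, hpow, map_one, one_pow]

end Squares

/-! ### Quadratic extensions -/

/-- A basis `1, s` of a quadratic extension. -/
theorem exists_basis_one {k l : Type*} [Field k] [Field l] [Algebra k l] {s : l}
    (hli : ∀ a b : k, algebraMap k l a + algebraMap k l b * s = 0 → a = 0 ∧ b = 0)
    (hsp : ∀ x : l, ∃ a b : k, x = algebraMap k l a + algebraMap k l b * s) :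
    ∃ e : Module.Basis (Fin 2) k l, e 0 = 1 ∧ e 1 = s := by
  have hli' : LinearIndependent k ![(1 : l), s] := by
    rw [LinearIndependent.pair_iff]
    intro x y hxy
    rw [Algebra.smul_def, Algebra.smul_def, mul_one] at hxy
    exact hli x y hxy
  have hsp' : ⊤ ≤ Submodule.span k (Set.range ![(1 : l), s]) := by
    rintro x -
    obtain ⟨a, b, rfl⟩ := hsp x
    rw [Matrix.range_cons, Matrix.range_cons, Matrix.range_empty, Set.union_empty,
      Set.singleton_union, Submodule.mem_span_pair]
    exact ⟨a, b, by rw [Algebra.smul_def, Algebra.smul_def, mul_one]⟩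
  exact ⟨Module.Basis.mk hli' hsp', by simp, by simp⟩

/-- The norm form of a quadratic extension `l = k(s)` with `s² = d ∈ k`. -/
theorem norm_add_mul {k l : Type*} [Field k] [Field l] [Algebra k l]
    (e : Module.Basis (Fin 2) k l) {s : l} (he0 : e 0 = 1) (he1 : e 1 = s) {d : k}
    (hd : s ^ 2 = algebraMap k l d) (a b : k) :
    Algebra.norm k (algebraMap k l a + algebraMap k l b * s) = a ^ 2 - d * b ^ 2 := by
  have hrepr (u v : k) : e.repr (u • e 0 + v • e 1) =
      Finsupp.single 0 u + Finsupp.single 1 v := by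
    rw [map_add, map_smul, map_smul, e.repr_self, e.repr_self, Finsupp.smul_single,
      Finsupp.smul_single, smul_eq_mul, smul_eq_mul, mul_one, mul_one]
  have h0 : (algebraMap k l a + algebraMap k l b * s) * e 0 = a • e 0 + b • e 1 := by
    rw [he0, he1, Algebra.smul_def, Algebra.smul_def]
    ring
  have h1 : (algebraMap k l a + algebraMap k l b * s) * e 1 = (b * d) • e 0 + a • e 1 := by
    rw [he0, he1, Algebra.smul_def, Algebra.smul_def, map_mul, ← hd]
    ring
  rw [Algebra.norm_eq_matrix_det e, Matrix.det_fin_two]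
  simp only [Algebra.leftMulMatrix_eq_repr_mul, h0, h1, hrepr]
  simp
  ring

section Quadratic

variable {F Fs : Type*} [Field F] [ValuativeRel F] [TopologicalSpace F]
  [IsNonarchimedeanLocalField F] [Field Fs] [Algebra F Fs] [IsSepClosure F Fs]

/-- `L/K` is a quadratic extension whose non-trivial automorphism is the restriction of `τ`. -/
structure IsQuad (K L : IntermediateField F Fs) (τ : Fs ≃ₐ[F] Fs) : Prop where
  le : K ≤ L
  fixed_iff : ∀ x ∈ L, τ x = x ↔ x ∈ K
  map_mem : ∀ x ∈ L, τ x ∈ L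
  involutive : ∀ x ∈ L, τ (τ x) = x
  exists_ne : ∃ x ∈ L, τ x ≠ x

/-- `s` is an element of `L`, non-zero and anti-invariant under `τ`, so that `L = K(s)` with
`s² ∈ K`. -/
structure IsAnti (L : IntermediateField F Fs) (τ : Fs ≃ₐ[F] Fs) (s : Fs) : Prop where
  mem : s ∈ L
  ne_zero : s ≠ 0
  map_eq : τ s = -s

theorem two_ne_zero_of_absVal_two (h2 : absVal F Fs 2 = 1) : (2 : Fs) ≠ 0 := by
  intro h0
  rw [h0, map_zero] at h2
  exact zero_ne_one h2

variable {K L : IntermediateField F Fs} {τ : Fs ≃ₐ[F] Fs} {s : Fs}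

theorem two_mem (K : IntermediateField F Fs) : (2 : Fs) ∈ K := ofNat_mem K 2

theorem IsQuad.mem_of_fixed (hq : IsQuad K L τ) {x : Fs} (hx : x ∈ L) (h : τ x = x) : x ∈ K :=
  (hq.fixed_iff x hx).1 h

theorem IsQuad.apply_eq (hq : IsQuad K L τ) {x : Fs} (hx : x ∈ K) : τ x = x :=
  (hq.fixed_iff x (hq.le hx)).2 hx

theorem IsQuad.exists_isAnti (hq : IsQuad K L τ) : ∃ s, IsAnti L τ s := by
  obtain ⟨x, hx, hne⟩ := hq.exists_ne
  refine ⟨x - τ x, L.sub_mem hx (hq.map_mem x hx), sub_ne_zero.2 hne.symm, ?_⟩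
  rw [map_sub, hq.involutive x hx, neg_sub]

theorem IsAnti.sq_mem (hs : IsAnti L τ s) (hq : IsQuad K L τ) : s ^ 2 ∈ K := by
  refine hq.mem_of_fixed (pow_mem hs.mem 2) ?_
  rw [map_pow, hs.map_eq, neg_sq]

theorem IsAnti.notMem (hs : IsAnti L τ s) (hq : IsQuad K L τ) (h2 : absVal F Fs 2 = 1) :
    s ∉ K := by
  intro h
  have h1 := hq.apply_eq h
  rw [hs.map_eq] at h1
  have h3 : 2 * s = 0 := by linear_combination -h1
  rcases mul_eq_zero.1 h3 with h4 | h4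
  · exact two_ne_zero_of_absVal_two h2 h4
  · exact hs.ne_zero h4

theorem IsAnti.mul (hs : IsAnti L τ s) (hq : IsQuad K L τ) {z : Fs} (hz : z ∈ K) (hz0 : z ≠ 0) :
    IsAnti L τ (z * s) :=
  ⟨L.mul_mem (hq.le hz) hs.mem, mul_ne_zero hz0 hs.ne_zero, by
    rw [map_mul, hs.map_eq, hq.apply_eq hz, mul_neg]⟩

theorem IsAnti.not_isSqIn_sq (hs : IsAnti L τ s) (hq : IsQuad K L τ) (h2 : absVal F Fs 2 = 1) :
    ¬ IsSqIn K (s ^ 2) := by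
  rintro ⟨y, hy, hys⟩
  rcases sq_eq_sq_iff_eq_or_eq_neg.1 hys with h | h
  · exact hs.notMem hq h2 (h ▸ hy)
  · exact hs.notMem hq h2 (h ▸ K.neg_mem hy)

theorem IsAnti.exists_eq_add (hs : IsAnti L τ s) (hq : IsQuad K L τ) (h2 : absVal F Fs 2 = 1)
    {x : Fs} (hx : x ∈ L) : ∃ a ∈ K, ∃ b ∈ K, x = a + b * s := by
  have h20 := two_ne_zero_of_absVal_two h2
  have hs0 := hs.ne_zero
  have hτ := hq.map_mem x hx
  refine ⟨(x + τ x) / 2, hq.mem_of_fixed ?_ ?_, (x - τ x) / (2 * s), hq.mem_of_fixed ?_ ?_, ?_⟩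
  · exact L.div_mem (L.add_mem hx hτ) (two_mem L)
  · rw [map_div₀, map_add, hq.involutive x hx, map_ofNat, add_comm]
  · exact L.div_mem (L.sub_mem hx hτ) (L.mul_mem (two_mem L) hs.mem)
  · rw [map_div₀, map_sub, hq.involutive x hx, map_mul, map_ofNat, hs.map_eq]
    field_simp
    ring
  · field_simp
    ring

theorem IsAnti.mul_apply_eq (hs : IsAnti L τ s) (hq : IsQuad K L τ) {a b : Fs} (ha : a ∈ K)
    (hb : b ∈ K) : (a + b * s) * τ (a + b * s) = a ^ 2 - s ^ 2 * b ^ 2 := by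
  rw [map_add, map_mul, hs.map_eq, hq.apply_eq ha, hq.apply_eq hb]
  ring

/-- Adjoining to `K` a square root `s` of an element of `K`, with `s ∉ K`. -/
theorem exists_isQuad_of_sq_mem (h2 : absVal F Fs 2 = 1) (hs : s ^ 2 ∈ K) (hsK : s ∉ K) :
    ∃ (M : IntermediateField F Fs) (τ : Fs ≃ₐ[F] Fs), IsQuad K M τ ∧ IsAnti M τ s ∧
      ∀ L : IntermediateField F Fs, K ≤ L → s ∈ L → M ≤ L := by
  obtain ⟨τ, hτK, hτs⟩ : ∃ τ : Fs ≃ₐ[F] Fs, (∀ y ∈ K, τ y = y) ∧ τ s ≠ s := by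
    by_contra! H
    exact hsK (mem_of_forall_gal_eq H)
  have hs0 : s ≠ 0 := fun h => hsK (h ▸ K.zero_mem)
  have hτ : τ s = -s := by
    have h1 : (τ s) ^ 2 = s ^ 2 := by rw [← map_pow, hτK _ hs]
    exact (sq_eq_sq_iff_eq_or_eq_neg.1 h1).resolve_left hτs
  let A : Subalgebra F Fs :=
    { carrier := {x | ∃ a ∈ K, ∃ b ∈ K, x = a + b * s}
      mul_mem' := by
        rintro _ _ ⟨a, ha, b, hb, rfl⟩ ⟨c, hc, d, hd, rfl⟩
        exact ⟨a * c + b * d * s ^ 2,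
          K.add_mem (K.mul_mem ha hc) (K.mul_mem (K.mul_mem hb hd) hs),
          a * d + b * c, K.add_mem (K.mul_mem ha hd) (K.mul_mem hb hc), by ring⟩
      add_mem' := by
        rintro _ _ ⟨a, ha, b, hb, rfl⟩ ⟨c, hc, d, hd, rfl⟩
        exact ⟨a + c, K.add_mem ha hc, b + d, K.add_mem hb hd, by ring⟩
      algebraMap_mem' := fun r => ⟨_, K.algebraMap_mem r, 0, K.zero_mem, by ring⟩ }
  let M : IntermediateField F Fs := A.toIntermediateField (by
    rintro _ ⟨a, ha, b, hb, rfl⟩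
    by_cases hN : a ^ 2 - s ^ 2 * b ^ 2 = 0
    · have h0 : a + b * s = 0 := by
        have hb0 : b = 0 := by
          by_contra hb0
          have h1 : (a / b) ^ 2 = s ^ 2 := by
            field_simp
            linear_combination hN
          rcases sq_eq_sq_iff_eq_or_eq_neg.1 h1 with h | h
          · exact hsK (h ▸ K.div_mem ha hb)
          · exact hsK (by rw [← neg_neg s, ← h]; exact K.neg_mem (K.div_mem ha hb))
        subst hb0
        have : a = 0 := by simpa using hN
        simp [this]
      rw [h0, inv_zero]
      exact A.zero_mem
    · have hD : a ^ 2 - s ^ 2 * b ^ 2 ∈ K :=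
        K.sub_mem (pow_mem ha 2) (K.mul_mem hs (pow_mem hb 2))
      refine ⟨a / (a ^ 2 - s ^ 2 * b ^ 2), K.div_mem ha hD, -b / (a ^ 2 - s ^ 2 * b ^ 2),
        K.div_mem (K.neg_mem hb) hD, inv_eq_of_mul_eq_one_right ?_⟩
      rw [← div_self hN]
      ring)
  have hKM : K ≤ M := fun x hx => ⟨x, hx, 0, K.zero_mem, by ring⟩
  have hsM : s ∈ M := ⟨0, K.zero_mem, 1, K.one_mem, by ring⟩
  refine ⟨M, τ, ⟨hKM, ?_, ?_, ?_, ⟨s, hsM, hτs⟩⟩, ⟨hsM, hs0, hτ⟩, ?_⟩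
  · intro x hx
    refine ⟨fun h => ?_, hτK x⟩
    obtain ⟨a, ha, b, hb, rfl⟩ := hx
    rw [map_add, map_mul, hτK a ha, hτK b hb, hτ] at h
    have h3 : 2 * (b * s) = 0 := by linear_combination -h
    have h4 := (mul_eq_zero.1 h3).resolve_left (two_ne_zero_of_absVal_two h2)
    rw [h4, add_zero]
    exact ha
  · rintro _ ⟨a, ha, b, hb, rfl⟩
    rw [map_add, map_mul, hτK a ha, hτK b hb, hτ]
    exact ⟨a, ha, -b, K.neg_mem hb, by ring⟩
  · rintro _ ⟨a, ha, b, hb, rfl⟩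
    rw [map_add, map_mul, hτK a ha, hτK b hb, hτ, map_add, map_mul, map_neg, hτK a ha, hτK b hb,
      hτ, neg_neg]
  · rintro L hKL hsL _ ⟨a, ha, b, hb, rfl⟩
    exact L.add_mem (hKL ha) (L.mul_mem (hKL hb) hsL)

/-- The basis `1, s` of a quadratic extension `L = K(s)`. -/
theorem IsAnti.exists_basis (hs : IsAnti L τ s) (hq : IsQuad K L τ) (h2 : absVal F Fs 2 = 1) :
    letI := inclAlgebra hq.le
    ∃ b : Module.Basis (Fin 2) K L, b 0 = 1 ∧ b 1 = ⟨s, hs.mem⟩ := by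
  letI := inclAlgebra hq.le
  refine exists_basis_one (fun x y hxy => ?_) fun x => ?_
  · have hxy' : (x : Fs) + y * s = 0 := congrArg Subtype.val hxy
    have hy : (y : Fs) = 0 := by
      by_contra hy
      refine hs.notMem hq h2 ?_
      have : s = -(x : Fs) / y := by
        field_simp
        linear_combination hxy'
      rw [this]
      exact K.div_mem (K.neg_mem x.2) y.2
    rw [hy] at hxy'
    have hx : (x : Fs) = 0 := by linear_combination hxy'
    exact ⟨Subtype.ext hx, Subtype.ext hy⟩
  · obtain ⟨a, ha, b, hb, hab⟩ := hs.exists_eq_add hq h2 x.2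
    exact ⟨⟨a, ha⟩, ⟨b, hb⟩, Subtype.ext hab⟩

theorem IsQuad.relDegree_eq (hq : IsQuad K L τ) (h2 : absVal F Fs 2 = 1) :
    relDegree hq.le = 2 := by
  letI := inclAlgebra hq.le
  obtain ⟨s, hs⟩ := hq.exists_isAnti
  obtain ⟨b, -⟩ := hs.exists_basis hq h2
  exact (Module.finrank_eq_card_basis b).trans (by simp)

theorem IsQuad.coe_relNorm (hq : IsQuad K L τ) (h2 : absVal F Fs 2 = 1) (x : L) :
    (relNorm hq.le x : Fs) = x * τ x := by
  letI := inclAlgebra hq.le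
  obtain ⟨s, hs⟩ := hq.exists_isAnti
  obtain ⟨e, he0, he1⟩ := hs.exists_basis hq h2
  obtain ⟨x, hx⟩ := x
  obtain ⟨a, ha, b, hb, rfl⟩ := hs.exists_eq_add hq h2 hx
  rw [hs.mul_apply_eq hq ha hb]
  exact congrArg Subtype.val
    (norm_add_mul e he0 he1 (d := ⟨s ^ 2, hs.sq_mem hq⟩) rfl ⟨a, ha⟩ ⟨b, hb⟩)

end Quadratic

section QuadraticRamification

variable {F Fs : Type*} [Field F] [ValuativeRel F] [TopologicalSpace F]
  [IsNonarchimedeanLocalField F] [Field Fs] [Algebra F Fs] [IsSepClosure F Fs]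

variable {K L : IntermediateField F Fs} {τ : Fs ≃ₐ[F] Fs} {s w : Fs}

theorem ne_zero_of_absVal_eq_one {x : Fs} (h : absVal F Fs x = 1) : x ≠ 0 := by
  rintro rfl
  rw [map_zero] at h
  exact zero_ne_one h

theorem absVal_eq_one_of_sq {x : Fs} (h : absVal F Fs (x ^ 2) = 1) : absVal F Fs x = 1 := by
  rw [map_pow] at h
  exact (pow_eq_one_iff_of_nonneg zero_le two_ne_zero).1 h

theorem IsUniformizer.sq_ne (hw : IsUniformizer K w) {a b : Fs} (ha : a ∈ K) (hb : b ∈ K)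
    (hb0 : b ≠ 0) : absVal F Fs a ^ 2 ≠ absVal F Fs w * absVal F Fs b ^ 2 := by
  intro h
  have ha0 : a ≠ 0 := by
    rintro rfl
    rw [map_zero, zero_pow two_ne_zero] at h
    exact mul_ne_zero hw.val_pos.ne' (pow_ne_zero 2 (absVal_ne_zero hb0)) h.symm
  obtain ⟨i, hi⟩ := hw.exists_zpow ha ha0
  obtain ⟨j, hj⟩ := hw.exists_zpow hb hb0
  rw [hi, hj, ← zpow_natCast, ← zpow_natCast, ← zpow_mul, ← zpow_mul,
    ← zpow_one_add₀ hw.val_pos.ne'] at h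
  have := hw.zpow_inj h
  push_cast at this
  omega

theorem IsSqIn.add_of_lt (h2 : absVal F Fs 2 = 1) {x y : Fs} (hx : IsSqIn K x) (hy : y ∈ K)
    (h : absVal F Fs y < absVal F Fs x) : IsSqIn K (x + y) := by
  have hx0 : x ≠ 0 := by
    rintro rfl
    rw [map_zero] at h
    exact not_lt_zero h
  have hxK : x ∈ K := by
    obtain ⟨a, ha, rfl⟩ := hx
    exact pow_mem ha 2
  have h1 : IsSqIn K ((x + y) / x) := by
    refine isSqIn_of_sub_one_lt h2 (K.div_mem (K.add_mem hxK hy) hxK) ?_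
    rw [show (x + y) / x - 1 = y / x by field_simp; ring, map_div₀, div_lt_one₀ (absVal_pos hx0)]
    exact h
  have := h1.mul hx
  rwa [div_mul_cancel₀ _ hx0] at this

/-- The values of `a² - w b²`, for a uniformizer `w`, are squares or `-w` times squares, according
to which of the two terms dominates. -/
theorem IsUniformizer.isSqIn_form (h2 : absVal F Fs 2 = 1) (hw : IsUniformizer K w) {a b : Fs}
    (ha : a ∈ K) (hb : b ∈ K) :
    IsSqIn K (a ^ 2 - w * b ^ 2) ∨ IsSqIn K (-((a ^ 2 - w * b ^ 2) * w)) := by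
  by_cases hb0 : b = 0
  · left
    exact ⟨a, ha, by rw [hb0]; ring⟩
  rcases lt_or_gt_of_ne (hw.sq_ne ha hb hb0) with h | h
  · right
    have h3 : IsSqIn K ((w * b) ^ 2 + -(a ^ 2 * w)) := by
      refine IsSqIn.add_of_lt h2 ⟨_, K.mul_mem hw.mem hb, rfl⟩
        (K.neg_mem (K.mul_mem (pow_mem ha 2) hw.mem)) ?_
      rw [Valuation.map_neg, map_mul, map_pow, mul_pow, map_mul, map_pow, map_pow]
      calc absVal F Fs a ^ 2 * absVal F Fs w
          < absVal F Fs w * absVal F Fs b ^ 2 * absVal F Fs w :=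
            mul_lt_mul_of_pos_right h hw.val_pos
        _ = absVal F Fs w ^ 2 * absVal F Fs b ^ 2 := by ring
    have h4 : -((a ^ 2 - w * b ^ 2) * w) = (w * b) ^ 2 + -(a ^ 2 * w) := by ring
    rw [h4]
    exact h3
  · left
    rw [sub_eq_add_neg]
    refine IsSqIn.add_of_lt h2 ⟨a, ha, rfl⟩ (K.neg_mem (K.mul_mem hw.mem (pow_mem hb 2))) ?_
    rw [Valuation.map_neg, map_mul, map_pow, map_pow]
    exact h

theorem IsUniformizer.not_isSqIn_mul (hw : IsUniformizer K w) {u z : Fs} (hz : z ∈ K)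
    (hz0 : z ≠ 0) (hu : absVal F Fs u = absVal F Fs z ^ 2) : ¬ IsSqIn K (-(u * w)) := by
  rintro ⟨y, hy, h⟩
  refine hw.sq_ne hy hz hz0 ?_
  rw [← map_pow, ← h, Valuation.map_neg, map_mul, hu, mul_comm]

/-- If `L = K(s)` with `s²` a unit, then the basis `1, s` is orthogonal for the absolute value. -/
theorem IsAnti.absVal_add (hs : IsAnti L τ s) (hq : IsQuad K L τ) (h2 : absVal F Fs 2 = 1)
    (hs1 : absVal F Fs s = 1) {a b : Fs} (ha : a ∈ K) (hb : b ∈ K) :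
    absVal F Fs (a + b * s) = max (absVal F Fs a) (absVal F Fs b) := by
  have hbs : absVal F Fs (b * s) = absVal F Fs b := by rw [map_mul, hs1, mul_one]
  by_cases hab : absVal F Fs a = absVal F Fs b
  · by_cases hb0 : b = 0
    · simp [hb0]
    have hle := (absVal F Fs).map_add a (b * s)
    rw [hbs] at hle
    refine le_antisymm hle ?_
    rw [hab, max_self]
    by_contra! hlt
    have h1 : absVal F Fs (a / b + s) < 1 := by
      rw [show a / b + s = (a + b * s) / b by field_simp, map_div₀, div_lt_one₀ (absVal_pos hb0)]
      exact hlt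
    have h3 : absVal F Fs (a / b - s) ≤ 1 := by
      refine (absVal F Fs).map_sub_le ?_ hs1.le
      rw [map_div₀, hab, div_self (absVal_ne_zero hb0)]
    refine hs.not_isSqIn_sq hq h2 (isSqIn_of_sub_sq_lt h2 (hs.sq_mem hq) (K.div_mem ha hb)
      (by rw [map_pow, hs1, one_pow]) ?_)
    rw [show s ^ 2 - (a / b) ^ 2 = -((a / b + s) * (a / b - s)) by ring, Valuation.map_neg, map_mul]
    exact mul_lt_one_of_lt_of_le h1 h3
  · rw [← hbs] at hab ⊢
    exact (absVal F Fs).map_add_of_distinct_val hab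

theorem IsAnti.ramIndex_eq_one (hs : IsAnti L τ s) (hq : IsQuad K L τ) (h2 : absVal F Fs 2 = 1)
    (hs1 : absVal F Fs s = 1) [FiniteDimensional F L] : ramIndex hq.le = 1 := by
  rw [ramIndex_eq_one_iff]
  intro x hx _
  obtain ⟨a, ha, b, hb, rfl⟩ := hs.exists_eq_add hq h2 hx
  rw [hs.absVal_add hq h2 hs1 ha hb]
  rcases max_choice (absVal F Fs a) (absVal F Fs b) with h | h
  · exact ⟨a, ha, h⟩
  · exact ⟨b, hb, h⟩

theorem IsAnti.ramIndex_ne_one (hs : IsAnti L τ s) (hq : IsQuad K L τ)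
    (hw : IsUniformizer K (s ^ 2)) [FiniteDimensional F L] : ramIndex hq.le ≠ 1 := by
  rw [ne_eq, ramIndex_eq_one_iff]
  intro H
  obtain ⟨y, hy, h⟩ := H s hs.mem hs.ne_zero
  refine hw.sq_ne hy K.one_mem one_ne_zero ?_
  rw [← h, map_pow, map_one, one_pow, mul_one]

/-- A quadratic extension is generated by a square root of a unit or of a uniformizer. -/
theorem IsQuad.exists_isAnti_normalized [FiniteDimensional F L] (hq : IsQuad K L τ) :
    (∃ s, IsAnti L τ s ∧ absVal F Fs s = 1) ∨ ∃ s, IsAnti L τ s ∧ IsUniformizer K (s ^ 2) := by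
  have := finiteDimensional_of_le hq.le
  obtain ⟨s, hs⟩ := hq.exists_isAnti
  obtain ⟨w, hw⟩ := exists_isUniformizer K
  obtain ⟨k, hk⟩ := hw.exists_zpow (hs.sq_mem hq) (pow_ne_zero 2 hs.ne_zero)
  have hw0 := hw.val_pos.ne'
  have key (m : ℤ) : absVal F Fs ((w ^ (-m) * s) ^ 2) = absVal F Fs w ^ (k - 2 * m) := by
    rw [mul_pow, map_mul, hk, map_pow, map_zpow₀, ← zpow_natCast, ← zpow_mul, ← zpow_add₀ hw0]
    congr 1
    push_cast
    ring
  rcases Int.even_or_odd' k with ⟨m, rfl | rfl⟩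
  · refine Or.inl ⟨w ^ (-m) * s, hs.mul hq (zpow_mem hw.mem _) (zpow_ne_zero _ hw.ne_zero),
      absVal_eq_one_of_sq ?_⟩
    rw [key, sub_self, zpow_zero]
  · have ha := hs.mul hq (zpow_mem hw.mem (-m)) (zpow_ne_zero _ hw.ne_zero)
    refine Or.inr ⟨_, ha, hw.of_absVal_eq (ha.sq_mem hq) ?_⟩
    rw [key, add_sub_cancel_left, zpow_one]

theorem IsQuad.exists_isAnti_of_unramified (hq : IsQuad K L τ)
    [FiniteDimensional F L] (he : ramIndex hq.le = 1) : ∃ s, IsAnti L τ s ∧ absVal F Fs s = 1 :=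
  hq.exists_isAnti_normalized.resolve_right fun ⟨_, hs, hw⟩ => hs.ramIndex_ne_one hq hw he

theorem IsQuad.exists_isAnti_of_ramified (hq : IsQuad K L τ) (h2 : absVal F Fs 2 = 1)
    [FiniteDimensional F L] (he : ramIndex hq.le ≠ 1) :
    ∃ s, IsAnti L τ s ∧ IsUniformizer K (s ^ 2) :=
  hq.exists_isAnti_normalized.resolve_left fun ⟨_, hs, hs1⟩ => he (hs.ramIndex_eq_one hq h2 hs1)

/-- The norms from an unramified quadratic extension are the elements of even valuation. -/
theorem IsQuad.exists_mul_apply_eq_iff (hq : IsQuad K L τ) (h2 : absVal F Fs 2 = 1)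
    [FiniteDimensional F L] (he : ramIndex hq.le = 1) {u : Fs} (hu : u ∈ K) (hu0 : u ≠ 0) :
    (∃ x ∈ L, x * τ x = u) ↔ ∃ z ∈ K, absVal F Fs u = absVal F Fs z ^ 2 := by
  have := finiteDimensional_of_le hq.le
  constructor
  · rintro ⟨x, hx, rfl⟩
    have hx0 : x ≠ 0 := left_ne_zero_of_mul hu0
    obtain ⟨z, hz, h⟩ := (ramIndex_eq_one_iff hq.le).1 he x hx hx0
    exact ⟨z, hz, by rw [map_mul, absVal_gal, h, sq]⟩
  · rintro ⟨z, hz, huz⟩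
    have hz0 : z ≠ 0 := by
      rintro rfl
      rw [map_zero, zero_pow two_ne_zero] at huz
      exact absVal_ne_zero hu0 huz
    -- after division by `z²`, the unit is approximated by a value `a² - s² b²` of the norm form
    obtain ⟨s, hs, hs1⟩ := hq.exists_isAnti_of_unramified he
    have hv : absVal F Fs (u / z ^ 2) = 1 := by
      rw [map_div₀, map_pow, huz, div_self (pow_ne_zero 2 (absVal_ne_zero hz0))]
    have hv0 := ne_zero_of_absVal_eq_one hv
    have hvK : u / z ^ 2 ∈ K := K.div_mem hu (pow_mem hz 2)
    obtain ⟨a, ha, b, hb, hab⟩ := exists_sub_sq_mul_sq (L := K) h2 (hs.sq_mem hq)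
      (by rw [map_pow, hs1, one_pow]) hvK hv
    rw [← hs.mul_apply_eq hq ha hb] at hab
    set x := a + b * s with hx
    have hxL : x ∈ L := L.add_mem (hq.le ha) (L.mul_mem (hq.le hb) hs.mem)
    have hNK : x * τ x ∈ K := by
      rw [hs.mul_apply_eq hq ha hb]
      exact K.sub_mem (pow_mem ha 2) (K.mul_mem (hs.sq_mem hq) (pow_mem hb 2))
    have hN1 : absVal F Fs (x * τ x) = 1 := absVal_eq_one_of_sub_lt hv hab
    have hN0 := ne_zero_of_absVal_eq_one hN1
    obtain ⟨y, hy, hy'⟩ : IsSqIn K ((u / z ^ 2) / (x * τ x)) := by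
      refine isSqIn_of_sub_one_lt h2 (K.div_mem hvK hNK) ?_
      rw [div_sub_one hN0, map_div₀, hN1, div_one, Valuation.map_sub_swap]
      exact hab
    refine ⟨z * y * x, L.mul_mem (hq.le (K.mul_mem hz hy)) hxL, ?_⟩
    rw [map_mul, hq.apply_eq (K.mul_mem hz hy)]
    have h5 : y ^ 2 * (x * τ x) * z ^ 2 = u := by
      rw [← hy', div_mul_cancel₀ _ hN0, div_mul_cancel₀ _ (pow_ne_zero 2 hz0)]
    rw [← h5]
    ring

/-- A unit is a norm from a ramified quadratic extension if and only if it is a square. -/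
theorem IsQuad.exists_mul_apply_eq_iff_isSqIn (hq : IsQuad K L τ) (h2 : absVal F Fs 2 = 1)
    [FiniteDimensional F L] (he : ramIndex hq.le ≠ 1) {u : Fs} (hu1 : absVal F Fs u = 1) :
    (∃ x ∈ L, x * τ x = u) ↔ IsSqIn K u := by
  obtain ⟨s, hs, hw⟩ := hq.exists_isAnti_of_ramified h2 he
  constructor
  · rintro ⟨x, hx, rfl⟩
    obtain ⟨a, ha, b, hb, rfl⟩ := hs.exists_eq_add hq h2 hx
    rw [hs.mul_apply_eq hq ha hb] at hu1 ⊢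
    refine (hw.isSqIn_form h2 ha hb).resolve_right ?_
    exact hw.not_isSqIn_mul K.one_mem one_ne_zero (by rw [hu1, map_one, one_pow])
  · rintro ⟨y, hy, rfl⟩
    exact ⟨y, hq.le hy, by rw [hq.apply_eq hy, sq]⟩

/-- For an unramified quadratic extension `L/K`, a unit of `L` is a square if and only if its norm
is a square in `K`: the norm of some non-square unit is a non-square, and units have only two square
classes. -/
theorem IsQuad.isSqIn_mul_apply_iff (hq : IsQuad K L τ) (h2 : absVal F Fs 2 = 1)
    [FiniteDimensional F L] (he : ramIndex hq.le = 1) {x : Fs} (hx : x ∈ L)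
    (hx1 : absVal F Fs x = 1) : IsSqIn K (x * τ x) ↔ IsSqIn L x := by
  have := finiteDimensional_of_le hq.le
  have hsq {y : Fs} (hy : IsSqIn L y) : IsSqIn K (y * τ y) := by
    obtain ⟨y, hy, rfl⟩ := hy
    refine ⟨y * τ y, hq.mem_of_fixed (L.mul_mem hy (hq.map_mem y hy)) ?_, ?_⟩
    · rw [map_mul, hq.involutive y hy, mul_comm]
    · rw [map_pow]
      ring
  refine ⟨fun h => ?_, hsq⟩
  by_contra hn
  obtain ⟨d, hd, hd1, hdn⟩ := exists_not_isSqIn h2 K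
  obtain ⟨y, hy, rfl⟩ := (hq.exists_mul_apply_eq_iff h2 he hd (ne_zero_of_absVal_eq_one hd1)).2
    ⟨1, K.one_mem, by rw [hd1, map_one, one_pow]⟩
  have hy1 : absVal F Fs y = 1 := by
    rw [map_mul, absVal_gal, ← sq, ← map_pow] at hd1
    exact absVal_eq_one_of_sq hd1
  have hxy := hsq (isSqIn_mul_of_not h2 hx hy hx1 hy1 hn fun h' => hdn (hsq h'))
  rw [map_mul, show x * y * (τ x * τ y) = y * τ y * (x * τ x) by ring] at hxy
  refine hdn (IsSqIn.of_mul_left h ?_ hxy)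
  exact mul_ne_zero (ne_zero_of_absVal_eq_one hx1)
    (ne_zero_of_absVal_eq_one ((absVal_gal τ x).trans hx1))

end QuadraticRamification

/-! ### Square classes and valuations of norms -/

section NormClasses

variable {F Fs : Type*} [Field F] [ValuativeRel F] [TopologicalSpace F]
  [IsNonarchimedeanLocalField F] [Field Fs] [Algebra F Fs] [IsSepClosure F Fs]

variable {K L : IntermediateField F Fs}

/-- If all units of `K` become squares in `L`, then `L` contains an unramified quadratic extension
of `K`. -/
theorem exists_unramified_quad_le (h2 : absVal F Fs 2 = 1) (h : K ≤ L) [FiniteDimensional F L]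
    (H : ∀ u ∈ K, absVal F Fs u = 1 → IsSqIn L u) :
    ∃ (M : IntermediateField F Fs) (τ : Fs ≃ₐ[F] Fs) (hq : IsQuad K M τ), M ≤ L ∧
      ramIndex hq.le = 1 := by
  have := finiteDimensional_of_le h
  obtain ⟨c, hc, hc1, hcn⟩ := exists_not_isSqIn h2 K
  obtain ⟨s, hs, rfl⟩ := H c hc hc1
  obtain ⟨M, τ, hq, ha, hM⟩ := exists_isQuad_of_sq_mem h2 hc fun hsK => hcn ⟨s, hsK, rfl⟩
  have hML := hM L h hs
  have := finiteDimensional_of_le hML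
  exact ⟨M, τ, hq, hML, ha.ramIndex_eq_one hq h2 (absVal_eq_one_of_sq hc1)⟩

theorem isSqIn_relNorm (h : K ≤ L) {x : L} (hx : IsSqIn L (x : Fs)) :
    IsSqIn K (relNorm h x : Fs) := by
  obtain ⟨y, hy, hxy⟩ := hx
  have : x = (⟨y, hy⟩ : L) ^ 2 := Subtype.ext hxy
  exact ⟨relNorm h ⟨y, hy⟩, (relNorm h ⟨y, hy⟩).2, by rw [this, map_pow]; rfl⟩

theorem isSqIn_pow_iff {c : Fs} (hc : c ∈ K) (hc0 : c ≠ 0) (hcn : ¬ IsSqIn K c) (n : ℕ) :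
    IsSqIn K (c ^ n) ↔ Even n := by
  have hsq (m : ℕ) : IsSqIn K (c ^ (2 * m)) := ⟨c ^ m, pow_mem hc m, by ring⟩
  rcases Nat.even_or_odd' n with ⟨m, rfl | rfl⟩
  · simp [hsq]
  · refine iff_of_false (fun h => hcn ?_) (by simp)
    rw [pow_succ, mul_comm] at h
    exact IsSqIn.of_mul_left (hsq m) (pow_ne_zero _ hc0) h

/-- The norm of a unit `u` of `L` is a square in `K` if and only if `u` is a square or the
ramification index is even: on residue fields the norm `N_{L/K}` is the `e`-th power of the norm
of `k_L / k_K`, and norms of finite fields preserve non-squares. The proof is by induction through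
unramified quadratic subextensions, which reduces to the case of odd residue degree. -/
theorem isSqIn_relNorm_iff (h2 : absVal F Fs 2 = 1) (h : K ≤ L) [FiniteDimensional F L] {u : L}
    (hu : absVal F Fs (u : Fs) = 1) :
    IsSqIn K (relNorm h u : Fs) ↔ IsSqIn L (u : Fs) ∨ Even (ramIndex h) := by
  induction hn : relDegree h using Nat.strong_induction_on generalizing K with
  | _ n ih =>
  by_cases H : ∀ c ∈ K, absVal F Fs c = 1 → IsSqIn L c
  · obtain ⟨M, τ, hq, hML, he⟩ := exists_unramified_quad_le h2 h H
    have := finiteDimensional_of_le hML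
    have hlt : relDegree hML < n := by
      have h1 := relDegree_mul hq.le hML
      have h3 := relDegree_pos hML
      rw [hq.relDegree_eq h2, hn] at h1
      omega
    have hM := ih _ hlt hML rfl
    have hN1 : absVal F Fs (relNorm hML u : Fs) = 1 := by rw [absVal_relNorm, hu, one_pow]
    rw [← ramIndex_mul hq.le hML, he, one_mul, ← hM, ← relNorm_trans hq.le hML, hq.coe_relNorm h2,
      hq.isSqIn_mul_apply_iff h2 he (relNorm hML u).2 hN1]
  · push Not at H
    obtain ⟨c, hc, hc1, hcn⟩ := H
    have hc0 := ne_zero_of_absVal_eq_one hc1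
    have hf : Odd (resDegree h) := (odd_resDegree_or h2 h).resolve_right fun H => hcn (H c hc hc1)
    -- the residue degree is odd; up to squares `u` is `1` or the unit `c` of `K`
    by_cases hsq : IsSqIn L (u : Fs)
    · exact iff_of_true (isSqIn_relNorm h hsq) (Or.inl hsq)
    have hcK : ¬ IsSqIn K c := fun h' => hcn (h'.mono h)
    have huc := isSqIn_mul_of_not h2 u.2 (h hc) hu hc1 hsq hcn
    have h3 := isSqIn_relNorm (x := u * IntermediateField.inclusion h ⟨c, hc⟩) h huc
    rw [map_mul, relNorm_inclusion] at h3
    have h4 : IsSqIn K ((relNorm h u : Fs) * c ^ relDegree h) := h3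
    have hN0 : (relNorm h u : Fs) ≠ 0 := by
      apply ne_zero_of_absVal_eq_one (F := F)
      rw [absVal_relNorm, hu, one_pow]
    have h5 : IsSqIn K (relNorm h u : Fs) ↔ IsSqIn K (c ^ relDegree h) := by
      constructor
      · intro h'
        rw [mul_comm] at h4
        exact IsSqIn.of_mul_left h' hN0 h4
      · intro h'
        exact IsSqIn.of_mul_left h' (pow_ne_zero _ hc0) h4
    rw [h5, isSqIn_pow_iff hc hc0 hcK, relDegree_eq, Nat.even_mul]
    simp [hsq, Nat.not_even_iff_odd.2 hf]

/-- If the residue degree is odd, the norm preserves odd valuations. -/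
theorem exists_sq_of_relNorm (h : K ≤ L) [FiniteDimensional F L] (hf : Odd (resDegree h)) {x : L}
    (hx : x ≠ 0) (hN : ∃ z ∈ K, absVal F Fs (relNorm h x : Fs) = absVal F Fs z ^ 2) :
    ∃ z ∈ L, absVal F Fs (x : Fs) = absVal F Fs z ^ 2 := by
  have := finiteDimensional_of_le h
  obtain ⟨w, hw⟩ := exists_isUniformizer K
  obtain ⟨y, hy⟩ := exists_isUniformizer L
  have hx0 : (x : Fs) ≠ 0 := fun h0 => hx (Subtype.ext h0)
  obtain ⟨i, hi⟩ := hy.exists_zpow x.2 hx0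
  obtain ⟨z, hz, hNz⟩ := hN
  have hz0 : z ≠ 0 := by
    rintro rfl
    rw [absVal_relNorm, map_zero, zero_pow two_ne_zero] at hNz
    exact pow_ne_zero _ (absVal_ne_zero hx0) hNz
  obtain ⟨j, hj⟩ := hw.exists_zpow hz hz0
  rw [absVal_relNorm, hi, hj, hw.absVal_eq_pow_ramIndex h hy, relDegree_eq, ← zpow_natCast,
    ← zpow_natCast, ← zpow_natCast, ← zpow_mul, ← zpow_mul, ← zpow_mul] at hNz
  have h1 := hy.zpow_inj hNz
  have he : (ramIndex h : ℤ) ≠ 0 := by exact_mod_cast ramIndex_ne_zero h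
  have h3 : i * resDegree h = 2 * j := by
    apply mul_left_cancel₀ he
    push_cast at h1
    linear_combination h1
  have hi2 : Even i := by
    have h4 : Even (i * resDegree h) := h3 ▸ even_two_mul j
    rcases Int.even_mul.1 h4 with h5 | h5
    · exact h5
    · exact absurd (by exact_mod_cast h5) (Nat.not_even_iff_odd.2 hf)
  obtain ⟨m, rfl⟩ := hi2
  refine ⟨y ^ m, zpow_mem hy.mem m, ?_⟩
  rw [hi, map_zpow₀, zpow_add₀ hy.val_pos.ne', sq]

/-- `x` is a norm from the (split or quadratic) extension `K(√w)`. -/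
def IsForm (K : IntermediateField F Fs) (w x : Fs) : Prop :=
  ∃ a ∈ K, ∃ b ∈ K, x = a ^ 2 - w * b ^ 2

theorem IsForm.sq_mul {w x z : Fs} (hx : IsForm K w x) (hz : z ∈ K) : IsForm K w (z ^ 2 * x) := by
  obtain ⟨a, ha, b, hb, rfl⟩ := hx
  exact ⟨z * a, K.mul_mem hz ha, z * b, K.mul_mem hz hb, by ring⟩

theorem IsUniformizer.of_ramIndex_eq_one (h : K ≤ L) [FiniteDimensional F L] {w : Fs}
    (hw : IsUniformizer K w) (he : ramIndex h = 1) : IsUniformizer L w := by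
  obtain ⟨y, hy⟩ := exists_isUniformizer L
  refine hy.of_absVal_eq (h hw.mem) ?_
  rw [hw.absVal_eq_pow_ramIndex h hy, he, pow_one]

/-- The case of an unramified quadratic extension `M/K` of the compatibility of norms from
`K(√w)` and `M(√w)`, for a uniformizer `w` of `K`. -/
theorem IsQuad.isForm_of_isForm_relNorm {M : IntermediateField F Fs} {τ : Fs ≃ₐ[F] Fs}
    (hq : IsQuad K M τ) (h2 : absVal F Fs 2 = 1) [FiniteDimensional F M]
    (he : ramIndex hq.le = 1) {w y : Fs} (hw : IsUniformizer K w) (hy : y ∈ M) (hy0 : y ≠ 0)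
    (hN : IsForm K w (y * τ y)) : IsForm M w y := by
  have := finiteDimensional_of_le hq.le
  have hwM := hw.of_ramIndex_eq_one hq.le he
  have hw0 := hw.ne_zero
  obtain ⟨k, hk⟩ := hwM.exists_zpow hy hy0
  have hkM : (-w) ^ k ∈ K := zpow_mem (K.neg_mem hw.mem) k
  have hk0 : (-w) ^ k ≠ 0 := zpow_ne_zero _ (neg_ne_zero.2 hw0)
  -- `-w` is a norm from `M(√w)`, so `y` may be replaced by a unit `v`
  set v := y / (-w) ^ k with hv
  have hvM : v ∈ M := M.div_mem hy (hq.le hkM)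
  have hv1 : absVal F Fs v = 1 := by
    rw [hv, map_div₀, map_zpow₀, Valuation.map_neg, hk,
      div_self (zpow_ne_zero _ hwM.val_pos.ne')]
  have hvy : y = v * (-w) ^ k := (div_mul_cancel₀ y hk0).symm
  have hNv1 : absVal F Fs (v * τ v) = 1 := by rw [map_mul, absVal_gal, hv1, one_mul]
  have hNv : IsForm K w (v * τ v) := by
    have h3 := hN.sq_mul (K.inv_mem hkM)
    have h4 : ((-w) ^ k)⁻¹ ^ 2 * (y * τ y) = v * τ v := by
      rw [hv, map_div₀, hq.apply_eq hkM]
      field_simp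
    rwa [h4] at h3
  have hvsq : IsSqIn M v := by
    rw [← hq.isSqIn_mul_apply_iff h2 he hvM hv1]
    obtain ⟨a, ha, b, hb, hab⟩ := hNv
    have h3 := hw.isSqIn_form h2 ha hb
    rw [← hab] at h3
    exact h3.resolve_right
      (hw.not_isSqIn_mul K.one_mem one_ne_zero (by rw [hNv1, map_one, one_pow]))
  obtain ⟨r, hr, hvr⟩ := hvsq
  rw [hvy, hvr]
  have hwm (m : ℤ) : (-w) ^ m ∈ M := zpow_mem (M.neg_mem hwM.mem) m
  rcases Int.even_or_odd' k with ⟨m, rfl | rfl⟩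
  · refine ⟨r * (-w) ^ m, M.mul_mem hr (hwm m), 0, M.zero_mem, ?_⟩
    rw [two_mul, zpow_add₀ (neg_ne_zero.2 hw0)]
    ring
  · refine ⟨0, M.zero_mem, r * (-w) ^ m, M.mul_mem hr (hwm m), ?_⟩
    rw [zpow_add_one₀ (neg_ne_zero.2 hw0), two_mul, zpow_add₀ (neg_ne_zero.2 hw0)]
    ring

/-- Let `w` be a uniformizer of `K` such that `L(√w)/L` is a quadratic unramified extension. If
the norm `N_{L/K}(x)` is a norm from `K(√w)`, then `x` is a norm from `L(√w)`, that is, has even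
valuation. If the residue degree is odd, then `L` contains `K(√(cw))` for a non-square unit `c` of
`K`, and a norm from both `K(√w)` and `K(√(cw))` has even valuation. -/
theorem exists_sq_of_isForm_relNorm (h2 : absVal F Fs 2 = 1) (h : K ≤ L) [FiniteDimensional F L]
    {w : Fs} (hw : IsUniformizer K w) (hwn : ¬ IsSqIn L w)
    (hwe : ∃ z ∈ L, absVal F Fs w = absVal F Fs z ^ 2) {x : L} (hx : x ≠ 0)
    (hN : IsForm K w (relNorm h x : Fs)) :
    ∃ z ∈ L, absVal F Fs (x : Fs) = absVal F Fs z ^ 2 := by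
  induction hn : relDegree h using Nat.strong_induction_on generalizing K with
  | _ n ih =>
  by_cases H : ∀ c ∈ K, absVal F Fs c = 1 → IsSqIn L c
  · obtain ⟨M, τ, hq, hML, he⟩ := exists_unramified_quad_le h2 h H
    have := finiteDimensional_of_le hML
    have hlt : relDegree hML < n := by
      have h1 := relDegree_mul hq.le hML
      have h3 := relDegree_pos hML
      rw [hq.relDegree_eq h2, hn] at h1
      omega
    refine ih _ hlt hML (hw.of_ramIndex_eq_one hq.le he) ?_ rfl
    have hy0 : (relNorm hML x : Fs) ≠ 0 := fun h0 => relNorm_ne_zero hML hx (Subtype.ext h0)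
    refine hq.isForm_of_isForm_relNorm h2 he hw (relNorm hML x).2 hy0 ?_
    rwa [← hq.coe_relNorm h2, relNorm_trans]
  · push Not at H
    obtain ⟨c, hc, hc1, hcn⟩ := H
    have hc0 := ne_zero_of_absVal_eq_one hc1
    have hf : Odd (resDegree h) := (odd_resDegree_or h2 h).resolve_right fun H => hcn (H c hc hc1)
    apply exists_sq_of_relNorm h hf hx
    obtain ⟨z, hz, hwz⟩ := hwe
    have hz0 : z ≠ 0 := by
      rintro rfl
      rw [map_zero, zero_pow two_ne_zero] at hwz
      exact hw.val_pos.ne' hwz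
    have hwz1 : absVal F Fs (w / z ^ 2) = 1 := by
      rw [map_div₀, map_pow, hwz, div_self (pow_ne_zero 2 (absVal_ne_zero hz0))]
    have hwzn : ¬ IsSqIn L (w / z ^ 2) := by
      intro h'
      apply hwn
      have := h'.mul (⟨z, hz, rfl⟩ : IsSqIn L (z ^ 2))
      rwa [div_mul_cancel₀ _ (pow_ne_zero 2 hz0)] at this
    -- `w` and `c` are in the same square class of `L`
    obtain ⟨t, ht, htw⟩ : IsSqIn L (c * w) := by
      have h3 := isSqIn_mul_of_not h2 (h hc) (L.div_mem (h hw.mem) (pow_mem hz 2)) hc1 hwz1 hcn hwzn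
      have := h3.mul (⟨z, hz, rfl⟩ : IsSqIn L (z ^ 2))
      rwa [mul_assoc, div_mul_cancel₀ _ (pow_ne_zero 2 hz0)] at this
    have hcw : IsUniformizer K (c * w) := hw.of_absVal_eq (K.mul_mem hc hw.mem)
      (by rw [map_mul, hc1, one_mul])
    have htK : t ∉ K := by
      intro htK
      refine hcw.sq_ne htK K.one_mem one_ne_zero ?_
      rw [htw, map_pow, map_one, one_pow, mul_one]
    obtain ⟨M, τ, hq, ha, hM⟩ := exists_isQuad_of_sq_mem h2 (htw ▸ hcw.mem) htK
    have hML := hM L h ht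
    have := finiteDimensional_of_le hML
    obtain ⟨a, haK, b, hb, hab⟩ := ha.exists_eq_add hq h2 (relNorm hML x).2
    have hNM : (relNorm h x : Fs) = a ^ 2 - c * w * b ^ 2 := by
      rw [← relNorm_trans hq.le hML, hq.coe_relNorm h2, hab, ha.mul_apply_eq hq haK hb, htw]
    obtain ⟨a', ha', b', hb', hab'⟩ := hN
    have hN0 : (relNorm h x : Fs) ≠ 0 := fun h0 => relNorm_ne_zero h hx (Subtype.ext h0)
    -- up to squares, `N_{L/K}(x)` is `1` or `-w`, and also `1` or `-cw`
    have h3 := hw.isSqIn_form h2 ha' hb'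
    rw [← hab'] at h3
    have h4 := hcw.isSqIn_form h2 haK hb
    rw [← hNM] at h4
    have hsq (h' : IsSqIn K (relNorm h x : Fs)) :
        ∃ z ∈ K, absVal F Fs (relNorm h x : Fs) = absVal F Fs z ^ 2 := by
      obtain ⟨z, hz, h'⟩ := h'
      exact ⟨z, hz, by rw [h', map_pow]⟩
    rcases h3 with h3 | h3
    · exact hsq h3
    rcases h4 with h4 | h4
    · exact hsq h4
    exfalso
    refine hcn (IsSqIn.mono h (IsSqIn.of_mul_left h3 ?_ (x := c) ?_))
    · exact neg_ne_zero.2 (mul_ne_zero hN0 hw.ne_zero)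
    · convert h4 using 1
      ring

end NormClasses

/-! ### The fields attached to a `Σ`-set -/

section SigmaFields

variable {F Fs : Type*} [Field F] [Field Fs] [Algebra F Fs]
  {R : Type*} [MulAction (Sig F Fs) R] {R' : Type*} [MulAction (Sig F Fs) R']

theorem gal_mul (σ τ : Fs ≃ₐ[F] Fs) (α : R) : gal (σ * τ) α = gal σ (gal τ α) := by
  simp only [gal, smul_smul, Prod.mk_mul_mk, one_mul]

theorem gal_one (α : R) : gal (1 : Fs ≃ₐ[F] Fs) α = α := one_smul _ α

theorem gal_neg (σ : Fs ≃ₐ[F] Fs) (α : R) : gal σ (neg F Fs α) = neg F Fs (gal σ α) := by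
  simp only [gal, neg, smul_smul, Prod.mk_mul_mk, one_mul, mul_one]

theorem neg_neg_eq (α : R) : neg F Fs (neg F Fs α) = α := by
  rw [neg, neg, smul_smul, Prod.mk_mul_mk, one_mul, neg_one_mul, neg_neg]
  exact one_smul _ α

theorem map_gal (f : R →[Sig F Fs] R') (σ : Fs ≃ₐ[F] Fs) (α : R) :
    f (gal σ α) = gal σ (f α) := map_smul f _ α

theorem map_neg_eq (f : R →[Sig F Fs] R') (α : R) : f (neg F Fs α) = neg F Fs (f α) :=
  map_smul f _ α

theorem neg_injective : Function.Injective (neg F Fs : R → R) :=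
  MulAction.injective ((1, -1) : Sig F Fs)

open scoped Pointwise in
theorem mem_stabPM {α : R} {σ : Fs ≃ₐ[F] Fs} :
    σ ∈ stabPM F Fs α ↔ gal σ α = α ∨ gal σ α = neg F Fs α := by
  change ((σ, 1) : Sig F Fs) • ({α, neg F Fs α} : Set R) = {α, neg F Fs α} ↔ _
  rw [← Set.image_smul, Set.image_pair]
  change ({gal σ α, gal σ (neg F Fs α)} : Set R) = _ ↔ _
  rw [gal_neg]
  constructor
  · intro h
    have h1 : gal σ α ∈ ({α, neg F Fs α} : Set R) := h ▸ Set.mem_insert _ _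
    simpa using h1
  · rintro (h | h)
    · rw [h]
    · rw [h, neg_neg_eq, Set.pair_comm]

theorem stabPM_le_map (f : R →[Sig F Fs] R') (α : R) : stabPM F Fs α ≤ stabPM F Fs (f α) := by
  intro σ hσ
  rw [mem_stabPM] at hσ ⊢
  rw [← map_gal, ← map_neg_eq]
  exact hσ.imp (congrArg f) (congrArg f)

theorem fldPM_map_le (f : R →[Sig F Fs] R') (α : R) : fldPM F Fs (f α) ≤ fldPM F Fs α := by
  intro x hx σ
  exact hx ⟨σ.1, stabPM_le_map f α σ.2⟩

theorem mem_fld {α : R} {x : Fs} :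
    x ∈ fld F Fs α ↔ ∀ σ : Fs ≃ₐ[F] Fs, gal σ α = α → σ x = x :=
  ⟨fun h σ hσ => h ⟨σ, hσ⟩, fun h σ => h σ.1 σ.2⟩

theorem mem_fldPM {α : R} {x : Fs} :
    x ∈ fldPM F Fs α ↔
      ∀ σ : Fs ≃ₐ[F] Fs, (gal σ α = α ∨ gal σ α = neg F Fs α) → σ x = x :=
  ⟨fun h σ hσ => h ⟨σ, mem_stabPM.2 hσ⟩, fun h σ => h σ.1 (mem_stabPM.1 σ.2)⟩

theorem gal_symm_gal (σ : Fs ≃ₐ[F] Fs) (α : R) : gal σ.symm (gal σ α) = α := by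
  rw [← gal_mul]
  exact (congrArg (gal · α) (inv_mul_cancel σ)).trans (gal_one α)

theorem map_fld (σ : Fs ≃ₐ[F] Fs) (α : R) :
    (fld F Fs α).map (σ : Fs →ₐ[F] Fs) = fld F Fs (gal σ α) := by
  ext x
  rw [IntermediateField.mem_map]
  constructor
  · rintro ⟨y, hy, rfl⟩
    rw [mem_fld] at hy ⊢
    intro τ hτ
    have h := hy (σ.symm * τ * σ) (by rw [gal_mul, gal_mul, hτ, gal_symm_gal])
    exact (σ.symm_apply_eq.1 h)
  · intro hx
    rw [mem_fld] at hx
    refine ⟨σ.symm x, mem_fld.2 fun τ hτ => ?_, σ.apply_symm_apply x⟩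
    have h := hx (σ * τ * σ.symm) (by rw [gal_mul, gal_mul, gal_symm_gal, hτ])
    exact (σ.symm_apply_eq.2 h.symm).symm

theorem map_fldPM (σ : Fs ≃ₐ[F] Fs) (α : R) :
    (fldPM F Fs α).map (σ : Fs →ₐ[F] Fs) = fldPM F Fs (gal σ α) := by
  ext x
  rw [IntermediateField.mem_map]
  constructor
  · rintro ⟨y, hy, rfl⟩
    rw [mem_fldPM] at hy ⊢
    intro τ hτ
    have h := hy (σ.symm * τ * σ) (by
      rw [gal_mul, gal_mul]
      rcases hτ with hτ | hτ
      · exact Or.inl (by rw [hτ, gal_symm_gal])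
      · exact Or.inr (by rw [hτ, gal_neg, gal_symm_gal]))
    exact (σ.symm_apply_eq.1 h)
  · intro hx
    rw [mem_fldPM] at hx
    refine ⟨σ.symm x, mem_fldPM.2 fun τ hτ => ?_, σ.apply_symm_apply x⟩
    have h := hx (σ * τ * σ.symm) (by
      rw [gal_mul, gal_mul, gal_symm_gal]
      rcases hτ with hτ | hτ
      · exact Or.inl (by rw [hτ])
      · exact Or.inr (by rw [hτ, gal_neg]))
    exact (σ.symm_apply_eq.2 h.symm).symm

theorem fld_neg (α : R) : fld F Fs (neg F Fs α) = fld F Fs α := by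
  ext x
  rw [mem_fld, mem_fld]
  refine forall_congr' fun σ => ?_
  rw [gal_neg, neg_injective.eq_iff]

theorem fldPM_neg (α : R) : fldPM F Fs (neg F Fs α) = fldPM F Fs α := by
  ext x
  rw [mem_fldPM, mem_fldPM]
  refine forall_congr' fun σ => ?_
  rw [gal_neg, neg_injective.eq_iff, neg_injective.eq_iff]

theorem isSym_gal_iff (σ : Fs ≃ₐ[F] Fs) (α : R) : IsSym F Fs (gal σ α) ↔ IsSym F Fs α := by
  constructor
  · rintro ⟨τ, hτ⟩
    refine ⟨σ.symm * τ * σ, ?_⟩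
    rw [gal_mul, gal_mul, hτ, gal_neg, gal_symm_gal]
  · rintro ⟨τ, hτ⟩
    refine ⟨σ * τ * σ.symm, ?_⟩
    rw [gal_mul, gal_mul, gal_symm_gal, hτ, gal_neg]

theorem isSym_neg_iff (α : R) : IsSym F Fs (neg F Fs α) ↔ IsSym F Fs α := by
  refine exists_congr fun τ => ?_
  rw [gal_neg, neg_injective.eq_iff]

section Galois

variable [IsSepClosure F Fs]

theorem fixingSubgroup_fixedField_of_isOpen {H : Subgroup (Fs ≃ₐ[F] Fs)}
    (hH : IsOpen (H : Set (Fs ≃ₐ[F] Fs))) :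
    (IntermediateField.fixedField H).fixingSubgroup = H := by
  have : IsGalois F Fs := IsSepClosure.isGalois
  exact InfiniteGalois.fixingSubgroup_fixedField ⟨H, Subgroup.isClosed_of_isOpen H hH⟩

theorem finiteDimensional_fixedField_of_isOpen {H : Subgroup (Fs ≃ₐ[F] Fs)}
    (hH : IsOpen (H : Set (Fs ≃ₐ[F] Fs))) :
    FiniteDimensional F (IntermediateField.fixedField H) := by
  have : IsGalois F Fs := IsSepClosure.isGalois
  rw [← InfiniteGalois.isOpen_iff_finite, fixingSubgroup_fixedField_of_isOpen hH]
  exact hH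

theorem finiteDimensional_fld (hRc : IsContinuousAction F Fs R) (α : R) :
    FiniteDimensional F (fld F Fs α) := finiteDimensional_fixedField_of_isOpen (hRc α)

theorem gal_eq_of_forall_mem_fld (hRc : IsContinuousAction F Fs R) {α : R} {σ : Fs ≃ₐ[F] Fs}
    (h : ∀ x ∈ fld F Fs α, σ x = x) : gal σ α = α := by
  have h1 : σ ∈ (fld F Fs α).fixingSubgroup := (IntermediateField.mem_fixingSubgroup_iff _ _).2 h
  rw [fld, fixingSubgroup_fixedField_of_isOpen (hRc α)] at h1
  exact h1

variable [ValuativeRel F] [TopologicalSpace F] [IsNonarchimedeanLocalField F]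

/-- For symmetric `α`, the extension `F_α/F_{±α}` is quadratic, with non-trivial automorphism
`τ_α`. -/
theorem isQuad_of_gal_eq_neg (hR : IsAdmissible F Fs R) (hRc : IsContinuousAction F Fs R) {α : R}
    {τ : Fs ≃ₐ[F] Fs} (hτ : gal τ α = neg F Fs α) : IsQuad (fldPM F Fs α) (fld F Fs α) τ where
  le := fldPM_le_fld F Fs α
  fixed_iff x hx := by
    rw [mem_fldPM]
    rw [mem_fld] at hx
    refine ⟨fun h σ hσ => ?_, fun h => h τ (Or.inr hτ)⟩
    rcases hσ with hσ | hσ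
    · exact hx σ hσ
    · have h1 := hx (τ.symm * σ) (by rw [gal_mul, hσ, ← hτ, gal_symm_gal])
      exact (τ.symm_apply_eq.1 h1).trans h
  map_mem x hx := by
    have h : τ x ∈ (fld F Fs α).map (τ : Fs →ₐ[F] Fs) := ⟨x, hx, rfl⟩
    rwa [map_fld, hτ, fld_neg] at h
  involutive x hx := by
    refine mem_fld.1 hx (τ * τ) ?_
    rw [gal_mul, hτ, gal_neg, hτ, neg_neg_eq]
  exists_ne := by
    by_contra! H
    exact hR α (hτ.symm.trans (gal_eq_of_forall_mem_fld hRc H))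

theorem isSymUnram_gal_iff (hRc : IsContinuousAction F Fs R) (σ : Fs ≃ₐ[F] Fs) (α : R) :
    IsSymUnram F Fs (gal σ α) ↔ IsSymUnram F Fs α := by
  have := finiteDimensional_fld hRc α
  have := finiteDimensional_fld hRc (gal σ α)
  refine and_congr (isSym_gal_iff σ α) ?_
  rw [ramIndex_eq_one_iff, ramIndex_eq_one_iff, ← map_fld, ← map_fldPM]
  constructor
  · intro h x hx hx0
    obtain ⟨_, ⟨y, hy, rfl⟩, hxy⟩ := h (σ x) ⟨x, hx, rfl⟩ (by simpa using hx0)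
    exact ⟨y, hy, (absVal_gal σ x).symm.trans (hxy.trans (absVal_gal σ y))⟩
  · rintro h _ ⟨x, hx, rfl⟩ hx0
    obtain ⟨y, hy, hxy⟩ := h x hx (by
      rintro rfl
      exact hx0 (map_zero _))
    exact ⟨σ y, ⟨y, hy, rfl⟩, (absVal_gal σ x).trans (hxy.trans (absVal_gal σ y).symm)⟩

theorem isSymUnram_neg_iff (hRc : IsContinuousAction F Fs R) (α : R) :
    IsSymUnram F Fs (neg F Fs α) ↔ IsSymUnram F Fs α := by
  have := finiteDimensional_fld hRc α
  have := finiteDimensional_fld hRc (neg F Fs α)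
  refine and_congr (isSym_neg_iff α) ?_
  rw [ramIndex_eq_one_iff, ramIndex_eq_one_iff, fld_neg, fldPM_neg]

end Galois

end SigmaFields

section NormCompat

variable {F Fs : Type*} [Field F] [ValuativeRel F] [TopologicalSpace F]
  [IsNonarchimedeanLocalField F] [Field Fs] [Algebra F Fs] [IsSepClosure F Fs]

/-- Let `E/K` and `M/L` be quadratic extensions, with `K ≤ L` and `M = LE`. Then `N_{M/E}` and
`N_{L/K}` agree on `L`. -/
theorem relNorm_eq_of_isQuad (h2 : absVal F Fs 2 = 1) {K E L M : IntermediateField F Fs}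
    {τ : Fs ≃ₐ[F] Fs} (hE : IsQuad K E τ) (hM : IsQuad L M τ) (hKL : K ≤ L) (hEM : E ≤ M)
    [FiniteDimensional F M] (x : L) :
    (relNorm hEM (IntermediateField.inclusion hM.le x) : Fs) = relNorm hKL x := by
  have := finiteDimensional_of_le hM.le
  letI := inclAlgebra hE.le
  letI := inclAlgebra hM.le
  letI := inclAlgebra hKL
  letI := inclAlgebra hEM
  letI := inclAlgebra (hKL.trans hM.le)
  have : IsScalarTower K L M := IsScalarTower.of_algebraMap_eq fun _ => rfl
  have : IsScalarTower K E M := IsScalarTower.of_algebraMap_eq fun _ => rfl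
  have hfin := finiteDimensional_incl hKL
  have hfin' := finiteDimensional_incl hEM
  obtain ⟨s, hs⟩ := hE.exists_isAnti
  have hsM : IsAnti M τ s := ⟨hEM hs.mem, hs.ne_zero, hs.map_eq⟩
  let b := Module.finBasis K L
  have hdeg : relDegree hEM = relDegree hKL := by
    have h1 := relDegree_mul hE.le hEM
    have h3 := relDegree_mul hKL hM.le
    rw [hE.relDegree_eq h2] at h1
    rw [hM.relDegree_eq h2] at h3
    omega
  have hL (a : L) : algebraMap L M a ∈
      Submodule.span E (Set.range fun i => algebraMap L M (b i)) := by
    rw [← b.sum_repr a, map_sum]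
    refine Submodule.sum_mem _ fun i _ => ?_
    have h3 : algebraMap L M (b.repr a i • b i) =
        algebraMap K E (b.repr a i) • algebraMap L M (b i) := by
      rw [Algebra.smul_def, Algebra.smul_def, map_mul]
      rfl
    rw [h3]
    exact Submodule.smul_mem _ _ (Submodule.subset_span ⟨i, rfl⟩)
  have hsp : ⊤ ≤ Submodule.span E (Set.range fun i => algebraMap L M (b i)) := by
    rintro ⟨x, hx⟩ -
    obtain ⟨a, ha, c, hc, rfl⟩ := hsM.exists_eq_add hM h2 hx
    have h3 : (⟨a + c * s, hx⟩ : M) =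
        algebraMap L M ⟨a, ha⟩ + (⟨s, hs.mem⟩ : E) • algebraMap L M ⟨c, hc⟩ :=
      Subtype.ext (by
        change a + c * s = a + s * c
        ring)
    rw [h3]
    exact Submodule.add_mem _ (hL _) (Submodule.smul_mem _ _ (hL _))
  let b' := basisOfTopLeSpanOfCardEqFinrank _ hsp (by rw [Fintype.card_fin]; exact hdeg.symm)
  have h3 := norm_eq_of_basis b b' (fun i => by simp [b']) x
  exact congrArg Subtype.val h3

end NormCompat

/-! ### Quadratic characters -/

section Characters

variable {F Fs : Type*} [Field F] [ValuativeRel F] [TopologicalSpace F]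
  [IsNonarchimedeanLocalField F] [Field Fs] [Algebra F Fs] [IsSepClosure F Fs]

variable {K L : IntermediateField F Fs}

/-- The absolute value of `x` is the square of the absolute value of an element of `L`; for non-zero
`x ∈ L` this says that `x` has even valuation. -/
def IsEvenIn (L : IntermediateField F Fs) (x : Fs) : Prop :=
  ∃ z ∈ L, absVal F Fs x = absVal F Fs z ^ 2

theorem isEvenIn_of_absVal_eq_one {x : Fs} (h : absVal F Fs x = 1) : IsEvenIn L x :=
  ⟨1, L.one_mem, by rw [h, map_one, one_pow]⟩

theorem IsUniformizer.isEvenIn_iff {w : Fs} (hw : IsUniformizer L w) {x : Fs} (hx0 : x ≠ 0)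
    {k : ℤ} (hk : absVal F Fs x = absVal F Fs w ^ k) : IsEvenIn L x ↔ Even k := by
  constructor
  · rintro ⟨z, hz, h⟩
    have hz0 : z ≠ 0 := by
      rintro rfl
      rw [map_zero, zero_pow two_ne_zero] at h
      exact absVal_ne_zero hx0 h
    obtain ⟨j, hj⟩ := hw.exists_zpow hz hz0
    rw [hk, hj, ← zpow_natCast, ← zpow_mul] at h
    rw [hw.zpow_inj h]
    exact Even.mul_left even_two j
  · rintro ⟨m, rfl⟩
    exact ⟨w ^ m, zpow_mem hw.mem m, by rw [hk, map_zpow₀, zpow_add₀ hw.val_pos.ne', sq]⟩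

theorem isEvenIn_mul_iff [FiniteDimensional F L] {x y : Fs} (hx : x ∈ L) (hy : y ∈ L)
    (hx0 : x ≠ 0) (hy0 : y ≠ 0) : IsEvenIn L (x * y) ↔ (IsEvenIn L x ↔ IsEvenIn L y) := by
  obtain ⟨w, hw⟩ := exists_isUniformizer L
  obtain ⟨i, hi⟩ := hw.exists_zpow hx hx0
  obtain ⟨j, hj⟩ := hw.exists_zpow hy hy0
  have hij : absVal F Fs (x * y) = absVal F Fs w ^ (i + j) := by
    rw [map_mul, hi, hj, zpow_add₀ hw.val_pos.ne']
  rw [hw.isEvenIn_iff hx0 hi, hw.isEvenIn_iff hy0 hj, hw.isEvenIn_iff (mul_ne_zero hx0 hy0) hij]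
  exact Int.even_add

theorem isEvenIn_gal_iff (σ : Fs ≃ₐ[F] Fs) {x : Fs} :
    IsEvenIn (L.map (σ : Fs →ₐ[F] Fs)) (σ x) ↔ IsEvenIn L x := by
  constructor
  · rintro ⟨_, ⟨z, hz, rfl⟩, h⟩
    exact ⟨z, hz, (absVal_gal σ x).symm.trans (h.trans (congrArg (· ^ 2) (absVal_gal σ z)))⟩
  · rintro ⟨z, hz, h⟩
    exact ⟨σ z, ⟨z, hz, rfl⟩, (absVal_gal σ x).trans
      (h.trans (congrArg (· ^ 2) (absVal_gal σ z).symm))⟩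

theorem isEvenIn_iff_of_ramIndex (h : K ≤ L) [FiniteDimensional F L] (he : ramIndex h = 1)
    {x : Fs} : IsEvenIn L x ↔ IsEvenIn K x := by
  constructor
  · rintro ⟨z, hz, hxz⟩
    by_cases hz0 : z = 0
    · exact ⟨0, K.zero_mem, hz0 ▸ hxz⟩
    obtain ⟨y, hy, hzy⟩ := (ramIndex_eq_one_iff h).1 he z hz hz0
    exact ⟨y, hy, hzy ▸ hxz⟩
  · rintro ⟨z, hz, hxz⟩
    exact ⟨z, h hz, hxz⟩

theorem coe_units_ne_zero (x : Lˣ) : ((x : L) : Fs) ≠ 0 := fun h => x.ne_zero (Subtype.ext h)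

open scoped Classical in
/-- The unramified quadratic character of `Lˣ`, which is `1` on elements of even valuation and
`-1` on elements of odd valuation. -/
def parityChar (L : IntermediateField F Fs) [FiniteDimensional F L] : Lˣ →* ℂˣ where
  toFun x := if IsEvenIn L (x : L) then 1 else -1
  map_one' := if_pos (isEvenIn_of_absVal_eq_one (map_one _))
  map_mul' x y := by
    have h := isEvenIn_mul_iff (x : L).2 (y : L).2 (coe_units_ne_zero x) (coe_units_ne_zero y)
    have h' : (((x * y : Lˣ) : L) : Fs) = ((x : L) : Fs) * ((y : L) : Fs) := rfl
    rw [h']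
    by_cases hx : IsEvenIn L (x : L) <;> by_cases hy : IsEvenIn L (y : L) <;>
      simp [h, hx, hy]

open scoped Classical in
theorem parityChar_apply [FiniteDimensional F L] (x : Lˣ) :
    parityChar L x = if IsEvenIn L (x : L) then 1 else -1 := rfl

theorem isContinuousChar_of_forall_sub_one_lt {χ : Lˣ →* ℂˣ}
    (h : ∀ x : Lˣ, absVal F Fs ((x : L) - 1 : Fs) < 1 → χ x = 1) : IsContinuousChar χ := by
  letI := Valued.mk' (integers L).valuation
  change Continuous χ
  refine continuous_of_continuousAt_one χ ?_
  have hU : {y : L | (integers L).valuation (y - 1) < 1} ∈ nhds (1 : L) := by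
    rw [Valued.mem_nhds]
    refine ⟨1, fun y hy => ?_⟩
    have hy' : Valued.v (y - 1) < 1 := by simpa using hy
    exact hy'
  have hev : ∀ᶠ x : Lˣ in nhds 1, χ x = 1 := by
    have hc : Filter.Tendsto (fun x : Lˣ => (x : L)) (nhds 1) (nhds 1) :=
      Units.continuous_val.tendsto 1
    filter_upwards [hc hU] with x hx
    exact h x (mem_principalUnitGroup_iff_absVal.1 hx)
  rw [ContinuousAt, map_one]
  exact tendsto_const_nhds.congr' (hev.mono fun x hx => hx.symm)

theorem mem_range_unitsNorm_iff {τ : Fs ≃ₐ[F] Fs} (hq : IsQuad K L τ) (h2 : absVal F Fs 2 = 1)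
    (x : Kˣ) : x ∈ (unitsNorm hq.le).range ↔ ∃ y ∈ L, y * τ y = ((x : K) : Fs) := by
  constructor
  · rintro ⟨y, rfl⟩
    exact ⟨(y : L), (y : L).2, by rw [coe_unitsNorm, hq.coe_relNorm h2]⟩
  · rintro ⟨y, hy, hxy⟩
    have hy0 : (⟨y, hy⟩ : L) ≠ 0 := by
      intro h0
      have h0' : y = 0 := congrArg Subtype.val h0
      rw [h0', zero_mul] at hxy
      exact coe_units_ne_zero x hxy.symm
    refine ⟨Units.mk0 ⟨y, hy⟩ hy0, Units.ext (Subtype.ext ?_)⟩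
    rw [coe_unitsNorm, hq.coe_relNorm h2]
    exact hxy

end Characters

section Values

variable {F Fs : Type*} [Field F] [ValuativeRel F] [TopologicalSpace F]
  [IsNonarchimedeanLocalField F] [Field Fs] [Algebra F Fs] [IsSepClosure F Fs]
  {R : Type*} [MulAction (Sig F Fs) R] {R' : Type*} [MulAction (Sig F Fs) R']

open scoped Classical in
theorem kappa_eq (h2 : absVal F Fs 2 = 1) (hR : IsAdmissible F Fs R)
    (hRc : IsContinuousAction F Fs R) {α : R} {τ : Fs ≃ₐ[F] Fs} (hτ : gal τ α = neg F Fs α)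
    (x : (fldPM F Fs α)ˣ) : kappa F Fs α x =
      if ∃ y ∈ fld F Fs α, y * τ y = ((x : fldPM F Fs α) : Fs) then 1 else -1 := by
  rw [kappa]
  exact if_congr (mem_range_unitsNorm_iff (isQuad_of_gal_eq_neg hR hRc hτ) h2 x) rfl rfl

open scoped Classical in
theorem kappa_eq_of_unramified (h2 : absVal F Fs 2 = 1) (hR : IsAdmissible F Fs R)
    (hRc : IsContinuousAction F Fs R) {α : R} (hα : IsSymUnram F Fs α) (x : (fldPM F Fs α)ˣ) :
    kappa F Fs α x = if IsEvenIn (fldPM F Fs α) (x : fldPM F Fs α) then 1 else -1 := by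
  have := finiteDimensional_fld hRc α
  obtain ⟨⟨τ, hτ⟩, he⟩ := hα
  rw [kappa_eq h2 hR hRc hτ]
  exact if_congr ((isQuad_of_gal_eq_neg hR hRc hτ).exists_mul_apply_eq_iff h2 he
    (x : fldPM F Fs α).2 (coe_units_ne_zero x)) rfl rfl

theorem unramExtension_spec (h2 : absVal F Fs 2 = 1) (hR : IsAdmissible F Fs R)
    (hRc : IsContinuousAction F Fs R) {α : R} (hα : IsSymUnram F Fs α) :
    IsUnramifiedChar (unramExtension F Fs α) ∧ ∀ x : (fldPM F Fs α)ˣ,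
      unramExtension F Fs α (unitsIncl (fldPM_le_fld F Fs α) x) = kappa F Fs α x := by
  classical
  have := finiteDimensional_fld hRc α
  refine Classical.epsilon_spec (p := fun ψ => IsUnramifiedChar ψ ∧ ∀ x : (fldPM F Fs α)ˣ,
    ψ (unitsIncl (fldPM_le_fld F Fs α) x) = kappa F Fs α x) ⟨parityChar (fld F Fs α), ?_, ?_⟩
  · intro x hx
    rw [MonoidHom.mem_ker, parityChar_apply,
      if_pos (isEvenIn_of_absVal_eq_one (mem_unitGroup_iff_absVal.1 hx))]
  · intro x
    rw [kappa_eq_of_unramified h2 hR hRc hα, parityChar_apply]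
    exact if_congr (isEvenIn_iff_of_ramIndex (fldPM_le_fld F Fs α) hα.2) rfl rfl

/-- In the unramified case, `F_αˣ` is generated by `F_{±α}ˣ` and the units. -/
theorem exists_unitsIncl_mul (hRc : IsContinuousAction F Fs R) {α : R} (hα : IsSymUnram F Fs α)
    (x : (fld F Fs α)ˣ) : ∃ (c : (fldPM F Fs α)ˣ) (u : (fld F Fs α)ˣ),
      absVal F Fs (u : fld F Fs α) = 1 ∧ x = unitsIncl (fldPM_le_fld F Fs α) c * u := by
  have := finiteDimensional_fld hRc α
  obtain ⟨y, hy, hxy⟩ := (ramIndex_eq_one_iff (fldPM_le_fld F Fs α)).1 hα.2 _ (x : fld F Fs α).2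
    (coe_units_ne_zero x)
  have hy0 : (⟨y, hy⟩ : fldPM F Fs α) ≠ 0 := by
    intro h0
    have h0' : y = 0 := congrArg Subtype.val h0
    rw [h0', map_zero] at hxy
    exact absVal_ne_zero (coe_units_ne_zero x) hxy
  refine ⟨Units.mk0 ⟨y, hy⟩ hy0, (unitsIncl (fldPM_le_fld F Fs α) (Units.mk0 ⟨y, hy⟩ hy0))⁻¹ * x,
    ?_, (mul_inv_cancel_left _ _).symm⟩
  have h : ((((unitsIncl (fldPM_le_fld F Fs α) (Units.mk0 ⟨y, hy⟩ hy0))⁻¹ * x : (fld F Fs α)ˣ) :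
      fld F Fs α) : Fs) = y⁻¹ * (x : fld F Fs α) := by
    rw [Units.val_mul, Units.val_inv_eq_inv_val]
    rfl
  rw [h, map_mul, map_inv₀, hxy, inv_mul_cancel₀]
  rw [← hxy]
  exact absVal_ne_zero (coe_units_ne_zero x)

open scoped Classical in
theorem unramExtension_apply (h2 : absVal F Fs 2 = 1) (hR : IsAdmissible F Fs R)
    (hRc : IsContinuousAction F Fs R) {α : R} (hα : IsSymUnram F Fs α) (x : (fld F Fs α)ˣ) :
    unramExtension F Fs α x = if IsEvenIn (fld F Fs α) (x : fld F Fs α) then 1 else -1 := by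
  have := finiteDimensional_fld hRc α
  obtain ⟨h1, h3⟩ := unramExtension_spec h2 hR hRc hα
  obtain ⟨c, u, hu, rfl⟩ := exists_unitsIncl_mul hRc hα x
  have h4 : unramExtension F Fs α u = 1 := h1 (mem_unitGroup_iff_absVal.2 hu)
  rw [map_mul, h3, h4, mul_one, kappa_eq_of_unramified h2 hR hRc hα,
    ← parityChar_apply (L := fld F Fs α) (unitsIncl _ c * u), map_mul, parityChar_apply u,
    if_pos (isEvenIn_of_absVal_eq_one hu), mul_one, parityChar_apply]
  exact if_congr (isEvenIn_iff_of_ramIndex (fldPM_le_fld F Fs α) hα.2).symm rfl rfl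

variable {χ' : CharFamily F Fs R'}

/-- The compatibility `κ_α = κ_{α'} ∘ N_{F_{±α}/F_{±α'}}` for symmetric unramified `α`. If
`F_{α'}/F_{±α'}` is unramified, both sides are determined by the parity of valuations, and
`F_{±α}/F_{±α'}` has odd residue degree. If it is ramified, this is
`exists_sq_of_isForm_relNorm`. (That norms are mapped to norms is clear.) -/
theorem kappa_unitsNorm (h2 : absVal F Fs 2 = 1) (hR : IsAdmissible F Fs R)
    (hRc : IsContinuousAction F Fs R) (hR' : IsAdmissible F Fs R')
    (hRc' : IsContinuousAction F Fs R') (f : R →[Sig F Fs] R') {α : R} (hα : IsSymUnram F Fs α)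
    (x : (fldPM F Fs α)ˣ) :
    kappa F Fs (f α) (unitsNorm (fldPM_map_le f α) x) = kappa F Fs α x := by
  classical
  have := finiteDimensional_fld hRc α
  have := finiteDimensional_fld hRc' (f α)
  have := finiteDimensional_of_le (fldPM_le_fld F Fs α)
  obtain ⟨⟨τ, hτ⟩, he⟩ := hα
  have hτ' : gal τ (f α) = neg F Fs (f α) := by rw [← map_gal, hτ, map_neg_eq]
  have hM := isQuad_of_gal_eq_neg hR hRc hτ
  have hE := isQuad_of_gal_eq_neg hR' hRc' hτ'
  have hEM := fld_map_le f α
  have hx0 : (x : fldPM F Fs α) ≠ 0 := x.ne_zero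
  rw [kappa_eq h2 hR hRc hτ, kappa_eq h2 hR' hRc' hτ']
  refine if_congr ?_ rfl rfl
  have hcoe : ((unitsNorm (fldPM_map_le f α) x : fldPM F Fs (f α)) : Fs) =
    relNorm (fldPM_map_le f α) (x : fldPM F Fs α) := rfl
  rw [hcoe]
  constructor
  · rintro ⟨y, hy, hxy⟩
    rw [hM.exists_mul_apply_eq_iff h2 he (x : fldPM F Fs α).2 (coe_units_ne_zero x)]
    have hN0 : (relNorm (fldPM_map_le f α) (x : fldPM F Fs α) : Fs) ≠ 0 :=
      coe_units_ne_zero (unitsNorm (fldPM_map_le f α) x)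
    rcases hE.exists_isAnti_normalized with ⟨s, hs, hs1⟩ | ⟨s, hs, hw⟩
    · have hsM : IsAnti (fld F Fs α) τ s := ⟨hEM hs.mem, hs.ne_zero, hs.map_eq⟩
      have hf : Odd (resDegree (fldPM_map_le f α)) :=
        (odd_resDegree_or h2 (fldPM_map_le f α)).resolve_right fun H => hsM.not_isSqIn_sq hM h2
          (H _ (hs.sq_mem hE) (by rw [map_pow, hs1, one_pow]))
      refine exists_sq_of_relNorm _ hf hx0 ?_
      rw [← hE.exists_mul_apply_eq_iff h2 (hs.ramIndex_eq_one hE h2 hs1)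
        (relNorm (fldPM_map_le f α) (x : fldPM F Fs α)).2 hN0]
      exact ⟨y, hy, hxy⟩
    · have hsM : IsAnti (fld F Fs α) τ s := ⟨hEM hs.mem, hs.ne_zero, hs.map_eq⟩
      refine exists_sq_of_isForm_relNorm h2 (fldPM_map_le f α) hw (hsM.not_isSqIn_sq hM h2) ?_
        hx0 ?_
      · obtain ⟨z, hz, hsz⟩ := (ramIndex_eq_one_iff _).1 he s hsM.mem hsM.ne_zero
        exact ⟨z, hz, by rw [map_pow, hsz]⟩
      · obtain ⟨a, ha, b, hb, rfl⟩ := hs.exists_eq_add hE h2 hy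
        exact ⟨a, ha, b, hb, by rw [← hxy, hs.mul_apply_eq hE ha hb]⟩
  · rintro ⟨y, hy, hxy⟩
    refine ⟨relNorm hEM ⟨y, hy⟩, (relNorm hEM ⟨y, hy⟩).2, ?_⟩
    rw [← hE.coe_relNorm h2, relNorm_trans hE.le hEM]
    have hx : (x : fldPM F Fs α) = relNorm hM.le ⟨y, hy⟩ :=
      Subtype.ext (by rw [hM.coe_relNorm h2]; exact hxy.symm)
    rw [hx, relNorm_trans (fldPM_map_le f α) hM.le]

/-- `(inf χ')_α` extends `κ_α`, for symmetric unramified `α`. -/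
theorem infData_unitsIncl (h2 : absVal F Fs 2 = 1) (hR : IsAdmissible F Fs R)
    (hRc : IsContinuousAction F Fs R) (hR' : IsAdmissible F Fs R')
    (hRc' : IsContinuousAction F Fs R') (f : R →[Sig F Fs] R') (hχ : IsMinimallyRamified χ')
    {α : R} (hα : IsSymUnram F Fs α) (x : (fldPM F Fs α)ˣ) :
    infData f χ' α (unitsIncl (fldPM_le_fld F Fs α) x) = kappa F Fs α x := by
  have := finiteDimensional_fld hRc α
  obtain ⟨τ, hτ⟩ := hα.1
  have hτ' : gal τ (f α) = neg F Fs (f α) := by rw [← map_gal, hτ, map_neg_eq]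
  have hM := isQuad_of_gal_eq_neg hR hRc hτ
  have hE := isQuad_of_gal_eq_neg hR' hRc' hτ'
  have hN : unitsNorm (fld_map_le f α) (unitsIncl (fldPM_le_fld F Fs α) x) =
      unitsIncl (fldPM_le_fld F Fs (f α)) (unitsNorm (fldPM_map_le f α) x) :=
    Units.ext (Subtype.ext
      (relNorm_eq_of_isQuad h2 hE hM (fldPM_map_le f α) (fld_map_le f α) (x : fldPM F Fs α)))
  rw [infData, MonoidHom.comp_apply, hN, hχ.restrict _ ⟨τ, hτ'⟩,
    kappa_unitsNorm h2 hR hRc hR' hRc' f hα]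

open scoped Classical in
/-- A tamely ramified extension of `κ_α` to `F_αˣ`, for symmetric ramified `α`, restricts to the
sign character on units. -/
theorem apply_unit_of_symRam (h2 : absVal F Fs 2 = 1) (hR' : IsAdmissible F Fs R')
    (hRc' : IsContinuousAction F Fs R') (hχ : IsMinimallyRamified χ') {β : R'}
    (hβ : IsSymRam F Fs β) {x : (fld F Fs β)ˣ} (hx : absVal F Fs (x : fld F Fs β) = 1) :
    χ' β x = if IsSqIn (fld F Fs β) (x : fld F Fs β) then 1 else -1 := by
  have := finiteDimensional_fld hRc' β
  obtain ⟨τ, hτ⟩ := hβ.1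
  have hE := isQuad_of_gal_eq_neg hR' hRc' hτ
  obtain ⟨s, hs, hw⟩ := hE.exists_isAnti_of_ramified h2 hβ.2
  -- the residue extension is trivial: `x = a + b s` is the product of the unit `a` of `F_{±β}` and
  -- an element `u` congruent to `1`
  obtain ⟨a, ha, b, hb, hab⟩ := hs.exists_eq_add hE h2 (x : fld F Fs β).2
  have hbs : absVal F Fs (b * s) ^ 2 = absVal F Fs (s ^ 2) * absVal F Fs b ^ 2 := by
    rw [← map_pow, mul_pow, map_mul, map_pow, map_pow, mul_comm]
  have hne1 : absVal F Fs (b * s) ≠ 1 := by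
    intro h1
    by_cases hb0 : b = 0
    · rw [hb0, zero_mul, map_zero] at h1
      exact zero_ne_one h1
    · refine hw.sq_ne (fldPM F Fs β).one_mem hb hb0 ?_
      rw [← hbs, h1, map_one]
  have hdist : absVal F Fs a ≠ absVal F Fs (b * s) := by
    intro h1
    by_cases hb0 : b = 0
    · rw [hb0, zero_mul, map_zero, map_eq_zero] at h1
      rw [hab, hb0, h1, zero_mul, add_zero, map_zero] at hx
      exact zero_ne_one hx
    · exact hw.sq_ne ha hb hb0 (by rw [h1, hbs])
  have hmax := (absVal F Fs).map_add_of_distinct_val hdist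
  rw [← hab, hx] at hmax
  have hbs1 : absVal F Fs (b * s) < 1 :=
    lt_of_le_of_ne (hmax ▸ le_max_right _ _) hne1
  have ha1 : absVal F Fs a = 1 := by
    rcases max_choice (absVal F Fs a) (absVal F Fs (b * s)) with h | h
    · rw [← h, ← hmax]
    · exact absurd (h.symm.trans hmax.symm) hne1
  have ha0 := ne_zero_of_absVal_eq_one ha1
  let c : (fldPM F Fs β)ˣ := Units.mk0 ⟨a, ha⟩ fun h => ha0 (congrArg Subtype.val h)
  let u : (fld F Fs β)ˣ := (unitsIncl (fldPM_le_fld F Fs β) c)⁻¹ * x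
  have hu : ((u : fld F Fs β) : Fs) = a⁻¹ * (x : fld F Fs β) := by
    simp only [u]
    rw [Units.val_mul, Units.val_inv_eq_inv_val]
    rfl
  have hu1 : absVal F Fs ((u : fld F Fs β) - 1 : Fs) < 1 := by
    rw [hu, hab, show a⁻¹ * (a + b * s) - 1 = a⁻¹ * (b * s) by field_simp; ring, map_mul, map_inv₀,
      ha1, inv_one, one_mul]
    exact hbs1
  have hxu : x = unitsIncl (fldPM_le_fld F Fs β) c * u := (mul_inv_cancel_left _ _).symm
  have hχu : χ' β u = 1 := hχ.ram β hβ (mem_principalUnitGroup_iff_absVal.2 hu1)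
  have husq : IsSqIn (fld F Fs β) (u : fld F Fs β) :=
    isSqIn_of_sub_one_lt h2 (u : fld F Fs β).2 hu1
  have hval : χ' β x = kappa F Fs β c := by
    conv_lhs => rw [hxu]
    rw [map_mul, hχu, mul_one, hχ.restrict β hβ.1]
  rw [hval, kappa_eq h2 hR' hRc' hτ]
  refine if_congr ?_ rfl rfl
  have hc : ((c : fldPM F Fs β) : Fs) = a := rfl
  rw [hc, hE.exists_mul_apply_eq_iff_isSqIn h2 hβ.2 ha1]
  have hxa : ((x : fld F Fs β) : Fs) = a * (u : fld F Fs β) := by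
    rw [hu, mul_inv_cancel_left₀ ha0]
  rw [hxa]
  constructor
  · intro h
    exact (h.mono hE.le).mul husq
  · intro h
    obtain ⟨y, hy, hay⟩ := IsSqIn.of_mul_left husq (coe_units_ne_zero u) h
    by_contra hn
    -- otherwise `F_β` would be generated by a square root of the unit `a`
    have hyK : y ∉ fldPM F Fs β := fun hyK => hn ⟨y, hyK, hay⟩
    have hya : τ y = -y := by
      have h1 : τ y ^ 2 = y ^ 2 := by rw [← map_pow, ← hay, hE.apply_eq ha]
      exact (sq_eq_sq_iff_eq_or_eq_neg.1 h1).resolve_left fun h3 => hyK (hE.mem_of_fixed hy h3)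
    have hy0 : y ≠ 0 := by
      rintro rfl
      exact ha0 (by rw [hay]; ring)
    have hyA : IsAnti (fld F Fs β) τ y := ⟨hy, hy0, hya⟩
    exact hβ.2 (hyA.ramIndex_eq_one hE h2 (absVal_eq_one_of_sq (hay ▸ ha1)))

open scoped Classical in
/-- For symmetric ramified `α'`, the restriction of `(inf χ')_α` to units is the sign character to
the power `e(α/α')`. -/
theorem infData_unit_of_symRam (h2 : absVal F Fs 2 = 1) (hRc : IsContinuousAction F Fs R)
    (hR' : IsAdmissible F Fs R') (hRc' : IsContinuousAction F Fs R') (f : R →[Sig F Fs] R')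
    (hχ : IsMinimallyRamified χ') {α : R} (hα : IsSymRam F Fs (f α)) {x : (fld F Fs α)ˣ}
    (hx : absVal F Fs (x : fld F Fs α) = 1) :
    infData f χ' α x = if IsSqIn (fld F Fs α) (x : fld F Fs α) ∨
      Even (ramIndex (fld_map_le f α)) then 1 else -1 := by
  have := finiteDimensional_fld hRc α
  have h1 : absVal F Fs (unitsNorm (fld_map_le f α) x : fld F Fs (f α)) = 1 := by
    rw [coe_unitsNorm, absVal_relNorm, hx, one_pow]
  rw [infData, MonoidHom.comp_apply, apply_unit_of_symRam h2 hR' hRc' hχ hα h1]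
  exact if_congr (isSqIn_relNorm_iff h2 (fld_map_le f α) hx) rfl rfl

theorem infData_unit_of_not_symRam (hRc : IsContinuousAction F Fs R) (f : R →[Sig F Fs] R')
    (hχ : IsMinimallyRamified χ') {α : R} (hα : ¬ IsSymRam F Fs (f α)) {x : (fld F Fs α)ˣ}
    (hx : absVal F Fs (x : fld F Fs α) = 1) : infData f χ' α x = 1 := by
  have := finiteDimensional_fld hRc α
  rw [infData, MonoidHom.comp_apply]
  by_cases hs : IsSym F Fs (f α)
  · have hu : IsSymUnram F Fs (f α) := ⟨hs, by
      by_contra h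
      exact hα ⟨hs, h⟩⟩
    refine hχ.unram _ hu (mem_unitGroup_iff_absVal.2 ?_)
    rw [coe_unitsNorm, absVal_relNorm, hx, one_pow]
  · rw [hχ.asym _ hs]
    rfl

theorem infData_principal_unit (h2 : absVal F Fs 2 = 1) (hRc : IsContinuousAction F Fs R)
    (hR' : IsAdmissible F Fs R') (hRc' : IsContinuousAction F Fs R') (f : R →[Sig F Fs] R')
    (hχ : IsMinimallyRamified χ') {α : R} {x : (fld F Fs α)ˣ}
    (hx : absVal F Fs ((x : fld F Fs α) - 1 : Fs) < 1) : infData f χ' α x = 1 := by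
  classical
  have hx1 : absVal F Fs (x : fld F Fs α) = 1 := absVal_eq_one_of_sub_lt (map_one _) hx
  by_cases hα : IsSymRam F Fs (f α)
  · rw [infData_unit_of_symRam h2 hRc hR' hRc' f hχ hα hx1, if_pos]
    exact Or.inl (isSqIn_of_sub_one_lt h2 (x : fld F Fs α).2 hx)
  · exact infData_unit_of_not_symRam hRc f hχ hα hx1

end Values

/-! ### The `ζ`-data -/

section ZetaData

variable {F Fs : Type*} [Field F] [ValuativeRel F] [TopologicalSpace F]
  [IsNonarchimedeanLocalField F] [Field Fs] [Algebra F Fs] [IsSepClosure F Fs]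
  {R : Type*} [MulAction (Sig F Fs) R] {R' : Type*} [MulAction (Sig F Fs) R']

theorem IsEquivariantFamily.apply_of_eq_gal {χ : CharFamily F Fs R} (h : IsEquivariantFamily χ)
    (σ : Fs ≃ₐ[F] Fs) {α β : R} (hβ : β = TorusSigns.gal σ α) (x : (fld F Fs α)ˣ)
    (y : (fld F Fs β)ˣ) (hxy : ((y : fld F Fs β) : Fs) = σ ((x : fld F Fs α) : Fs)) :
    χ β y = χ α x := by
  subst hβ
  exact h.gal σ α x y hxy

theorem IsEquivariantFamily.apply_of_eq_neg {χ : CharFamily F Fs R} (h : IsEquivariantFamily χ)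
    {α β : R} (hβ : β = TorusSigns.neg F Fs α) (x : (fld F Fs α)ˣ) (y : (fld F Fs β)ˣ)
    (hxy : ((y : fld F Fs β) : Fs) = ((x : fld F Fs α) : Fs)) : χ β y = (χ α x)⁻¹ := by
  subst hβ
  exact h.neg α x y hxy

variable {χ' : CharFamily F Fs R'}

theorem infData_gal (h : IsEquivariantFamily χ') (f : R →[Sig F Fs] R') (σ : Fs ≃ₐ[F] Fs) (α : R)
    (x : (fld F Fs α)ˣ) (y : (fld F Fs (gal σ α))ˣ)
    (hxy : ((y : fld F Fs (gal σ α)) : Fs) = σ ((x : fld F Fs α) : Fs)) :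
    infData f χ' (gal σ α) y = infData f χ' α x :=
  h.apply_of_eq_gal σ (map_gal f σ α) _ _ (relNorm_gal (fld_map_le f α) (fld_map_le f (gal σ α)) σ
    (by rw [map_gal, map_fld]) (map_fld σ α) x y hxy)

theorem infData_neg (h : IsEquivariantFamily χ') (f : R →[Sig F Fs] R') (α : R)
    (x : (fld F Fs α)ˣ) (y : (fld F Fs (neg F Fs α))ˣ)
    (hxy : ((y : fld F Fs (neg F Fs α)) : Fs) = ((x : fld F Fs α) : Fs)) :
    infData f χ' (neg F Fs α) y = (infData f χ' α x)⁻¹ := by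
  have hmap (β : R) : (fld F Fs β).map ((1 : Fs ≃ₐ[F] Fs) : Fs →ₐ[F] Fs) =
      fld F Fs (neg F Fs β) := by rw [map_fld, gal_one, fld_neg]
  have hmap' (β : R') : (fld F Fs β).map ((1 : Fs ≃ₐ[F] Fs) : Fs →ₐ[F] Fs) =
      fld F Fs (neg F Fs β) := by rw [map_fld, gal_one, fld_neg]
  exact h.apply_of_eq_neg (map_neg_eq f α) _ _ (relNorm_gal (fld_map_le f α)
    (fld_map_le f (neg F Fs α)) 1 (by rw [map_neg_eq, hmap']) (hmap α) x y hxy)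

theorem zetaData_of_isSymUnram (f : R →[Sig F Fs] R') {α : R} (hα : IsSymUnram F Fs α)
    (x : (fld F Fs α)ˣ) :
    zetaData f χ' α x = unramExtension F Fs α x * (infData f χ' α x)⁻¹ := by
  rw [zetaData, MonoidHom.mul_apply, MonoidHom.inv_apply, minData, if_pos hα.1, if_pos hα]

theorem zetaData_of_isSym_of_not (f : R →[Sig F Fs] R') {α : R} (hα : IsSym F Fs α)
    (hα' : ¬ IsSymUnram F Fs α) : zetaData f χ' α = 1 := by
  rw [zetaData, minData, if_pos hα, if_neg hα']
  exact MonoidHom.ext fun x => mul_inv_cancel (infData f χ' α x)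

theorem zetaData_of_not_isSym (f : R →[Sig F Fs] R') {α : R} (hα : ¬ IsSym F Fs α)
    (x : (fld F Fs α)ˣ) : zetaData f χ' α x = (infData f χ' α x)⁻¹ := by
  rw [zetaData, MonoidHom.mul_apply, MonoidHom.inv_apply, minData, if_neg hα, MonoidHom.one_apply,
    one_mul]

theorem isZetaData_zetaData (h2 : absVal F Fs 2 = 1) (hR : IsAdmissible F Fs R)
    (hRc : IsContinuousAction F Fs R) (hR' : IsAdmissible F Fs R')
    (hRc' : IsContinuousAction F Fs R') (f : R →[Sig F Fs] R') (hχ : IsMinimallyRamified χ') :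
    IsZetaData (zetaData f χ') where
  continuous α := by
    classical
    refine isContinuousChar_of_forall_sub_one_lt fun x hx => ?_
    have hinf := infData_principal_unit h2 hRc hR' hRc' f hχ hx
    by_cases hs : IsSym F Fs α
    · by_cases hu : IsSymUnram F Fs α
      · rw [zetaData_of_isSymUnram f hu, hinf, inv_one, mul_one,
          unramExtension_apply h2 hR hRc hu, if_pos]
        exact isEvenIn_of_absVal_eq_one (absVal_eq_one_of_sub_lt (map_one _) hx)
      · rw [zetaData_of_isSym_of_not f hs hu, MonoidHom.one_apply]
    · rw [zetaData_of_not_isSym f hs, hinf, inv_one]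
  gal σ α x y hxy := by
    classical
    have hinf := infData_gal hχ.toIsEquivariantFamily f σ α x y hxy
    by_cases hs : IsSym F Fs α
    · have hs' := (isSym_gal_iff σ α).2 hs
      by_cases hu : IsSymUnram F Fs α
      · have hu' := (isSymUnram_gal_iff hRc σ α).2 hu
        rw [zetaData_of_isSymUnram f hu, zetaData_of_isSymUnram f hu', hinf,
          unramExtension_apply h2 hR hRc hu, unramExtension_apply h2 hR hRc hu']
        congr 1
        refine if_congr ?_ rfl rfl
        rw [hxy, ← map_fld, isEvenIn_gal_iff]
      · have hu' := mt (isSymUnram_gal_iff hRc σ α).1 hu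
        rw [zetaData_of_isSym_of_not f hs hu, zetaData_of_isSym_of_not f hs' hu']
        rfl
    · have hs' := mt (isSym_gal_iff σ α).1 hs
      rw [zetaData_of_not_isSym f hs, zetaData_of_not_isSym f hs', hinf]
  neg α x y hxy := by
    classical
    have hinf := infData_neg hχ.toIsEquivariantFamily f α x y hxy
    by_cases hs : IsSym F Fs α
    · have hs' := (isSym_neg_iff α).2 hs
      by_cases hu : IsSymUnram F Fs α
      · have hu' := (isSymUnram_neg_iff hRc α).2 hu
        rw [zetaData_of_isSymUnram f hu, zetaData_of_isSymUnram f hu', hinf, mul_inv,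
          unramExtension_apply h2 hR hRc hu, unramExtension_apply h2 hR hRc hu', hxy, fld_neg]
        congr 1
        split_ifs
        · exact inv_one.symm
        · exact inv_neg_one.symm
      · have hu' := mt (isSymUnram_neg_iff hRc α).1 hu
        rw [zetaData_of_isSym_of_not f hs hu, zetaData_of_isSym_of_not f hs' hu']
        exact inv_one.symm
    · have hs' := mt (isSym_neg_iff α).1 hs
      rw [zetaData_of_not_isSym f hs, zetaData_of_not_isSym f hs', hinf]
  restrict α hs x := by
    by_cases hu : IsSymUnram F Fs α
    · rw [zetaData_of_isSymUnram f hu, (unramExtension_spec h2 hR hRc hu).2,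
        infData_unitsIncl h2 hR hRc hR' hRc' f hχ hu, mul_inv_cancel]
    · rw [zetaData_of_isSym_of_not f hs hu, MonoidHom.one_apply]

/-- For symmetric `α`, all choices of `τ_α` agree on `F_α`. -/
theorem apply_eq_of_gal_eq_neg {α : R} {τ τ' : Fs ≃ₐ[F] Fs} (hτ : gal τ α = neg F Fs α)
    (hτ' : gal τ' α = neg F Fs α) {x : Fs} (hx : x ∈ fld F Fs α) : τ' x = τ x := by
  have h1 := mem_fld.1 hx (τ.symm * τ') (by rw [gal_mul, hτ', ← hτ, gal_symm_gal])
  exact τ.symm_apply_eq.1 h1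

/-- Hilbert 90 for `F_α/F_{±α}`: the defining property of `halfElement`. -/
theorem halfElement_spec (hR : IsAdmissible F Fs R) (hRc : IsContinuousAction F Fs R) {α : R}
    {τ : Fs ≃ₐ[F] Fs} (hτ : gal τ α = neg F Fs α) {u : (fld F Fs α)ˣ}
    (hu : τ ((u : fld F Fs α) : Fs) = ((u : fld F Fs α) : Fs)⁻¹) :
    ((halfElement α u : fld F Fs α) : Fs) / τ ((halfElement α u : fld F Fs α) : Fs) =
      ((u : fld F Fs α) : Fs) := by
  have hq := isQuad_of_gal_eq_neg hR hRc hτ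
  have hu0 := coe_units_ne_zero u
  suffices h : ∃ δ : (fld F Fs α)ˣ, ((δ : fld F Fs α) : Fs) / τ ((δ : fld F Fs α) : Fs) =
      ((u : fld F Fs α) : Fs) by
    obtain ⟨δ, hδ⟩ := h
    refine Classical.epsilon_spec (p := fun δ : (fld F Fs α)ˣ => ∀ τ : Fs ≃ₐ[F] Fs,
      gal τ α = neg F Fs α → ((δ : fld F Fs α) : Fs) / τ ((δ : fld F Fs α) : Fs) =
        ((u : fld F Fs α) : Fs)) ⟨δ, fun τ' hτ' => ?_⟩ τ hτ
    rw [apply_eq_of_gal_eq_neg hτ hτ' (δ : fld F Fs α).2, hδ]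
  by_cases h1 : (1 : Fs) + (u : fld F Fs α) = 0
  · obtain ⟨s, hs⟩ := hq.exists_isAnti
    refine ⟨Units.mk0 ⟨s, hs.mem⟩ fun h => hs.ne_zero (congrArg Subtype.val h), ?_⟩
    change s / τ s = _
    rw [hs.map_eq, div_neg, div_self hs.ne_zero]
    linear_combination -h1
  · refine ⟨Units.mk0 (1 + (u : fld F Fs α)) fun h => h1 (congrArg Subtype.val h), ?_⟩
    change (1 + ((u : fld F Fs α) : Fs)) / τ (1 + ((u : fld F Fs α) : Fs)) = _
    rw [map_add, map_one, hu]
    have h3 : 1 + ((u : fld F Fs α) : Fs)⁻¹ =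
        ((u : fld F Fs α) : Fs)⁻¹ * (1 + (u : fld F Fs α)) := by
      rw [mul_add, mul_one, inv_mul_cancel₀ hu0, add_comm]
    rw [h3, div_mul_cancel_right₀ h1, inv_inv]

/-- `ζ_α(δ)` only depends on `δ/τ_α(δ)`, since `ζ_α` is trivial on `F_{±α}ˣ`. -/
theorem IsZetaData.apply_eq_of_div_eq {ζ : CharFamily F Fs R} (hζ : IsZetaData ζ)
    (hR : IsAdmissible F Fs R) (hRc : IsContinuousAction F Fs R) {α : R} {τ : Fs ≃ₐ[F] Fs}
    (hτ : TorusSigns.gal τ α = TorusSigns.neg F Fs α) {x y : (fld F Fs α)ˣ}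
    (h : ((x : fld F Fs α) : Fs) / τ ((x : fld F Fs α) : Fs) =
      ((y : fld F Fs α) : Fs) / τ ((y : fld F Fs α) : Fs)) : ζ α x = ζ α y := by
  have hq := isQuad_of_gal_eq_neg hR hRc hτ
  have hx0 := coe_units_ne_zero x
  have hy0 := coe_units_ne_zero y
  have hτx : τ ((x : fld F Fs α) : Fs) ≠ 0 := (map_ne_zero τ).2 hx0
  have hτy : τ ((y : fld F Fs α) : Fs) ≠ 0 := (map_ne_zero τ).2 hy0
  have hval : (((x * y⁻¹ : (fld F Fs α)ˣ) : fld F Fs α) : Fs) =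
      ((x : fld F Fs α) : Fs) / ((y : fld F Fs α) : Fs) := by
    rw [Units.val_mul, Units.val_inv_eq_inv_val, div_eq_mul_inv]
    rfl
  have hmem : ((x : fld F Fs α) : Fs) / ((y : fld F Fs α) : Fs) ∈ fldPM F Fs α := by
    refine hq.mem_of_fixed (div_mem (x : fld F Fs α).2 (y : fld F Fs α).2) ?_
    rw [map_div₀, div_eq_div_iff hτy hy0]
    rw [div_eq_div_iff hτx hτy] at h
    linear_combination -h
  have h1 : x * y⁻¹ = unitsIncl (fldPM_le_fld F Fs α)
      (Units.mk0 ⟨_, hmem⟩ fun h0 => div_ne_zero hx0 hy0 (congrArg Subtype.val h0)) :=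
    Units.ext (Subtype.ext hval)
  have h3 := hζ.restrict α ⟨τ, hτ⟩ (Units.mk0 ⟨_, hmem⟩ fun h0 =>
    div_ne_zero hx0 hy0 (congrArg Subtype.val h0))
  rw [← h1, map_mul, map_inv, mul_inv_eq_one] at h3
  exact h3

end ZetaData

/-! ### Values of characters of tori -/

section CharacterValues

open scoped TensorProduct

variable {F Fs : Type*} [Field F] [Field Fs] [Algebra F Fs]
  {A : Type*} [CommRing A] [HopfAlgebra F A] {B : Type*} [CommRing B] [HopfAlgebra F B]
  {R : Type*} [MulAction (Sig F Fs) R]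

theorem evalAt_tmul (γ : Points F A) (x : Fs) (a : A) :
    evalAt γ (x ⊗ₜ[F] a) = x * algebraMap F Fs (γ.ofConv a) := by
  simp [evalAt, Algebra.ofId_apply]

theorem evalAt_mul (γ δ : Points F A) (z : Fs ⊗[F] A) : evalAt (γ * δ) z =
    Algebra.TensorProduct.lift (evalAt γ) (evalAt δ) (fun _ _ => Commute.all _ _)
      (Coalgebra.comul (R := Fs) z) := by
  have h : evalAt (γ * δ) = (Algebra.TensorProduct.lift (evalAt γ) (evalAt δ)
      (fun _ _ => Commute.all _ _)).comp (Bialgebra.comulAlgHom Fs (Fs ⊗[F] A)) := by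
    refine Algebra.TensorProduct.ext' fun x a => ?_
    rw [evalAt_tmul, AlgHom.comp_apply, Bialgebra.comulAlgHom_apply, TensorProduct.comul_tmul]
    change x * algebraMap F Fs ((γ * δ) a) = _
    rw [AlgHom.convMul_apply]
    generalize (Coalgebra.comul (R := F) a) = t
    induction t with
    | zero => simp
    | tmul a b =>
      simp only [Algebra.TensorProduct.lift_tmul, CommSemiring.comul_apply,
        TensorProduct.AlgebraTensorModule.tensorTensorTensorComm_tmul, evalAt_tmul, map_mul,
        one_mul]
      ring
    | add s t hs ht =>
      simp only [map_add, mul_add, TensorProduct.tmul_add, hs, ht]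
  exact DFunLike.congr_fun h z

theorem evalAt_pointsMap (φ : B →ₐc[F] A) (γ : Points F A) (z : Fs ⊗[F] B) :
    evalAt (pointsMap φ γ) z = evalAt γ (Bialgebra.TensorProduct.map (BialgHom.id Fs Fs) φ z) := by
  induction z with
  | zero => simp
  | tmul x b =>
    rw [Bialgebra.TensorProduct.map_tmul, evalAt_tmul, evalAt_tmul]
    rfl
  | add x y hx hy => rw [map_add, map_add, map_add, hx, hy]

/-- Evaluation of a character of a torus at rational points. -/
def charHom (χ : Chars F Fs A) : Points F A →* Fsˣ :=
  MonoidHom.mk' (fun γ => (χ.isGroupLikeElem_val.isUnit.map (evalAt γ)).unit) fun γ δ => by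
    ext
    change evalAt (γ * δ) χ.val = evalAt γ χ.val * evalAt δ χ.val
    rw [evalAt_mul, χ.isGroupLikeElem_val.comul_eq_tmul_self, Algebra.TensorProduct.lift_tmul]

theorem coe_charHom (χ : Chars F Fs A) (γ : Points F A) :
    (charHom χ γ : Fs) = evalAt γ χ.val := rfl

theorem charHom_charsMap (φ : B →ₐc[F] A) (χ : Chars F Fs B) (γ : Points F A) :
    charHom (charsMap φ χ) γ = charHom χ (pointsMap φ γ) :=
  Units.ext (evalAt_pointsMap φ γ χ.val).symm

theorem charHom_inv (χ : Chars F Fs A) (γ : Points F A) :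
    charHom χ⁻¹ γ = (charHom χ γ)⁻¹ := by
  refine eq_inv_of_mul_eq_one_left (Units.ext ?_)
  rw [Units.val_mul, coe_charHom, coe_charHom, ← map_mul, ← GroupLike.val_mul, inv_mul_cancel,
    GroupLike.val_one, map_one, Units.val_one]

variable {bar : R → Chars F Fs A} (hbar : IsSigmaEquivariant bar)

theorem coe_charVal (α : R) (γ : Points F A) :
    ((charVal hbar α γ : fld F Fs α) : Fs) = charHom (bar α) γ := rfl

theorem charVal_mul (α : R) (γ δ : Points F A) :
    charVal hbar α (γ * δ) = charVal hbar α γ * charVal hbar α δ :=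
  Units.ext (Subtype.ext (congrArg Units.val (map_mul (charHom (bar α)) γ δ)))

/-- `ᾱ(γ)` has norm `1` to `F_{±α}`, for symmetric `α`. -/
theorem apply_charVal {α : R} {τ : Fs ≃ₐ[F] Fs} (hτ : gal τ α = neg F Fs α) (γ : Points F A) :
    τ ((charVal hbar α γ : fld F Fs α) : Fs) = ((charVal hbar α γ : fld F Fs α) : Fs)⁻¹ := by
  rw [coe_charVal, ← Units.val_inv_eq_inv_val, ← charHom_inv, ← hbar.neg, ← hτ, coe_charHom,
    coe_charHom, hbar.gal, evalAt_map]

section Bounded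

variable [ValuativeRel F] [TopologicalSpace F] [IsNonarchimedeanLocalField F] [IsSepClosure F Fs]

/-- A bounded set of rational points over `F` is bounded for functions over `Fs`. -/
theorem IsBoundedSet.exists_le {U : Set (Points F B)} (hU : IsBoundedSet U) (z : Fs ⊗[F] B) :
    ∃ c : ℝ≥0, ∀ t ∈ U, absVal F Fs (evalAt t z) ≤ c := by
  induction z with
  | zero => exact ⟨0, fun t _ => by rw [map_zero, map_zero]⟩
  | tmul x b =>
    obtain ⟨c, hc⟩ := hU b
    obtain ⟨y, rfl⟩ := ValuativeRel.valuation_surjective c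
    refine ⟨absVal F Fs x * absVal F Fs (algebraMap F Fs y), fun t ht => ?_⟩
    rw [evalAt_tmul, map_mul]
    exact mul_le_mul_right (absVal_algebraMap_le_iff.2 (hc t ht)) _
  | add z z' hz hz' =>
    obtain ⟨c, hc⟩ := hz
    obtain ⟨c', hc'⟩ := hz'
    refine ⟨max c c', fun t ht => ?_⟩
    rw [map_add]
    exact (Valuation.map_add _ _ _).trans (max_le_max (hc t ht) (hc' t ht))

/-- Characters are bounded by `1` on bounded subgroups, since the powers of an element of absolute
value larger than `1` are unbounded. -/
theorem absVal_charHom_le_one {U : Subgroup (Points F B)}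
    (hU : IsBoundedSet (U : Set (Points F B))) (χ : Chars F Fs B) {t : Points F B} (ht : t ∈ U) :
    absVal F Fs (charHom χ t) ≤ 1 := by
  obtain ⟨c, hc⟩ := hU.exists_le χ.val
  by_contra! h
  obtain ⟨n, hn⟩ := pow_unbounded_of_one_lt c h
  have h1 := hc (t ^ n) (U.pow_mem ht n)
  rw [← coe_charHom, map_pow, Units.val_pow_eq_pow_val, map_pow] at h1
  exact absurd hn h1.not_gt

/-- Characters take unit values on the maximal bounded subgroup. -/
theorem absVal_charHom_eq_one (χ : Chars F Fs B) {t : Points F B}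
    (ht : t ∈ boundedSubgroup F B) : absVal F Fs (charHom χ t) = 1 := by
  have h : boundedSubgroup F B ≤
      ((Units.map (absVal F Fs).toMonoidWithZeroHom.toMonoidHom).comp (charHom χ)).ker := by
    refine sSup_le fun U hU t ht => MonoidHom.mem_ker.2 (Units.ext ?_)
    change absVal F Fs (charHom χ t) = 1
    refine le_antisymm (absVal_charHom_le_one hU χ ht) ?_
    have h1 := absVal_charHom_le_one hU χ (U.inv_mem ht)
    rw [map_inv, Units.val_inv_eq_inv_val, map_inv₀] at h1
    exact (inv_le_one₀ (absVal_pos (Units.ne_zero _))).1 h1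
  exact congrArg Units.val (MonoidHom.mem_ker.1 (h ht))

/-- `ᾱ(γ)` is a unit for `γ ∈ S(F)_c`, since `ᾱ` is the pullback of a character of `T`. -/
theorem absVal_charVal {φ : B →ₐc[F] A} (hφ : IsDualToSpan bar φ) {γ : Points F A}
    (hγ : γ ∈ pointsC φ) (α : R) :
    absVal F Fs ((charVal hbar α γ : fld F Fs α) : Fs) = 1 := by
  have h : bar α ∈ Set.range (charsMap (Fs := Fs) φ) := by
    rw [hφ.range_eq]
    exact Subgroup.subset_closure ⟨α, rfl⟩
  obtain ⟨χ, hχ⟩ := h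
  rw [coe_charVal, ← hχ, charHom_charsMap]
  exact absVal_charHom_eq_one χ hγ

theorem orbitChar_mul (hR : IsAdmissible F Fs R) (hRc : IsContinuousAction F Fs R)
    {ζ : CharFamily F Fs R} (hζ : IsZetaData ζ) (α : R) (γ δ : Points F A) :
    orbitChar hbar ζ α (γ * δ) = orbitChar hbar ζ α γ * orbitChar hbar ζ α δ := by
  by_cases hα : IsSym F Fs α
  · rw [orbitChar, orbitChar, orbitChar, if_pos hα, if_pos hα, if_pos hα, ← map_mul]
    obtain ⟨τ, hτ⟩ := hα
    refine hζ.apply_eq_of_div_eq hR hRc hτ ?_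
    rw [halfElement_spec hR hRc hτ (apply_charVal hbar hτ (γ * δ)), charVal_mul]
    have h1 := halfElement_spec hR hRc hτ (apply_charVal hbar hτ γ)
    have h2 := halfElement_spec hR hRc hτ (apply_charVal hbar hτ δ)
    have hmul (x y : (fld F Fs α)ˣ) : (((x * y : (fld F Fs α)ˣ) : fld F Fs α) : Fs) =
      (x : fld F Fs α) * (y : fld F Fs α) := rfl
    rw [hmul, hmul, map_mul, mul_div_mul_comm, h1, h2]
  · rw [orbitChar, orbitChar, orbitChar, if_neg hα, if_neg hα, if_neg hα, charVal_mul, map_mul]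

/-- The character `ζ_S`, for a set of `ζ`-data. -/
def zetaHom [Finite R] (hR : IsAdmissible F Fs R) (hRc : IsContinuousAction F Fs R)
    {ζ : CharFamily F Fs R} (hζ : IsZetaData ζ) : Points F A →* ℂˣ :=
  MonoidHom.mk' (zetaS hbar ζ) fun γ δ => by
    simp only [zetaS, orbitChar_mul hbar hR hRc hζ]
    exact finprod_mul_distrib (Set.toFinite _) (Set.toFinite _)

end Bounded

end CharacterValues

/-! ### Norms in residue fields of unramified quadratic extensions -/

section ResidueNorm

variable {F Fs : Type*} [Field F] [ValuativeRel F] [TopologicalSpace F]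
  [IsNonarchimedeanLocalField F] [Field Fs] [Algebra F Fs] [IsSepClosure F Fs]
  {K L : IntermediateField F Fs} {τ : Fs ≃ₐ[F] Fs}

theorem coe_unitGroupToResidueFieldUnits {x : Lˣ} (hx : x ∈ (integers L).unitGroup) :
    ((integers L).unitGroupToResidueFieldUnits ⟨x, hx⟩ : ResidueField L) =
      IsLocalRing.residue (integers L) ((integers L).unitGroupMulEquiv ⟨x, hx⟩) := rfl

/-- For an unramified quadratic extension `L/K`, the norm of the residue class of `x` is the class
of `x τ(x)`: the residue classes of `1, s` form a basis of `k_L/k_K`, for a unit `s` that is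
anti-invariant under `τ`. -/
theorem IsQuad.norm_residue_eq_one_iff (hq : IsQuad K L τ) (h2 : absVal F Fs 2 = 1)
    [FiniteDimensional F L] (he : ramIndex hq.le = 1) (x : integers L) :
    letI := residueAlgebra hq.le
    Algebra.norm (ResidueField K) (IsLocalRing.residue (integers L) x) = 1 ↔
      absVal F Fs (((x : L) : Fs) * τ ((x : L) : Fs) - 1) < 1 := by
  letI := residueAlgebra hq.le
  obtain ⟨s, hs, hs1⟩ := hq.exists_isAnti_of_unramified he
  have hmul (a b : integers K) (c : integers L) (hc : ((c : L) : Fs) = s) :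
      algebraMap (ResidueField K) (ResidueField L) (IsLocalRing.residue _ a) +
        algebraMap (ResidueField K) (ResidueField L) (IsLocalRing.residue _ b) *
          IsLocalRing.residue _ c =
      IsLocalRing.residue _ (integersMap hq.le a + integersMap hq.le b * c) := by
    rw [map_add, map_mul]
    rfl
  have hcoe (a b : integers K) (c : integers L) (hc : ((c : L) : Fs) = s) :
      (((integersMap hq.le a + integersMap hq.le b * c : integers L) : L) : Fs) =
        (a : K) + (b : K) * s := by
    rw [← hc]
    rfl
  have hex (x : integers L) (c : integers L) (hc : ((c : L) : Fs) = s) :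
      ∃ a b : integers K, x = integersMap hq.le a + integersMap hq.le b * c := by
    obtain ⟨a, ha, b, hb, hab⟩ := hs.exists_eq_add hq h2 (x : L).2
    have h1 : absVal F Fs (x : L) ≤ 1 := mem_integers_iff_absVal.1 x.2
    rw [hab, hs.absVal_add hq h2 hs1 ha hb, max_le_iff] at h1
    refine ⟨⟨⟨a, ha⟩, mem_integers_iff_absVal.2 h1.1⟩, ⟨⟨b, hb⟩, mem_integers_iff_absVal.2 h1.2⟩,
      Subtype.ext (Subtype.ext ?_)⟩
    rw [hcoe _ _ c hc]
    exact hab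
  let c : integers L := ⟨⟨s, hs.mem⟩, mem_integers_iff_absVal.2 hs1.le⟩
  let d : integers K := ⟨⟨s ^ 2, hs.sq_mem hq⟩, mem_integers_iff_absVal.2
    (by rw [map_pow, hs1, one_pow])⟩
  have hd : (IsLocalRing.residue (integers L) c) ^ 2 =
      algebraMap (ResidueField K) (ResidueField L) (IsLocalRing.residue _ d) := by
    rw [← map_pow]
    rfl
  obtain ⟨a, b, rfl⟩ := hex x c rfl
  have hli (a b : ResidueField K) (hab : algebraMap _ (ResidueField L) a +
      algebraMap _ (ResidueField L) b * IsLocalRing.residue _ c = 0) : a = 0 ∧ b = 0 := by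
    obtain ⟨a, rfl⟩ := IsLocalRing.residue_surjective a
    obtain ⟨b, rfl⟩ := IsLocalRing.residue_surjective b
    rw [hmul _ _ c rfl, IsLocalRing.residue_eq_zero_iff, mem_maximalIdeal_iff_absVal,
      hcoe a b c rfl, hs.absVal_add hq h2 hs1 (a : K).2 (b : K).2, max_lt_iff] at hab
    rw [IsLocalRing.residue_eq_zero_iff, IsLocalRing.residue_eq_zero_iff,
      mem_maximalIdeal_iff_absVal, mem_maximalIdeal_iff_absVal]
    exact hab
  have hsp (y : ResidueField L) : ∃ a b : ResidueField K, y = algebraMap _ (ResidueField L) a +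
      algebraMap _ (ResidueField L) b * IsLocalRing.residue _ c := by
    obtain ⟨y, rfl⟩ := IsLocalRing.residue_surjective y
    obtain ⟨a, b, rfl⟩ := hex y c rfl
    exact ⟨_, _, (hmul a b c rfl).symm⟩
  obtain ⟨e, he0, he1⟩ := exists_basis_one hli hsp
  rw [← hmul _ _ c rfl, norm_add_mul e he0 he1 hd, hcoe a b c rfl,
    hs.mul_apply_eq hq (a : K).2 (b : K).2, ← map_pow, ← map_pow, ← map_mul, ← map_sub,
    ← map_one (IsLocalRing.residue (integers K)), residue_eq_residue_iff]
  rfl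

theorem IsQuad.mem_residueNormOne_iff (hq : IsQuad K L τ) (h2 : absVal F Fs 2 = 1)
    [FiniteDimensional F L] (he : ramIndex hq.le = 1) {x : Lˣ}
    (hx : x ∈ (integers L).unitGroup) :
    (integers L).unitGroupToResidueFieldUnits ⟨x, hx⟩ ∈ residueNormOne hq.le ↔
      absVal F Fs (((x : L) : Fs) * τ ((x : L) : Fs) - 1) < 1 := by
  have h := hq.norm_residue_eq_one_iff h2 he ((integers L).unitGroupMulEquiv ⟨x, hx⟩)
  rw [residueNormOne, MonoidHom.mem_ker, ← Units.val_inj]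
  exact h

theorem IsQuad.hasResidueNormOne (hq : IsQuad K L τ) (h2 : absVal F Fs 2 = 1)
    [FiniteDimensional F L] (he : ramIndex hq.le = 1) {x : Lˣ}
    (hx : absVal F Fs (x : L) = 1) (hxτ : τ ((x : L) : Fs) = ((x : L) : Fs)⁻¹) :
    HasResidueNormOne hq.le x := by
  refine ⟨mem_unitGroup_iff_absVal.2 hx, (hq.mem_residueNormOne_iff h2 he _).2 ?_⟩
  rw [hxτ, mul_inv_cancel₀ (coe_units_ne_zero x), sub_self, map_zero]
  exact zero_lt_one

/-- Units of `K` become squares in an unramified quadratic extension. -/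
theorem IsQuad.isSqIn_of_unramified (hq : IsQuad K L τ) (h2 : absVal F Fs 2 = 1)
    [FiniteDimensional F L] (he : ramIndex hq.le = 1) {a : Fs} (ha : a ∈ K)
    (ha1 : absVal F Fs a = 1) : IsSqIn L a := by
  have := finiteDimensional_of_le hq.le
  obtain ⟨s, hs, hs1⟩ := hq.exists_isAnti_of_unramified he
  by_cases h : IsSqIn K a
  · exact h.mono hq.le
  · have h1 : IsSqIn K (a * s ^ 2) := isSqIn_mul_of_not h2 ha (hs.sq_mem hq) ha1
      (by rw [map_pow, hs1, one_pow]) h (hs.not_isSqIn_sq hq h2)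
    exact IsSqIn.of_mul_left ⟨s, hs.mem, rfl⟩ (pow_ne_zero 2 hs.ne_zero) (h1.mono hq.le)

/-- In an unramified quadratic extension, a unit `r` that is congruent to `τ(r)` is a square. -/
theorem IsQuad.isSqIn_of_absVal_sub_lt (hq : IsQuad K L τ) (h2 : absVal F Fs 2 = 1)
    [FiniteDimensional F L] (he : ramIndex hq.le = 1) {r : Fs} (hr : r ∈ L)
    (hr1 : absVal F Fs r = 1) (h : absVal F Fs (r - τ r) < 1) : IsSqIn L r := by
  obtain ⟨s, hs, hs1⟩ := hq.exists_isAnti_of_unramified he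
  obtain ⟨a, ha, b, hb, rfl⟩ := hs.exists_eq_add hq h2 hr
  have hb1 : absVal F Fs b < 1 := by
    have h3 : a + b * s - τ (a + b * s) = 2 * b * s := by
      rw [map_add, map_mul, hs.map_eq, hq.apply_eq ha, hq.apply_eq hb]
      ring
    rwa [h3, map_mul, map_mul, h2, hs1, one_mul, mul_one] at h
  have ha1 : absVal F Fs a = 1 := by
    rw [hs.absVal_add hq h2 hs1 ha hb] at hr1
    rcases max_choice (absVal F Fs a) (absVal F Fs b) with h4 | h4
    · exact h4.symm.trans hr1
    · exact absurd (h4.symm.trans hr1) hb1.ne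
  have ha0 := ne_zero_of_absVal_eq_one ha1
  have h5 : a + b * s = ((a + b * s) / a) * a := by rw [div_mul_cancel₀ _ ha0]
  rw [h5]
  refine IsSqIn.mul (isSqIn_of_sub_one_lt h2 (L.div_mem hr (hq.le ha)) ?_)
    (hq.isSqIn_of_unramified h2 he ha ha1)
  rw [show (a + b * s) / a - 1 = b * s / a by field_simp; ring, map_div₀, map_mul, ha1, hs1,
    mul_one, div_one]
  exact hb1

/-- Hilbert 90 in the residue field, for an unramified quadratic extension. -/
theorem IsQuad.exists_absVal_sub_mul_lt (hq : IsQuad K L τ)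
    [FiniteDimensional F L] (he : ramIndex hq.le = 1) {w : Fs} (hw : w ∈ L)
    (hw1 : absVal F Fs w = 1) (h : absVal F Fs (w * τ w - 1) < 1) :
    ∃ z ∈ L, absVal F Fs z = 1 ∧ absVal F Fs (z - w * τ z) < 1 := by
  by_cases h1 : absVal F Fs (1 + w) < 1
  · obtain ⟨s, hs, hs1⟩ := hq.exists_isAnti_of_unramified he
    refine ⟨s, hs.mem, hs1, ?_⟩
    rwa [hs.map_eq, show s - w * -s = (1 + w) * s by ring, map_mul, hs1, mul_one]
  · refine ⟨1 + w, L.add_mem L.one_mem hw, le_antisymm ?_ (not_lt.1 h1), ?_⟩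
    · refine (Valuation.map_add _ _ _).trans (max_le ?_ hw1.le)
      rw [map_one]
    · rwa [map_add, map_one, show 1 + w - w * (1 + τ w) = -(w * τ w - 1) by ring,
        Valuation.map_neg]

open scoped Classical in
theorem sgnResidue_eq (h2 : absVal F Fs 2 = 1) {x : Lˣ} (hx : absVal F Fs (x : L) = 1) :
    sgnResidue x = if IsSqIn L (x : L) then 1 else -1 := by
  have hx' : x ∈ (integers L).unitGroup := mem_unitGroup_iff_absVal.2 hx
  rw [sgnResidue, dif_pos hx', sgn]
  refine if_congr ?_ rfl rfl
  let y : integers L := ((integers L).unitGroupMulEquiv ⟨x, hx'⟩ : (integers L)ˣ)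
  have hy : absVal F Fs (y : L) = 1 := hx
  have h := isSquare_residue_iff h2 hy
  refine Iff.trans ?_ h
  rw [← coe_unitGroupToResidueFieldUnits hx']
  constructor
  · rintro ⟨y, hy⟩
    exact ⟨(y : ResidueField L), by rw [hy, Units.val_mul]⟩
  · rintro ⟨y, hy⟩
    have hy0 : y ≠ 0 := by
      rintro rfl
      rw [zero_mul] at hy
      exact Units.ne_zero _ hy
    exact ⟨Units.mk0 y hy0, Units.ext hy⟩

open scoped Classical in
/-- For `u = v/τ(v)` with `v` a unit, the sign of `u` in `k_L^1` is the sign of `v` in `k_Lˣ`. -/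
theorem IsQuad.sgnResidueNormOne_eq (hq : IsQuad K L τ) (h2 : absVal F Fs 2 = 1)
    [FiniteDimensional F L] (he : ramIndex hq.le = 1) {u v : Lˣ}
    (hv : absVal F Fs (v : L) = 1) (hu : ((u : L) : Fs) = ((v : L) : Fs) / τ ((v : L) : Fs)) :
    sgnResidueNormOne hq.le u = if IsSqIn L (v : L) then 1 else -1 := by
  have hv0 := coe_units_ne_zero v
  have hτv0 : τ ((v : L) : Fs) ≠ 0 := (map_ne_zero τ).2 hv0
  have hττ := hq.involutive
  have hu1 : absVal F Fs (u : L) = 1 := by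
    rw [hu, map_div₀, absVal_gal, div_self (absVal_ne_zero hv0)]
  have huτ : τ ((u : L) : Fs) = ((u : L) : Fs)⁻¹ := by
    rw [hu, map_div₀, hττ _ (v : L).2, inv_div]
  have hu' := hq.hasResidueNormOne h2 he hu1 huτ
  rw [sgnResidueNormOne, dif_pos hu', sgn]
  refine if_congr ?_ rfl rfl
  constructor
  · rintro ⟨⟨w, hw⟩, hw'⟩
    obtain ⟨⟨x, hx⟩, rfl⟩ := (integers L).surjective_unitGroupToResidueFieldUnits w
    have hx1 : absVal F Fs (x : L) = 1 := mem_unitGroup_iff_absVal.1 hx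
    rw [hq.mem_residueNormOne_iff h2 he] at hw
    have hux : absVal F Fs (((u : L) : Fs) - (x : L) * (x : L)) < 1 := by
      have h1 := congrArg (fun y : residueNormOne hq.le => ((y : (ResidueField L)ˣ) :
        ResidueField L)) hw'
      simp only [Subgroup.coe_mul, Units.val_mul] at h1
      rw [coe_unitGroupToResidueFieldUnits, coe_unitGroupToResidueFieldUnits, ← map_mul,
        residue_eq_residue_iff] at h1
      exact h1
    obtain ⟨z, hz, hz1, hzx⟩ := hq.exists_absVal_sub_mul_lt he (x : L).2 hx1 hw
    have hz0 := ne_zero_of_absVal_eq_one hz1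
    have hτz0 : τ z ≠ 0 := (map_ne_zero τ).2 hz0
    have hτz1 : absVal F Fs (τ z) = 1 := (absVal_gal τ z).trans hz1
    have hτv1 : absVal F Fs (τ (v : L)) = 1 := (absVal_gal τ _).trans hv
    -- both `v` and `z²` have image `u` under `y ↦ y/τ(y)` modulo the maximal ideal
    have hr : IsSqIn L ((v : L) / z ^ 2) := by
      refine hq.isSqIn_of_absVal_sub_lt h2 he (L.div_mem (v : L).2 (pow_mem hz 2))
        (by rw [map_div₀, hv, map_pow, hz1, one_pow, div_one]) ?_
      have hid : ((v : L) : Fs) / z ^ 2 - τ ((v : L) / z ^ 2) =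
          τ (v : L) / (z ^ 2 * τ z ^ 2) * (((u : L) - (x : L) * (x : L)) * τ z ^ 2 -
            (z - (x : L) * τ z) * (z + (x : L) * τ z)) := by
        rw [map_div₀, map_pow, hu]
        field_simp
        ring
      rw [hid, map_mul, map_div₀, map_mul, map_pow, map_pow, hz1, hτz1, hτv1, one_pow, one_mul,
        div_one, one_mul]
      refine lt_of_le_of_lt (Valuation.map_sub _ _ _) (max_lt ?_ ?_)
      · rwa [map_mul, map_pow, hτz1, one_pow, mul_one]
      · rw [map_mul]
        refine mul_lt_one_of_lt_of_le hzx ((Valuation.map_add _ _ _).trans (max_le hz1.le ?_))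
        rw [map_mul, hx1, hτz1, one_mul]
    have h3 := hr.mul (⟨z, hz, rfl⟩ : IsSqIn L (z ^ 2))
    rwa [div_mul_cancel₀ _ (pow_ne_zero 2 hz0)] at h3
  · rintro ⟨y, hy, hvy⟩
    have hy0 : y ≠ 0 := by
      rintro rfl
      exact hv0 (hvy.trans (zero_pow two_ne_zero))
    have hτy0 : τ y ≠ 0 := (map_ne_zero τ).2 hy0
    let x : Lˣ := Units.mk0 ⟨y / τ y, L.div_mem hy (hq.map_mem y hy)⟩
      fun h => div_ne_zero hy0 hτy0 (congrArg Subtype.val h)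
    have hx : ((x : L) : Fs) = y / τ y := rfl
    have hxn := hq.hasResidueNormOne h2 he (x := x)
      (by rw [hx, map_div₀, absVal_gal, div_self (absVal_ne_zero hy0)])
      (by rw [hx, map_div₀, hττ y hy, inv_div])
    refine ⟨⟨_, hxn.2⟩, Subtype.ext ?_⟩
    have hux : u = x * x := Units.ext (Subtype.ext (by
      change ((u : L) : Fs) = (y / τ y) * (y / τ y)
      rw [hu, hvy, map_pow]
      field_simp))
    have hsub : (⟨u, hu'.1⟩ : (integers L).unitGroup) = ⟨x, hxn.1⟩ * ⟨x, hxn.1⟩ := Subtype.ext hux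
    change (integers L).unitGroupToResidueFieldUnits ⟨u, hu'.1⟩ = _
    rw [hsub, map_mul]
    rfl

end ResidueNorm

/-! ### Contributions of the orbits -/

section Orbits

variable {F Fs : Type*} [Field F] [ValuativeRel F] [TopologicalSpace F]
  [IsNonarchimedeanLocalField F] [Field Fs] [Algebra F Fs] [IsSepClosure F Fs]
  {A : Type*} [CommRing A] [HopfAlgebra F A] {B : Type*} [CommRing B] [HopfAlgebra F B]
  {R : Type*} [MulAction (Sig F Fs) R] {R' : Type*} [MulAction (Sig F Fs) R']
  {bar : R → Chars F Fs A} (hbar : IsSigmaEquivariant bar)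

/-- The inclusion `{±1} → ℂˣ`. -/
abbrev signHom : ℤˣ →* ℂˣ := Units.map (Int.castRingHom ℂ).toMonoidHom

open scoped Classical in
theorem signHom_ite_pow (P : Prop) (n : ℕ) :
    signHom ((if P then 1 else -1) ^ n) = (if P ∨ Even n then 1 else -1)⁻¹ := by
  have hneg : signHom (-1) = -1 := Units.ext (by simp [signHom])
  rw [map_pow]
  by_cases hP : P
  · simp [hP]
  · rw [if_neg hP, hneg]
    rcases Nat.even_or_odd n with hn | hn
    · rw [hn.neg_one_pow, if_pos (Or.inr hn), inv_one]
    · rw [hn.neg_one_pow, if_neg (not_or.2 ⟨hP, Nat.not_even_iff_odd.2 hn⟩), inv_neg_one]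

open scoped Classical in
/-- On `S(F)_c`, the contribution of each orbit to `ζ_S` is a power of a sign. -/
theorem orbitChar_zetaData (h2 : absVal F Fs 2 = 1) (hR : IsAdmissible F Fs R)
    (hRc : IsContinuousAction F Fs R) (hR' : IsAdmissible F Fs R')
    (hRc' : IsContinuousAction F Fs R') (f : R →[Sig F Fs] R') {χ' : CharFamily F Fs R'}
    (hχ : IsMinimallyRamified χ') {φ : B →ₐc[F] A} (hφ : IsDualToSpan bar φ) {γ : Points F A}
    (hγ : γ ∈ pointsC φ) (α : R) :
    orbitChar hbar (zetaData f χ') α γ = signHom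
      ((if ¬ IsSym F Fs α ∧ IsSymRam F Fs (f α) then
          sgnResidue (charVal hbar α γ) ^ ramIndex (fld_map_le f α) else 1) *
        if IsSymUnram F Fs α ∧ IsSymRam F Fs (f α) then
          sgnResidueNormOne (fldPM_le_fld F Fs α) (charVal hbar α γ) ^ ramIndex (fld_map_le f α)
        else 1) := by
  have := finiteDimensional_fld hRc α
  have hu1 := absVal_charVal hbar hφ hγ α
  by_cases hs : IsSym F Fs α
  · rw [if_neg (fun h => h.1 hs), one_mul, orbitChar, if_pos hs]
    by_cases hun : IsSymUnram F Fs α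
    · obtain ⟨τ, hτ⟩ := hs
      have hq := isQuad_of_gal_eq_neg hR hRc hτ
      -- modulo `F_{±α}ˣ`, where `ζ_α` is trivial, `δ` may be replaced by a unit
      obtain ⟨c, v, hv, hcv⟩ := exists_unitsIncl_mul hRc hun (halfElement α (charVal hbar α γ))
      have hζ := isZetaData_zetaData h2 hR hRc hR' hRc' f hχ
      have hvu : ((charVal hbar α γ : fld F Fs α) : Fs) =
          ((v : fld F Fs α) : Fs) / τ ((v : fld F Fs α) : Fs) := by
        have hc : τ ((c : fldPM F Fs α) : Fs) = ((c : fldPM F Fs α) : Fs) :=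
          hq.apply_eq (c : fldPM F Fs α).2
        have hval : (((unitsIncl (fldPM_le_fld F Fs α) c * v : (fld F Fs α)ˣ) : fld F Fs α) :
          Fs) = ((c : fldPM F Fs α) : Fs) * ((v : fld F Fs α) : Fs) := rfl
        rw [← halfElement_spec hR hRc hτ (apply_charVal hbar hτ γ), hcv, hval, map_mul, hc,
          mul_div_mul_left _ _ (coe_units_ne_zero c)]
      rw [hcv, map_mul, hζ.restrict α ⟨τ, hτ⟩, one_mul, zetaData_of_isSymUnram f hun,
        (unramExtension_spec h2 hR hRc hun).1 (mem_unitGroup_iff_absVal.2 hv), one_mul]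
      by_cases hα : IsSymRam F Fs (f α)
      · rw [if_pos ⟨hun, hα⟩, hq.sgnResidueNormOne_eq h2 hun.2 hv hvu, signHom_ite_pow,
          infData_unit_of_symRam h2 hRc hR' hRc' f hχ hα hv]
      · rw [if_neg (fun h => hα h.2), map_one, infData_unit_of_not_symRam hRc f hχ hα hv, inv_one]
    · rw [if_neg (fun h => hun h.1), map_one, zetaData_of_isSym_of_not f hs hun,
        MonoidHom.one_apply]
  · rw [if_neg (fun h : IsSymUnram F Fs α ∧ _ => hs h.1.1), mul_one, orbitChar, if_neg hs,
      zetaData_of_not_isSym f hs]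
    by_cases hα : IsSymRam F Fs (f α)
    · rw [if_pos ⟨hs, hα⟩, sgnResidue_eq h2 hu1, signHom_ite_pow,
        infData_unit_of_symRam h2 hRc hR' hRc' f hχ hα hu1]
    · rw [if_neg (fun h => hα h.2), map_one, infData_unit_of_not_symRam hRc f hχ hα hu1, inv_one]

theorem zetaS_zetaData [Finite R] (h2 : absVal F Fs 2 = 1) (hR : IsAdmissible F Fs R)
    (hRc : IsContinuousAction F Fs R) (hR' : IsAdmissible F Fs R')
    (hRc' : IsContinuousAction F Fs R') (f : R →[Sig F Fs] R') {χ' : CharFamily F Fs R'}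
    (hχ : IsMinimallyRamified χ') {φ : B →ₐc[F] A} (hφ : IsDualToSpan bar φ) {γ : Points F A}
    (hγ : γ ∈ pointsC φ) :
    zetaS hbar (zetaData f χ') γ = signHom (signProduct hbar f γ) := by
  rw [signProduct, ← finprod_mul_distrib (Set.toFinite _) (Set.toFinite _),
    MonoidHom.map_finprod _ (Set.toFinite _), zetaS]
  exact finprod_congr fun O => orbitChar_zetaData hbar h2 hR hRc hR' hRc' f hχ hφ hγ O.out

end Orbits

end TorusSigns

end

theorem mainTheorem11
    {F : Type*} [Field F] [ValuativeRel F] [TopologicalSpace F] [IsNonarchimedeanLocalField F]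
    (hp : ringChar (IsLocalRing.ResidueField (ValuativeRel.valuation F).integer) ≠ 2)
    {Fs : Type*} [Field Fs] [Algebra F Fs] [IsSepClosure F Fs]
    -- the torus `S`
    {A : Type*} [CommRing A] [HopfAlgebra F A] (hS : TorusSigns.IsTorus F Fs A)
    -- the finite admissible `Σ`-sets `R` and `R'`
    {R : Type*} [Finite R] [MulAction (TorusSigns.Sig F Fs) R]
    (hR : TorusSigns.IsAdmissible F Fs R) (hRc : TorusSigns.IsContinuousAction F Fs R)
    {R' : Type*} [Finite R'] [MulAction (TorusSigns.Sig F Fs) R']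
    (hR' : TorusSigns.IsAdmissible F Fs R') (hRc' : TorusSigns.IsContinuousAction F Fs R')
    -- the `Σ`-equivariant map `R → X^*(S)` and the surjective `Σ`-equivariant map `R → R'`
    (bar : R → TorusSigns.Chars F Fs A) (hbar : TorusSigns.IsSigmaEquivariant bar)
    (f : R →[TorusSigns.Sig F Fs] R') (hf : Function.Surjective f)
    -- the torus `T` whose character module is the span of `R`, and the natural map `S → T`
    {B : Type*} [CommRing B] [HopfAlgebra F B] (hT : TorusSigns.IsTorus F Fs B)
    (φ : B →ₐc[F] A) (hφ : TorusSigns.IsDualToSpan bar φ) :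
    -- the terms of the product make sense
    (∀ γ ∈ TorusSigns.pointsC φ, ∀ α : R,
      TorusSigns.charVal hbar α γ ∈ (TorusSigns.integers (TorusSigns.fld F Fs α)).unitGroup ∧
      (TorusSigns.IsSymUnram F Fs α →
        TorusSigns.HasResidueNormOne (TorusSigns.fldPM_le_fld F Fs α)
          (TorusSigns.charVal hbar α γ))) ∧
    -- the formula for the restriction of the character `ζ_S`
    (∀ χ' : TorusSigns.CharFamily F Fs R', TorusSigns.IsMinimallyRamified χ' →
      TorusSigns.IsZetaData (TorusSigns.zetaData f χ') ∧
      ∃ ζS : TorusSigns.Points F A →* ℂˣ,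
        (∀ γ, ζS γ = TorusSigns.zetaS hbar (TorusSigns.zetaData f χ') γ) ∧
        ∀ γ ∈ TorusSigns.pointsC φ,
          ζS γ = Units.map (Int.castRingHom ℂ).toMonoidHom (TorusSigns.signProduct hbar f γ)) ∧
    -- independence of `χ'`
    (∀ χ₁ χ₂ : TorusSigns.CharFamily F Fs R',
      TorusSigns.IsMinimallyRamified χ₁ → TorusSigns.IsMinimallyRamified χ₂ →
      ∀ γ ∈ TorusSigns.pointsC φ,
        TorusSigns.zetaS hbar (TorusSigns.zetaData f χ₁) γ =
          TorusSigns.zetaS hbar (TorusSigns.zetaData f χ₂) γ) := by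
  have h2 := TorusSigns.absVal_two (Fs := Fs) hp
  refine ⟨fun γ hγ α => ?_, fun χ' hχ => ?_, fun χ₁ χ₂ h₁ h₂ γ hγ => ?_⟩
  · have hu := TorusSigns.absVal_charVal hbar hφ hγ α
    refine ⟨TorusSigns.mem_unitGroup_iff_absVal.2 hu, fun hα => ?_⟩
    obtain ⟨⟨τ, hτ⟩, he⟩ := hα
    have := TorusSigns.finiteDimensional_fld hRc α
    exact (TorusSigns.isQuad_of_gal_eq_neg hR hRc hτ).hasResidueNormOne h2 he hu
      (TorusSigns.apply_charVal hbar hτ γ)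
  · have hζ := TorusSigns.isZetaData_zetaData h2 hR hRc hR' hRc' f hχ
    exact ⟨hζ, TorusSigns.zetaHom hbar hR hRc hζ, fun _ => rfl,
      fun γ hγ => TorusSigns.zetaS_zetaData hbar h2 hR hRc hR' hRc' f hχ hφ hγ⟩
  · rw [TorusSigns.zetaS_zetaData hbar h2 hR hRc hR' hRc' f h₁ hφ hγ,
      TorusSigns.zetaS_zetaData hbar h2 hR hRc hR' hRc' f h₂ hφ hγ]
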